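/- **Conventions.** Let $\mathbb K$ be an algebraic closure of $\mathbb C(t_0,t_1)$, with square roots $t_0^{1/2}$, $t_1^{1/2}$ and $Y=((t_0-1)(1-t_1))^{1/2}$, and let $W$ be the $\mathbb K$-vector space with basis $e_1,\dots,e_4$. Let $R\in\mathrm{End}(W\otimes W)$ be the Links–Gould R-matrix: with $e_{ij}=e_i\otimes e_j$, $j\in\{2,3\}$, it maps $e_{11}\mapsto t_0e_{11}$, $e_{22}\mapsto -e_{22}$, $e_{33}\mapsto -e_{33}$, $e_{44}\mapsto t_1e_{44}$, $e_{1j}\mapsto t_0^{1/2}e_{j1}$, $e_{j1}\mapsto t_0^{1/2}e_{1j}+(t_0-1)e_{j1}$, $e_{j4}\mapsto t_1^{1/2}e_{4j}$, $e_{4j}\mapsto t_1^{1/2}e_{j4}+(t_1-1)e_{4j}$, $e_{14}\mapsto e_{41}$, $e_{23}\mapsto (t_0t_1-1)e_{23}-t_0^{1/2}t_1^{1/2}e_{32}-t_0^{1/2}t_1^{1/2}Y\,e_{41}$, $e_{32}\mapsto -t_0^{1/2}t_1^{1/2}e_{23}+Y\,e_{41}$, $e_{41}\mapsto e_{14}-t_0^{1/2}t_1^{1/2}Y\,e_{23}+Y\,e_{32}+Y^2e_{41}$.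 Let $\mu=\mathrm{diag}(t_0^{-1},-t_1,-t_0^{-1},t_1)\in\mathrm{End}(W)$. For a braid $\beta\in B_n$ let $b_R(\beta)\in\mathrm{End}(W^{\otimes n})$ be the operator obtained by letting each generator $\sigma_i$ (a positive crossing) act by $R$ on the factors $i,i+1$. The Links–Gould polynomial $LG(L;t_0,t_1)\in\mathbb Z[t_0^{\pm1},t_1^{\pm1}]$ of an oriented link $L$ is characterized by $$\mathrm{trace}_{2,\dots,n}\bigl((\mathrm{id}_W\otimes\mu^{\otimes(n-1)})\circ b_R(\beta)\bigr)=LG(L;t_0,t_1)\cdot \mathrm{id}_W\quad\text{for every } n\ge1 \text{ and every braid }\beta\in B_n\text{ with closure } L.$$ For $P=\sum a_{ij}t_0^it_1^j\ne0$ put $\mathrm{span}(P)=\max\{i-j: a_{ij}\neq0\}-\min\{i-j: a_{ij}\ne0\}$. For $m\ge1$ and integers $b_1,\dots,b_m$, let $D(b_1,\dots,b_m)$ be the following oriented 2-bridge link. Take four vertical strands, oriented alternately up, down, up, down. At the bottom join strands 2, 3 and strands 1, 4. Above this place the 3-braid $S_1^{-2b_1}S_2^{2b_2}S_1^{-2b_3}\cdots$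 ($m$ factors) on strands 1, 2, 3, where each $S_1^{-2}$ is a full twist of strands 1, 2 with two negative crossings and each $S_2^{2}$ is a full twist of strands 2, 3 with two positive crossings. At the top join strands 1, 2 and strands 3, 4 if $m$ is even, strands 2, 3 and strands 1, 4 if $m$ is odd. **Theorem.** For every $m\ge 1$ and all integers $b_1,\dots,b_m>0$, there is a Laurent polynomial $LG(D(b_1,\dots,b_m))\in\mathbb Z[t_0^{\pm1},t_1^{\pm1}]$ as characterized above, and $$\mathrm{span}\bigl(LG(D(b_1,\dots,b_m))\bigr)=2m.$$ -/

import Mathlib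

namespace LinksGould

/-! ### Oriented link diagrams

Oriented tangle diagrams are put in Morse position and read from bottom to top.  A horizontal level
that misses the singular points is a list of orientations (`true` for a strand that runs upwards,
`false` for one that runs downwards), and the diagram is a sequence of slices each of which holds one
crossing, one local minimum or one local maximum. -/

/-- The elementary pieces of a tangle diagram.
* `crossing a b o`: two strands cross; at the bottom the left one has orientation `a` and the right
  one has orientation `b`.  The strand from bottom left to top right is the over-strand if `o = true`
  and the under-strand if `o = false`.  (So `crossing true true true` is a positive crossing.)
* `cup a`: a local minimum, whose left leg has orientation `a`.
* `cap a`: a local maximum, whose left leg has orientation `a`. -/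
inductive Gen : Type
  | crossing (a b o : Bool) : Gen
  | cup (a : Bool) : Gen
  | cap (a : Bool) : Gen

/-- Orientations of the strands at the bottom of a piece. -/
def Gen.dom : Gen → List Bool
  | .crossing a b _ => [a, b]
  | .cup _ => []
  | .cap a => [a, !a]

/-- Orientations of the strands at the top of a piece. -/
def Gen.cod : Gen → List Bool
  | .crossing a b _ => [b, a]
  | .cup a => [a, !a]
  | .cap _ => []

/-- A slice: an elementary piece with vertical strands on its left and on its right. -/
structure Slice : Type where
  left : List Bool
  gen : Gen
  right : List Bool

def Slice.source (x : Slice) : List Bool := x.left ++ x.gen.dom ++ x.right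

def Slice.target (x : Slice) : List Bool := x.left ++ x.gen.cod ++ x.right

/-- `IsTangle s w t`: the slices of `w`, stacked from bottom to top, fit together to a tangle diagram
with bottom level `s` and top level `t`. -/
def IsTangle : List Bool → List Slice → List Bool → Prop
  | s, [], t => s = t
  | s, x :: w, t => x.source = s ∧ IsTangle x.target w t

theorem IsTangle.append {s t r : List Bool} {v w : List Slice}
    (hv : IsTangle s v t) (hw : IsTangle t w r) : IsTangle s (v ++ w) r := by
  induction v generalizing s with
  | nil =>
    have h : s = t := hv
    subst h
    exact hw
  | cons x v ih => exact ⟨hv.1, ih hv.2⟩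

theorem IsTangle.flatten {s : List Bool} {l : List (List Slice)}
    (h : ∀ w ∈ l, IsTangle s w s) : IsTangle s l.flatten s := by
  induction l with
  | nil => exact rfl
  | cons w l ih =>
    rw [List.flatten_cons]
    exact (h w (by simp)).append (ih fun v hv => h v (by simp [hv]))

/-- Add vertical strands `l` on the left and `r` on the right of a diagram. -/
def whisker (l r : List Bool) (w : List Slice) : List Slice :=
  w.map fun x => ⟨l ++ x.left, x.gen, x.right ++ r⟩

/-- The elementary moves between tangle diagrams in Morse position. -/
inductive ElemMove : List Slice → List Slice → Prop
  /-- Planar isotopy: two pieces side by side exchange their heights. -/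
  | exchange (g h : Gen) (m : List Bool) :
      ElemMove [⟨[], g, m ++ h.dom⟩, ⟨g.cod ++ m, h, []⟩]
        [⟨g.dom ++ m, h, []⟩, ⟨[], g, m ++ h.cod⟩]
  /-- Planar isotopy: a minimum and a maximum on one strand cancel. -/
  | zigzagRight (a : Bool) :
      ElemMove [⟨[a], .cup (!a), []⟩, ⟨[], .cap a, [a]⟩] []
  /-- Planar isotopy: a minimum and a maximum on one strand cancel. -/
  | zigzagLeft (a : Bool) :
      ElemMove [⟨[], .cup a, [a]⟩, ⟨[a], .cap (!a), []⟩] []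
  /-- A strand moves over or under a local maximum. -/
  | slideCap (a c o : Bool) :
      ElemMove [⟨[c], .cap a, []⟩]
        [⟨[], .crossing c a o, [!a]⟩, ⟨[a], .crossing c (!a) o, []⟩, ⟨[], .cap a, [c]⟩]
  /-- A strand moves over or under a local minimum. -/
  | slideCup (a c o : Bool) :
      ElemMove [⟨[c], .cup a, []⟩]
        [⟨[], .cup a, [c]⟩, ⟨[a], .crossing (!a) c o, []⟩, ⟨[], .crossing a c o, [!a]⟩]
  /-- First Reidemeister move, curl on the right of the strand. -/
  | reidemeisterOneRight (a o : Bool) :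
      ElemMove [⟨[a], .cup a, []⟩, ⟨[], .crossing a a o, [!a]⟩, ⟨[a], .cap a, []⟩] []
  /-- First Reidemeister move, curl on the left of the strand. -/
  | reidemeisterOneLeft (a o : Bool) :
      ElemMove [⟨[], .cup (!a), [a]⟩, ⟨[!a], .crossing a a o, []⟩, ⟨[], .cap (!a), [a]⟩] []
  /-- Second Reidemeister move. -/
  | reidemeisterTwo (a b o : Bool) :
      ElemMove [⟨[], .crossing a b o, []⟩, ⟨[], .crossing b a (!o), []⟩] []
  /-- Third Reidemeister move. -/
  | reidemeisterThree (a b c : Bool) :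
      ElemMove
        [⟨[], .crossing a b true, [c]⟩, ⟨[b], .crossing a c true, []⟩,
          ⟨[], .crossing b c true, [a]⟩]
        [⟨[a], .crossing b c true, []⟩, ⟨[], .crossing a c true, [b]⟩,
          ⟨[c], .crossing a b true, []⟩]

/-- An oriented link diagram: a tangle diagram without end points. -/
structure LinkDiagram : Type where
  word : List Slice
  closed : IsTangle [] word []

/-- Two link diagrams differ by one elementary move, applied somewhere inside the diagram. -/
def LinkDiagram.Move (D E : LinkDiagram) : Prop :=
  ∃ (u v : List Slice) (l r : List Bool) (p q : List Slice), ElemMove p q ∧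
    D.word = u ++ whisker l r p ++ v ∧ E.word = u ++ whisker l r q ++ v

/-- Oriented links up to isotopy: oriented link diagrams modulo the equivalence relation that is
generated by the elementary moves. -/
def OrientedLink : Type := Quot LinkDiagram.Move

/-- The oriented link that a diagram represents. -/
def LinkDiagram.toLink (D : LinkDiagram) : OrientedLink := Quot.mk _ D

/-! ### Braids and their closures -/

/-- A word in the generators of the braid group on `k + 1` strands: `(i, true)` stands for
the generator `σ_{i+1}` and `(i, false)` for its inverse. -/
abbrev BraidWord (k : ℕ) : Type := List (Fin k × Bool)

/-- The slice of a letter; the `k + 1` strands of the braid run upwards, and on their right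
there are the `k + 1` downward strands of the closure. -/
def braidSlice {k : ℕ} (x : Fin k × Bool) : Slice :=
  ⟨List.replicate x.1 true, .crossing true true x.2,
    List.replicate (k - 1 - x.1) true ++ List.replicate (k + 1) false⟩

/-- `n` nested local minima. -/
def nestedCups : ℕ → List Slice
  | 0 => []
  | n + 1 => nestedCups n ++ [⟨List.replicate n true, .cup true, List.replicate n false⟩]

/-- `n` nested local maxima. -/
def nestedCaps : ℕ → List Slice
  | 0 => []
  | n + 1 => ⟨List.replicate n true, .cap true, List.replicate n false⟩ :: nestedCaps n

theorem isTangle_nestedCups (n : ℕ) :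
    IsTangle [] (nestedCups n) (List.replicate n true ++ List.replicate n false) := by
  induction n with
  | zero => exact rfl
  | succ n ih =>
    refine ih.append ⟨by simp [Slice.source, Gen.dom], ?_⟩
    show Slice.target _ = _
    simp [Slice.target, Gen.cod, List.replicate_succ' (n := n) (a := true),
      List.replicate_succ (n := n) (a := false)]

theorem isTangle_nestedCaps (n : ℕ) :
    IsTangle (List.replicate n true ++ List.replicate n false) (nestedCaps n) [] := by
  induction n with
  | zero => exact rfl
  | succ n ih =>
    refine ⟨?_, ?_⟩
    · simp [Slice.source, Gen.dom, List.replicate_succ' (n := n) (a := true),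
        List.replicate_succ (n := n) (a := false)]
    · simpa [Slice.target, Gen.cod] using ih

theorem isTangle_braid {k : ℕ} (β : BraidWord k) :
    IsTangle (List.replicate (k + 1) true ++ List.replicate (k + 1) false) (β.map braidSlice)
      (List.replicate (k + 1) true ++ List.replicate (k + 1) false) := by
  induction β with
  | nil => exact rfl
  | cons x β ih =>
    have hk : List.replicate (k + 1) true =
        List.replicate x.1 true ++ ([true, true] ++ List.replicate (k - 1 - x.1) true) := by
      have h : k + 1 = x.1 + (2 + (k - 1 - x.1)) := by have := x.1.2; omega
      rw [h, List.replicate_add, List.replicate_add]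
      congr 3
    refine ⟨?_, ?_⟩
    · rw [hk]
      simp [braidSlice, Slice.source, Gen.dom]
    · have h : (braidSlice x).target =
          List.replicate (k + 1) true ++ List.replicate (k + 1) false := by
        rw [hk]
        simp [braidSlice, Slice.target, Gen.cod]
      show IsTangle (braidSlice x).target _ _
      rw [h]
      exact ih

/-- The closure of a braid. -/
def braidClosure {k : ℕ} (β : BraidWord k) : LinkDiagram where
  word := nestedCups (k + 1) ++ (β.map braidSlice ++ nestedCaps (k + 1))
  closed := (isTangle_nestedCups _).append ((isTangle_braid β).append (isTangle_nestedCaps _))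

/-! ### The 2-bridge links `D(b₁, …, bₘ)`

Four strands with orientations up, down, up, down.  At the bottom the strands 2, 3 and the strands
1, 4 are joined.  Then follows the 3-braid `S₁^(-2b₁) S₂^(2b₂) S₁^(-2b₃) ⋯` on the first three
strands.  At the top the strands 1, 2 and 3, 4 are joined if `m` is even, the strands 2, 3 and 1, 4 if
`m` is odd. -/

/-- The full twist `S₁⁻²`, two negative crossings of the antiparallel strands 1 and 2. -/
def fullTwistOne : List Slice :=
  [⟨[], .crossing true false true, [true, false]⟩, ⟨[], .crossing false true true, [true, false]⟩]

/-- The full twist `S₂²`, two positive crossings of the antiparallel strands 2 and 3. -/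
def fullTwistTwo : List Slice :=
  [⟨[true], .crossing false true false, [false]⟩, ⟨[true], .crossing true false false, [false]⟩]

/-- The 3-braid `S₁^(-2b₁) S₂^(2b₂) ⋯`; the index `i : Fin m` stands for `b_{i+1}`. -/
def twistRegions {m : ℕ} (b : Fin m → ℕ) : List Slice :=
  ((List.finRange m).map fun i =>
    (List.replicate (b i) (if Even (i : ℕ) then fullTwistOne else fullTwistTwo)).flatten).flatten

/-- The arcs at the bottom. -/
def bottomArcs : List Slice := [⟨[], .cup true, []⟩, ⟨[true], .cup false, [false]⟩]

theorem isTangle_bottomArcs : IsTangle [] bottomArcs [true, false, true, false] :=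
  ⟨rfl, rfl, rfl⟩

/-- The arcs at the top. -/
def topArcs (m : ℕ) : List Slice :=
  if Even m then [⟨[], .cap true, [true, false]⟩, ⟨[], .cap true, []⟩]
  else [⟨[true], .cap false, [false]⟩, ⟨[], .cap true, []⟩]

theorem isTangle_twistRegions {m : ℕ} (b : Fin m → ℕ) :
    IsTangle [true, false, true, false] (twistRegions b) [true, false, true, false] := by
  refine IsTangle.flatten fun w hw => ?_
  obtain ⟨i, -, rfl⟩ := List.mem_map.1 hw
  refine IsTangle.flatten fun v hv => ?_
  rw [List.eq_of_mem_replicate hv]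
  split_ifs
  · exact ⟨rfl, rfl, rfl⟩
  · exact ⟨rfl, rfl, rfl⟩

theorem isTangle_topArcs (m : ℕ) : IsTangle [true, false, true, false] (topArcs m) [] := by
  unfold topArcs
  split_ifs
  · exact ⟨rfl, rfl, rfl⟩
  · exact ⟨rfl, rfl, rfl⟩

/-- The diagram of the oriented 2-bridge link `D(b₁, …, bₘ)`. -/
def twoBridge {m : ℕ} (b : Fin m → ℕ) : LinkDiagram where
  word := bottomArcs ++ (twistRegions b ++ topArcs m)
  closed := isTangle_bottomArcs.append ((isTangle_twistRegions b).append (isTangle_topArcs m))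

/-! ### The Links–Gould invariant -/

/-- The ground field, an algebraically closed field that contains `ℂ(t₀, t₁)`. -/
abbrev 𝕂 : Type := AlgebraicClosure (FractionRing (MvPolynomial (Fin 2) ℂ))

noncomputable section

def t₀ : 𝕂 := algebraMap (FractionRing (MvPolynomial (Fin 2) ℂ)) 𝕂
  (algebraMap (MvPolynomial (Fin 2) ℂ) _ (MvPolynomial.X 0))

def t₁ : 𝕂 := algebraMap (FractionRing (MvPolynomial (Fin 2) ℂ)) 𝕂
  (algebraMap (MvPolynomial (Fin 2) ℂ) _ (MvPolynomial.X 1))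

/-- A square root in `𝕂`. -/
def root (x : 𝕂) : 𝕂 := (IsAlgClosed.exists_pow_nat_eq x (n := 2) two_pos).choose

theorem root_sq (x : 𝕂) : root x ^ 2 = x :=
  (IsAlgClosed.exists_pow_nat_eq x (n := 2) two_pos).choose_spec

/-- `t₀^(1/2)` -/
def s₀ : 𝕂 := root t₀

/-- `t₁^(1/2)` -/
def s₁ : 𝕂 := root t₁

/-- `Y = ((t₀ - 1)(1 - t₁))^(1/2)` -/
def Y : 𝕂 := root ((t₀ - 1) * (1 - t₁))

/-- The Links–Gould R-matrix on `W ⊗ W`, where `W` has the basis `e₁, …, e₄` (here indexed by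
`0, …, 3`): the coefficient of `R (e_k ⊗ e_l)` at `e_i ⊗ e_j` is `R (i, j) (k, l)`.  It satisfies the
Yang–Baxter equation and `(R - t₀)(R - t₁)(R + 1) = 0`; in particular it is invertible. -/
def R : Matrix (Fin 4 × Fin 4) (Fin 4 × Fin 4) 𝕂 := fun p q =>
  match p, q with
  | (0, 0), (0, 0) => t₀
  | (1, 1), (1, 1) => -1
  | (2, 2), (2, 2) => -1
  | (3, 3), (3, 3) => t₁
  | (0, 1), (1, 0) => s₀
  | (1, 0), (0, 1) => s₀
  | (1, 0), (1, 0) => t₀ - 1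
  | (0, 2), (2, 0) => s₀
  | (2, 0), (0, 2) => s₀
  | (2, 0), (2, 0) => t₀ - 1
  | (1, 3), (3, 1) => s₁
  | (3, 1), (1, 3) => s₁
  | (3, 1), (3, 1) => t₁ - 1
  | (2, 3), (3, 2) => s₁
  | (3, 2), (2, 3) => s₁
  | (3, 2), (3, 2) => t₁ - 1
  | (0, 3), (3, 0) => 1
  | (3, 0), (0, 3) => 1
  | (1, 2), (1, 2) => t₀ * t₁ - 1
  | (1, 2), (2, 1) => -(s₀ * s₁)
  | (2, 1), (1, 2) => -(s₀ * s₁)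
  | (1, 2), (3, 0) => -(s₀ * s₁ * Y)
  | (3, 0), (1, 2) => -(s₀ * s₁ * Y)
  | (2, 1), (3, 0) => Y
  | (3, 0), (2, 1) => Y
  | (3, 0), (3, 0) => Y ^ 2
  | _, _ => 0

/-- The diagonal entries of `μ ∈ End(W)`. -/
def μ : Fin 4 → 𝕂 := ![t₀⁻¹, -t₁, -t₀⁻¹, t₁]

/-- The operator of one letter on `W^{⊗(k+1)}`: `R` or its inverse on the tensor factors `i`, `i + 1`
and the identity on the others.  The basis of `W^{⊗(k+1)}` is indexed by `Fin (k + 1) → Fin 4`. -/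
def letterOp {k : ℕ} (x : Fin k × Bool) :
    Matrix (Fin (k + 1) → Fin 4) (Fin (k + 1) → Fin 4) 𝕂 := fun f g =>
  if ∀ j, j ≠ x.1.castSucc → j ≠ x.1.succ → f j = g j then
    (if x.2 then R else R⁻¹) (f x.1.castSucc, f x.1.succ) (g x.1.castSucc, g x.1.succ)
  else 0

/-- The operator `b_R(β)` on `W^{⊗(k+1)}`; the first letter of `β` (the lowest one in the diagram)
acts first. -/
def braidOp {k : ℕ} (β : BraidWord k) :
    Matrix (Fin (k + 1) → Fin 4) (Fin (k + 1) → Fin 4) 𝕂 :=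
  β.foldl (fun M x => letterOp x * M) 1

/-- `trace_{2, …, k+1} ((id ⊗ μ^{⊗k}) ∘ M)`, an endomorphism of `W`. -/
def quantumTrace {k : ℕ} (M : Matrix (Fin (k + 1) → Fin 4) (Fin (k + 1) → Fin 4) 𝕂) :
    Matrix (Fin 4) (Fin 4) 𝕂 := fun i j =>
  ∑ f : Fin k → Fin 4, (∏ l, μ (f l)) * M (Fin.cons i f) (Fin.cons j f)

/-- Laurent polynomials in `ℤ[t₀^{±1}, t₁^{±1}]`; the coefficient of `t₀^i t₁^j` in `P`
is `P.coeff (i, j)`. -/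
abbrev Laurent : Type := AddMonoidAlgebra ℤ (ℤ × ℤ)

/-- A Laurent polynomial as an element of `𝕂`. -/
def Laurent.toField (P : Laurent) : 𝕂 :=
  P.coeff.sum fun e a => (a : 𝕂) * (t₀ ^ e.1 * t₁ ^ e.2)

/-- The span of a Laurent polynomial for the degree `deg (t₀^n t₁^m) = n - m`
(and `0` for the zero polynomial, whose span is not defined). -/
def span (P : Laurent) : ℤ :=
  if h : P.coeff.support.Nonempty then
    P.coeff.support.sup' h (fun e => e.1 - e.2) - P.coeff.support.inf' h (fun e => e.1 - e.2)
  else 0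

/-- `P` is the Links–Gould polynomial of the oriented link `L`: for every braid `β` with closure `L`,
on any number of strands, `trace_{2, …, n} ((id ⊗ μ^{⊗(n-1)}) ∘ b_R(β)) = P • id_W`.
Every oriented link is the closure of a braid, and `t₀`, `t₁` are algebraically
independent, so that `P` is determined by `L`. -/
def IsLinksGould (L : OrientedLink) (P : Laurent) : Prop :=
  ∀ (k : ℕ) (β : BraidWord k), (braidClosure β).toLink = L →
    quantumTrace (braidOp β) = P.toField • (1 : Matrix (Fin 4) (Fin 4) 𝕂)

end

end LinksGould

/-!
The R-matrix `R` and the weights `μ` define an operator `wordOp` for every oriented tangle diagram in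
Morse position: the extrema carry the weights, and a crossing of any orientation is a rotated crossing
of two upward strands (`rotatedCrossing_check`).  The operator is invariant under the elementary moves
(`ElemMove.agreeOn`).  Apart from the Yang–Baxter equation, which gives that a strand slides across
every tangle (`tangle_natural`) and hence the third Reidemeister move for all orientations, the moves
are finite identities between explicit tensors; they are decided in the kernel, with coefficients in
a normal form for polynomials in `t₀^(±1/2)`, `t₁^(±1/2)`, `Y`.

Since the weights have the sum zero, closed diagrams evaluate to zero (`wordOp_closed`), and one cuts
a strand open instead.  The sliding of an auxiliary strand in fixed states yields linear relations
between the matrix entries of a tangle.  They imply that a tangle with one upward strand acts by a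
scalar (`entry_upward`), and that the left and the right partial trace of a tangle with two strands
agree (`partialTrace_eq`).  So all strands of a level (`cutVal_eq_cutLevel`), and then all nonempty
levels (`cutLevel_word`), give the same value, and this value is an invariant of the link
(`HasCutValue.of_toLink_eq`).  For the closure of a braid it is the scalar by which the quantum trace
acts (`quantumTrace_of_hasCutValue`), so it is the Links–Gould polynomial of any link for which it is
a Laurent polynomial.

For a 2-bridge link it is computed in the space spanned by three vectors of `W^{⊗4}`: the two ways `f`,
`f'` to join four strands by arcs, and `g = T f - f`, where `T` is a full twist that fixes `f'`.  With
`ζ = (t₀ t₁)^{±1}` and with `ω` equal to `(t₀ - 1) (t₁ - 1)` up to a power of `t₀ t₁`, one has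
`T g = ζ g - 2 ω f'` and `g = -ω (f + f') - ζ g'`, where `g'` belongs to the other kind of twists
(`twist_twistVec`, `twistVec_eq`).  In the grading `i - j` of `t₀^i t₁^j` the factor `ζ` has degree `0`,
and `ω` has the extreme degrees `1` and `-1`, both with the coefficient `-1`.  Therefore each twist
region with `n` full twists raises the extreme degrees of the coefficient of the arcs by one, and
multiplies the sums of the extreme coefficients by `n²` (`hasEdges_finalState`).  The products of
the `bᵢ²` are not zero, so that the span is `2 m`.
-/

namespace LinksGould

/-! ### The ground field and coefficients in normal form -/

theorem s₀_sq : s₀ ^ 2 = t₀ := root_sq _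
theorem s₁_sq : s₁ ^ 2 = t₁ := root_sq _
theorem Y_sq : Y ^ 2 = (t₀ - 1) * (1 - t₁) := root_sq _

theorem algebraMap_MvPolynomial_injective :
    Function.Injective (fun p : MvPolynomial (Fin 2) ℂ =>
      algebraMap (FractionRing (MvPolynomial (Fin 2) ℂ)) 𝕂
        (algebraMap (MvPolynomial (Fin 2) ℂ) _ p)) :=
  (algebraMap (FractionRing (MvPolynomial (Fin 2) ℂ)) 𝕂).injective.comp
    (IsFractionRing.injective _ _)

theorem t₀_ne_zero : t₀ ≠ 0 := fun h =>
  MvPolynomial.X_ne_zero (R := ℂ) (0 : Fin 2)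
    (algebraMap_MvPolynomial_injective (h.trans (by simp)))

theorem t₁_ne_zero : t₁ ≠ 0 := fun h =>
  MvPolynomial.X_ne_zero (R := ℂ) (1 : Fin 2)
    (algebraMap_MvPolynomial_injective (h.trans (by simp)))

theorem s₀_ne_zero : s₀ ≠ 0 := fun h => t₀_ne_zero (by rw [← s₀_sq, h]; simp)
theorem s₁_ne_zero : s₁ ≠ 0 := fun h => t₁_ne_zero (by rw [← s₁_sq, h]; simp)

/-- The monomial `coef * t₀^(exp₀/2) * t₁^(exp₁/2)`, times `Y` if `hasY` holds.  Together with sums these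
are closed under products, because `Y²` is a polynomial; all coefficients that occur are of this form,
so that identities between operators can be decided in the kernel. -/
structure Mono where
  coef : ℤ
  exp₀ : ℤ
  exp₁ : ℤ
  hasY : Bool

namespace Mono

/-- The value of a monomial in the ground field. -/
noncomputable def eval (m : Mono) : 𝕂 :=
  m.coef * (s₀ ^ m.exp₀ * s₁ ^ m.exp₁ * if m.hasY then Y else 1)

/-- Whether two monomials differ at most in their integer coefficient. -/
def sameExp (m n : Mono) : Bool :=
  m.exp₀ == n.exp₀ && (m.exp₁ == n.exp₁ && m.hasY == n.hasY)

/-- The product as a sum of monomials: `Y * Y = t₀ - t₀ t₁ - 1 + t₁`. -/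
def mul (m n : Mono) : List Mono :=
  let c := m.coef * n.coef
  let a := m.exp₀ + n.exp₀
  let b := m.exp₁ + n.exp₁
  if m.hasY && n.hasY then
    [⟨c, a + 2, b, false⟩, ⟨-c, a + 2, b + 2, false⟩, ⟨-c, a, b, false⟩, ⟨c, a, b + 2, false⟩]
  else [⟨c, a, b, m.hasY || n.hasY⟩]

end Mono

/-- A formal sum of monomials, which stands for an element of the ground field. -/
abbrev Coef := List Mono

namespace Coef

/-- The value of a formal sum in the ground field. -/
noncomputable def eval (p : Coef) : 𝕂 := (p.map Mono.eval).sum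

@[simp] theorem eval_nil : eval [] = 0 := rfl
@[simp] theorem eval_cons (m : Mono) (p : Coef) : eval (m :: p) = m.eval + eval p := by
  simp [eval]

/-- Add one monomial, collecting equal exponents and dropping zero terms: the sum of two collected sums
is `[]` exactly if all coefficients cancel. -/
def insert (m : Mono) : Coef → Coef
  | [] => [m]
  | n :: p =>
    if m.sameExp n then
      (if m.coef + n.coef == 0 then p else ⟨m.coef + n.coef, n.exp₀, n.exp₁, n.hasY⟩ :: p)
    else n :: insert m p

/-- The sum, with equal exponents collected. -/
def add (p q : Coef) : Coef := p.foldr insert q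

/-- The product, with equal exponents collected. -/
def mul (p q : Coef) : Coef :=
  p.foldr (fun m acc => q.foldr (fun n acc => add (m.mul n) acc) acc) []

theorem eval_insert (m : Mono) (p : Coef) : eval (insert m p) = m.eval + eval p := by
  induction p with
  | nil => simp [insert]
  | cons n p ih =>
    rw [insert]
    split_ifs with h h'
    · simp only [Mono.sameExp, Bool.and_eq_true, beq_iff_eq] at h
      obtain ⟨h0, h1, h2⟩ := h
      have hc : (m.coef : 𝕂) + n.coef = 0 := by exact_mod_cast beq_iff_eq.1 h'
      simp only [eval_cons, Mono.eval, h0, h1, h2]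
      linear_combination (-1 * (s₀ ^ n.exp₀ * s₁ ^ n.exp₁ * if n.hasY then Y else 1)) * hc
    · simp only [Mono.sameExp, Bool.and_eq_true, beq_iff_eq] at h
      obtain ⟨h0, h1, h2⟩ := h
      simp only [eval_cons, Mono.eval, h0, h1, h2]
      push_cast
      ring
    · rw [eval_cons, ih, eval_cons]
      ring

theorem eval_add (p q : Coef) : eval (add p q) = eval p + eval q := by
  induction p with
  | nil => simp [add]
  | cons m p ih =>
    have : add (m :: p) q = insert m (add p q) := rfl
    rw [this, eval_insert, ih, eval_cons]
    ring

theorem eval_mono_mul (m n : Mono) : eval (m.mul n) = m.eval * n.eval := by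
  obtain ⟨c, a, b, e⟩ := m
  obtain ⟨c', a', b', e'⟩ := n
  have hY : Y * Y = s₀ ^ 2 - s₀ ^ 2 * s₁ ^ 2 - 1 + s₁ ^ 2 := by
    rw [← sq, Y_sq, s₀_sq, s₁_sq]; ring
  have h0 := s₀_ne_zero
  have h1 := s₁_ne_zero
  have h2 : ∀ x : 𝕂, x ^ (2 : ℤ) = x ^ 2 := fun x => zpow_ofNat x 2
  cases e <;> cases e' <;>
    simp [Mono.mul, Mono.eval, zpow_add₀ h0, zpow_add₀ h1, h2] <;> try ring1
  linear_combination (-(c * c' * (s₀ ^ a * s₀ ^ a') * (s₁ ^ b * s₁ ^ b'))) * hY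

theorem eval_mul (p q : Coef) : eval (mul p q) = eval p * eval q := by
  have h : ∀ (m : Mono) (q acc : Coef),
      eval (q.foldr (fun n acc => add (m.mul n) acc) acc) = m.eval * eval q + eval acc := by
    intro m q acc
    induction q with
    | nil => simp
    | cons n q ih => rw [List.foldr_cons, eval_add, ih, eval_mono_mul, eval_cons]; ring
  induction p with
  | nil => simp [mul]
  | cons m p ih =>
    have : mul (m :: p) q = q.foldr (fun n acc => add (m.mul n) acc) (mul p q) := rfl
    rw [this, h, ih, eval_cons]
    ring

end Coef

/-! ### Tensors and diagram operators -/

/-- The coordinates of an element of the product of all tensor powers `W^{⊗n}`; the word `[i₁, …, iₙ]`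
stands for `e_{i₁} ⊗ ⋯ ⊗ e_{iₙ}`.  One type for all orders avoids casts between the levels of a
diagram; `HasOrder` singles out the tensors of one order. -/
abbrev Tensor : Type := List (Fin 4) → 𝕂

/-- The operator `id_W ⊗ T`. -/
noncomputable def lift (T : Tensor →ₗ[𝕂] Tensor) : Tensor →ₗ[𝕂] Tensor where
  toFun u x :=
    match x with
    | [] => 0
    | i :: x => T (fun y => u (i :: y)) x
  map_add' u v := by
    funext x
    cases x with
    | nil => simp
    | cons i x =>
      exact congrFun (T.map_add (fun y => u (i :: y)) (fun y => v (i :: y))) x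
  map_smul' c u := by
    funext x
    cases x with
    | nil => simp
    | cons i x => exact congrFun (T.map_smul c (fun y => u (i :: y))) x

@[simp] theorem lift_nil (T : Tensor →ₗ[𝕂] Tensor) (u : Tensor) : lift T u [] = 0 := rfl
@[simp] theorem lift_cons (T : Tensor →ₗ[𝕂] Tensor) (u : Tensor) (i : Fin 4) (x : List (Fin 4)) :
    lift T u (i :: x) = T (fun y => u (i :: y)) x := rfl

theorem lift_comp (S T : Tensor →ₗ[𝕂] Tensor) : lift (S ∘ₗ T) = lift S ∘ₗ lift T := by
  ext u x
  cases x <;> rfl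

/-- The operator `M ⊗ id`, where `M` acts on the first two factors. -/
noncomputable def crossOp (M : Matrix (Fin 4 × Fin 4) (Fin 4 × Fin 4) 𝕂) :
    Tensor →ₗ[𝕂] Tensor where
  toFun u x :=
    match x with
    | k :: l :: r => ∑ i, ∑ j, M (k, l) (i, j) * u (i :: j :: r)
    | _ => 0
  map_add' u v := by
    funext x
    rcases x with _ | ⟨k, _ | ⟨l, r⟩⟩ <;> simp [mul_add, Finset.sum_add_distrib]
  map_smul' c u := by
    funext x
    rcases x with _ | ⟨k, _ | ⟨l, r⟩⟩ <;> simp [Finset.mul_sum, mul_left_comm]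

/-- The operator `u ↦ (∑ᵢ wᵢ eᵢ ⊗ eᵢ) ⊗ u`. -/
noncomputable def cupOp (w : Fin 4 → 𝕂) : Tensor →ₗ[𝕂] Tensor where
  toFun u x :=
    match x with
    | k :: l :: r => if k = l then w k * u r else 0
    | _ => 0
  map_add' u v := by
    funext x
    rcases x with _ | ⟨k, _ | ⟨l, r⟩⟩ <;> simp [mul_add, ite_add_zero]
  map_smul' c u := by
    funext x
    rcases x with _ | ⟨k, _ | ⟨l, r⟩⟩ <;> simp [mul_left_comm]

/-- The contraction of the first two factors with the weights `w`. -/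
noncomputable def capOp (w : Fin 4 → 𝕂) : Tensor →ₗ[𝕂] Tensor where
  toFun u r := ∑ i, w i * u (i :: i :: r)
  map_add' u v := by
    funext r
    simp [mul_add, Finset.sum_add_distrib]
  map_smul' c u := by
    funext r
    simp [Finset.mul_sum, mul_left_comm]

/-! ### Coefficient tables -/

/-- The diagonal entries of `μ`. -/
def muCoef : Fin 4 → Coef
  | 0 => [⟨1, -2, 0, false⟩]
  | 1 => [⟨-1, 0, 2, false⟩]
  | 2 => [⟨-1, -2, 0, false⟩]
  | 3 => [⟨1, 0, 2, false⟩]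

/-- The diagonal entries of `μ⁻¹`. -/
def muInvCoef : Fin 4 → Coef
  | 0 => [⟨1, 2, 0, false⟩]
  | 1 => [⟨-1, 0, -2, false⟩]
  | 2 => [⟨-1, 2, 0, false⟩]
  | 3 => [⟨1, 0, -2, false⟩]

/-- The coefficients of a local minimum whose left leg has orientation `a`.  A dual basis is used on the
downward strands, so that only the extrema `cup false` and `cap true` carry a factor `μ^{±1}`. -/
def cupCoef (a : Bool) (i : Fin 4) : Coef := if a then [⟨1, 0, 0, false⟩] else muInvCoef i

/-- The coefficients of a local maximum whose left leg has orientation `a`. -/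
def capCoef (a : Bool) (i : Fin 4) : Coef := if a then muCoef i else [⟨1, 0, 0, false⟩]

/-- The coefficient of `e_j ⊗ e_i` in the image of `e_i ⊗ e_j` under a crossing.  The sign `e` of the
exponents depends on the orientations and on the over-strand. -/
def swapMono (e : ℤ) : Fin 4 → Fin 4 → Mono
  | 0, 0 => ⟨1, 2 * e, 0, false⟩
  | 0, 3 => ⟨1, 0, 0, false⟩
  | 3, 0 => ⟨1, 0, 0, false⟩
  | 3, 3 => ⟨1, 0, 2 * e, false⟩
  | 0, _ => ⟨1, e, 0, false⟩
  | _, 0 => ⟨1, e, 0, false⟩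
  | 3, _ => ⟨1, 0, e, false⟩
  | _, 3 => ⟨1, 0, e, false⟩
  | 1, 2 => ⟨-1, e, e, false⟩
  | 2, 1 => ⟨-1, e, e, false⟩
  | _, _ => ⟨-1, 0, 0, false⟩

/-- The terms other than the multiple of `e_j ⊗ e_i` in the image of `e_i ⊗ e_j` under a crossing of two
upward strands: those of `R` (`true`) and of `R⁻¹` (`false`). -/
def extraUpUp : Bool → Fin 4 → Fin 4 → List (Fin 4 × Fin 4 × Coef)
  | true, 1, 0 => [(1, 0, [⟨-1, 0, 0, false⟩, ⟨1, 2, 0, false⟩])]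
  | true, 1, 2 => [(1, 2, [⟨-1, 0, 0, false⟩, ⟨1, 2, 2, false⟩]), (3, 0, [⟨-1, 1, 1, true⟩])]
  | true, 2, 0 => [(2, 0, [⟨-1, 0, 0, false⟩, ⟨1, 2, 0, false⟩])]
  | true, 2, 1 => [(3, 0, [⟨1, 0, 0, true⟩])]
  | true, 3, 0 => [(1, 2, [⟨-1, 1, 1, true⟩]), (2, 1, [⟨1, 0, 0, true⟩]), (3, 0, [⟨-1, 0, 0, false⟩, ⟨1, 0, 2, false⟩, ⟨1, 2, 0, false⟩, ⟨-1, 2, 2, false⟩])]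
  | true, 3, 1 => [(3, 1, [⟨-1, 0, 0, false⟩, ⟨1, 0, 2, false⟩])]
  | true, 3, 2 => [(3, 2, [⟨-1, 0, 0, false⟩, ⟨1, 0, 2, false⟩])]
  | false, 0, 1 => [(0, 1, [⟨1, -2, 0, false⟩, ⟨-1, 0, 0, false⟩])]
  | false, 0, 2 => [(0, 2, [⟨1, -2, 0, false⟩, ⟨-1, 0, 0, false⟩])]
  | false, 0, 3 => [(0, 3, [⟨-1, -2, -2, false⟩, ⟨1, -2, 0, false⟩, ⟨1, 0, -2, false⟩, ⟨-1, 0, 0, false⟩]), (1, 2, [⟨1, -1, -1, true⟩]), (2, 1, [⟨-1, -2, -2, true⟩])]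
  | false, 1, 2 => [(0, 3, [⟨1, -1, -1, true⟩])]
  | false, 1, 3 => [(1, 3, [⟨1, 0, -2, false⟩, ⟨-1, 0, 0, false⟩])]
  | false, 2, 1 => [(0, 3, [⟨-1, -2, -2, true⟩]), (2, 1, [⟨1, -2, -2, false⟩, ⟨-1, 0, 0, false⟩])]
  | false, 2, 3 => [(2, 3, [⟨1, 0, -2, false⟩, ⟨-1, 0, 0, false⟩])]
  | _, _, _ => []

/-- The terms as in `extraUpUp` for an upward strand on the left and a downward strand on the right.
These coefficients, and those of the next two tables, are forced by rotating the crossing of two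
upward strands, see `rotatedCrossing_check`. -/
def extraUpDown : Bool → Fin 4 → Fin 4 → List (Fin 4 × Fin 4 × Coef)
  | true, 1, 1 => [(0, 0, [⟨-1, 0, 2, false⟩, ⟨1, 2, 2, false⟩]), (2, 2, [⟨1, 0, 0, false⟩, ⟨-1, 2, 2, false⟩])]
  | true, 1, 3 => [(2, 0, [⟨1, 0, 0, true⟩])]
  | true, 2, 2 => [(0, 0, [⟨-1, -2, 0, false⟩, ⟨1, 0, 0, false⟩])]
  | true, 2, 3 => [(1, 0, [⟨-1, -1, -1, true⟩])]
  | true, 3, 1 => [(0, 2, [⟨1, 0, 0, true⟩])]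
  | true, 3, 2 => [(0, 1, [⟨-1, -1, -1, true⟩])]
  | true, 3, 3 => [(0, 0, [⟨-1, 0, 0, false⟩, ⟨1, 0, 2, false⟩, ⟨1, 2, 0, false⟩, ⟨-1, 2, 2, false⟩]), (1, 1, [⟨-1, 0, -2, false⟩, ⟨1, 0, 0, false⟩]), (2, 2, [⟨-1, 2, 0, false⟩, ⟨1, 2, 2, false⟩])]
  | false, 0, 0 => [(1, 1, [⟨1, -2, -2, false⟩, ⟨-1, 0, -2, false⟩]), (2, 2, [⟨1, 0, 0, false⟩, ⟨-1, 2, 0, false⟩]), (3, 3, [⟨-1, -2, -2, false⟩, ⟨1, -2, 0, false⟩, ⟨1, 0, -2, false⟩, ⟨-1, 0, 0, false⟩])]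
  | false, 0, 1 => [(3, 2, [⟨-1, 0, 0, true⟩])]
  | false, 0, 2 => [(3, 1, [⟨1, -1, -1, true⟩])]
  | false, 1, 0 => [(2, 3, [⟨-1, 0, 0, true⟩])]
  | false, 1, 1 => [(3, 3, [⟨1, 0, 0, false⟩, ⟨-1, 0, 2, false⟩])]
  | false, 2, 0 => [(1, 3, [⟨1, -1, -1, true⟩])]
  | false, 2, 2 => [(1, 1, [⟨-1, -2, -2, false⟩, ⟨1, 0, 0, false⟩]), (3, 3, [⟨1, -2, -2, false⟩, ⟨-1, -2, 0, false⟩])]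
  | _, _, _ => []

/-- The terms as in `extraUpUp` for a downward strand on the left and an upward strand on the right. -/
def extraDownUp : Bool → Fin 4 → Fin 4 → List (Fin 4 × Fin 4 × Coef)
  | true, 0, 0 => [(1, 1, [⟨1, -2, 0, false⟩, ⟨-1, 0, 0, false⟩]), (2, 2, [⟨1, -2, 0, false⟩, ⟨-1, 0, 0, false⟩]), (3, 3, [⟨-1, -2, -2, false⟩, ⟨1, -2, 0, false⟩, ⟨1, 0, -2, false⟩, ⟨-1, 0, 0, false⟩])]
  | true, 0, 1 => [(3, 2, [⟨1, -1, -1, true⟩])]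
  | true, 0, 2 => [(3, 1, [⟨-1, -2, -2, true⟩])]
  | true, 1, 0 => [(2, 3, [⟨1, -1, -1, true⟩])]
  | true, 1, 1 => [(3, 3, [⟨1, 0, -2, false⟩, ⟨-1, 0, 0, false⟩])]
  | true, 2, 0 => [(1, 3, [⟨-1, -2, -2, true⟩])]
  | true, 2, 2 => [(1, 1, [⟨1, -2, -2, false⟩, ⟨-1, 0, 0, false⟩]), (3, 3, [⟨1, 0, -2, false⟩, ⟨-1, 0, 0, false⟩])]
  | false, 1, 1 => [(0, 0, [⟨-1, 0, 0, false⟩, ⟨1, 2, 0, false⟩]), (2, 2, [⟨-1, 0, 0, false⟩, ⟨1, 2, 2, false⟩])]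
  | false, 1, 3 => [(2, 0, [⟨-1, 1, 1, true⟩])]
  | false, 2, 2 => [(0, 0, [⟨-1, 0, 0, false⟩, ⟨1, 2, 0, false⟩])]
  | false, 2, 3 => [(1, 0, [⟨1, 0, 0, true⟩])]
  | false, 3, 1 => [(0, 2, [⟨-1, 1, 1, true⟩])]
  | false, 3, 2 => [(0, 1, [⟨1, 0, 0, true⟩])]
  | false, 3, 3 => [(0, 0, [⟨-1, 0, 0, false⟩, ⟨1, 0, 2, false⟩, ⟨1, 2, 0, false⟩, ⟨-1, 2, 2, false⟩]), (1, 1, [⟨-1, 0, 0, false⟩, ⟨1, 0, 2, false⟩]), (2, 2, [⟨-1, 0, 0, false⟩, ⟨1, 0, 2, false⟩])]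
  | _, _, _ => []

/-- The terms as in `extraUpUp` for two downward strands. -/
def extraDownDown : Bool → Fin 4 → Fin 4 → List (Fin 4 × Fin 4 × Coef)
  | true, 0, 1 => [(0, 1, [⟨-1, 0, 0, false⟩, ⟨1, 2, 0, false⟩])]
  | true, 0, 2 => [(0, 2, [⟨-1, 0, 0, false⟩, ⟨1, 2, 0, false⟩])]
  | true, 0, 3 => [(0, 3, [⟨-1, 0, 0, false⟩, ⟨1, 0, 2, false⟩, ⟨1, 2, 0, false⟩, ⟨-1, 2, 2, false⟩]), (1, 2, [⟨1, 0, 0, true⟩]), (2, 1, [⟨-1, 1, 1, true⟩])]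
  | true, 1, 2 => [(0, 3, [⟨1, 0, 0, true⟩])]
  | true, 1, 3 => [(1, 3, [⟨-1, 0, 0, false⟩, ⟨1, 0, 2, false⟩])]
  | true, 2, 1 => [(0, 3, [⟨-1, 1, 1, true⟩]), (2, 1, [⟨-1, 0, 0, false⟩, ⟨1, 2, 2, false⟩])]
  | true, 2, 3 => [(2, 3, [⟨-1, 0, 0, false⟩, ⟨1, 0, 2, false⟩])]
  | false, 1, 0 => [(1, 0, [⟨1, -2, 0, false⟩, ⟨-1, 0, 0, false⟩])]
  | false, 1, 2 => [(1, 2, [⟨1, -2, -2, false⟩, ⟨-1, 0, 0, false⟩]), (3, 0, [⟨-1, -2, -2, true⟩])]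
  | false, 2, 0 => [(2, 0, [⟨1, -2, 0, false⟩, ⟨-1, 0, 0, false⟩])]
  | false, 2, 1 => [(3, 0, [⟨1, -1, -1, true⟩])]
  | false, 3, 0 => [(1, 2, [⟨-1, -2, -2, true⟩]), (2, 1, [⟨1, -1, -1, true⟩]), (3, 0, [⟨-1, -2, -2, false⟩, ⟨1, -2, 0, false⟩, ⟨1, 0, -2, false⟩, ⟨-1, 0, 0, false⟩])]
  | false, 3, 1 => [(3, 1, [⟨1, 0, -2, false⟩, ⟨-1, 0, 0, false⟩])]
  | false, 3, 2 => [(3, 2, [⟨1, 0, -2, false⟩, ⟨-1, 0, 0, false⟩])]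
  | _, _, _ => []

/-- The terms as in `extraUpUp` for all orientations. -/
def extra : Bool → Bool → Bool → Fin 4 → Fin 4 → List (Fin 4 × Fin 4 × Coef)
  | true, true => extraUpUp
  | true, false => extraUpDown
  | false, true => extraDownUp
  | false, false => extraDownDown

/-- The image of `e_i ⊗ e_j` under `crossing a b o`, as a list of terms `c * e_k ⊗ e_l`. -/
def row (a b o : Bool) (i j : Fin 4) : List (Fin 4 × Fin 4 × Coef) :=
  (j, i, [swapMono (if (a == b) == o then 1 else -1) i j]) :: extra a b o i j

/-- The matrix of `crossing a b o`; the entry at `(k, l)`, `(i, j)` is the coefficient of `e_k ⊗ e_l` in the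
image of `e_i ⊗ e_j`. -/
noncomputable def crossMatrix (a b o : Bool) : Matrix (Fin 4 × Fin 4) (Fin 4 × Fin 4) 𝕂 :=
  fun p q => ((row a b o q.1 q.2).map fun e => if p = (e.1, e.2.1) then e.2.2.eval else 0).sum

/-- The operator of an elementary piece, acting on the first factors. -/
noncomputable def genOp : Gen → Tensor →ₗ[𝕂] Tensor
  | .crossing a b o => crossOp (crossMatrix a b o)
  | .cup a => cupOp fun i => (cupCoef a i).eval
  | .cap a => capOp fun i => (capCoef a i).eval

/-- The operator of a slice.  The strands on the right need no mention, since the operators of the pieces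
act on tensors of every order. -/
noncomputable def sliceOp (x : Slice) : Tensor →ₗ[𝕂] Tensor := lift^[x.left.length] (genOp x.gen)

/-- The Links–Gould operator of a tangle diagram, whose slices act from bottom to top. -/
noncomputable def wordOp : List Slice → Tensor →ₗ[𝕂] Tensor
  | [] => LinearMap.id
  | x :: w => wordOp w ∘ₗ sliceOp x

/-! ### Computing with operators on basis tensors -/

/-- The map `v ↦ e_i ⊗ v`. -/
noncomputable def consL (i : Fin 4) : Tensor →ₗ[𝕂] Tensor where
  toFun v x :=
    match x with
    | [] => 0
    | j :: x => if j = i then v x else 0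
  map_add' u v := by
    funext x
    rcases x with _ | ⟨k, x⟩ <;> simp [ite_add_zero]
  map_smul' c u := by
    funext x
    rcases x with _ | ⟨k, x⟩ <;> simp

@[simp] theorem consL_nil (i : Fin 4) (v : Tensor) : consL i v [] = 0 := rfl
@[simp] theorem consL_cons (i j : Fin 4) (v : Tensor) (x : List (Fin 4)) :
    consL i v (j :: x) = if j = i then v x else 0 := rfl

/-- The map `v ↦ e_y ⊗ v` for a word `y`. -/
noncomputable def pre : List (Fin 4) → Tensor →ₗ[𝕂] Tensor
  | [] => LinearMap.id
  | i :: y => consL i ∘ₗ pre y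

@[simp] theorem pre_nil (v : Tensor) : pre [] v = v := rfl
@[simp] theorem pre_cons (i : Fin 4) (y : List (Fin 4)) (v : Tensor) :
    pre (i :: y) v = consL i (pre y v) := rfl

theorem lift_consL (T : Tensor →ₗ[𝕂] Tensor) (i : Fin 4) (u : Tensor) :
    lift T (consL i u) = consL i (T u) := by
  funext x
  rcases x with _ | ⟨j, x⟩
  · rfl
  · rw [lift_cons, consL_cons]
    by_cases h : j = i
    · simp [h]
    · simp only [consL_cons, h, if_false]
      exact congrFun T.map_zero x

/-- A formal linear combination of words. -/
abbrev SparseVec := List (List (Fin 4) × Coef)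

namespace SparseVec

variable {V : Type*} [AddCommGroup V] [Module 𝕂 V]

/-- The linear extension of `f`, applied to a formal linear combination of words. -/
noncomputable def sum (f : List (Fin 4) → V) (s : SparseVec) : V :=
  (s.map fun e => e.2.eval • f e.1).sum

@[simp] theorem sum_nil (f : List (Fin 4) → V) : sum f [] = 0 := rfl
@[simp] theorem sum_cons (f : List (Fin 4) → V) (e : List (Fin 4) × Coef) (s : SparseVec) :
    sum f (e :: s) = e.2.eval • f e.1 + sum f s := by
  simp [sum]

/-- The tensor `∑ c_y e_y ⊗ v` for the formal linear combination `∑ c_y y`. -/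
noncomputable def eval (s : SparseVec) (v : Tensor) : Tensor := s.sum fun y => pre y v

@[simp] theorem eval_nil (v : Tensor) : eval [] v = 0 := rfl
@[simp] theorem eval_cons (e : List (Fin 4) × Coef) (s : SparseVec) (v : Tensor) :
    eval (e :: s) v = e.2.eval • pre e.1 v + eval s v := by
  simp [eval]

/-- Equality of words, by a recursion that the kernel evaluates fast. -/
def sameWord : List (Fin 4) → List (Fin 4) → Bool
  | [], [] => true
  | i :: x, j :: y => Nat.beq i.1 j.1 && sameWord x y
  | _, _ => false

theorem eq_of_sameWord : ∀ {x y : List (Fin 4)}, sameWord x y = true → x = y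
  | [], [], _ => rfl
  | i :: x, j :: y, h => by
    simp only [sameWord, Bool.and_eq_true] at h
    rw [eq_of_sameWord h.2, Fin.ext (Nat.eq_of_beq_eq_true h.1)]
  | [], _ :: _, h => by simp [sameWord] at h
  | _ :: _, [], h => by simp [sameWord] at h

/-- Add `c` times the word `y`, collecting equal words and dropping zero terms. -/
def insert (y : List (Fin 4)) (c : Coef) : SparseVec → SparseVec
  | [] => [(y, c)]
  | e :: s =>
    if sameWord y e.1 then
      match Coef.add c e.2 with
      | [] => s
      | m :: p => (e.1, m :: p) :: s
    else e :: insert y c s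

theorem sum_insert (f : List (Fin 4) → V) (y : List (Fin 4)) (c : Coef) (s : SparseVec) :
    sum f (insert y c s) = c.eval • f y + sum f s := by
  induction s with
  | nil => simp [insert]
  | cons e s ih =>
    rw [insert]
    split_ifs with h
    · have hy := eq_of_sameWord h
      have ha := Coef.eval_add c e.2
      split
      · next hc =>
        rw [hc, Coef.eval_nil] at ha
        rw [sum_cons, ← add_assoc, hy, ← add_smul, ← ha]
        simp
      · next m p hc =>
        rw [hc] at ha
        rw [sum_cons, sum_cons, hy, ha, add_smul, add_assoc]
    · rw [sum_cons, ih, sum_cons]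
      abel

/-- The combination `c * s + t`. -/
def addMul (c : Coef) (s t : SparseVec) : SparseVec :=
  s.foldr (fun e acc => insert e.1 (Coef.mul c e.2) acc) t

theorem sum_addMul (f : List (Fin 4) → V) (c : Coef) (s t : SparseVec) :
    sum f (addMul c s t) = c.eval • sum f s + sum f t := by
  induction s with
  | nil => simp [addMul]
  | cons e s ih =>
    have : addMul c (e :: s) t = insert e.1 (Coef.mul c e.2) (addMul c s t) := rfl
    rw [this, sum_insert, ih, sum_cons, Coef.eval_mul, smul_add, smul_smul, add_assoc]

theorem eval_addMul (c : Coef) (s t : SparseVec) (v : Tensor) :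
    eval (addMul c s t) v = c.eval • eval s v + eval t v :=
  sum_addMul _ c s t

/-- `s.same t` decides whether the formal linear combinations `s` and `t` are equal. -/
def same (s t : SparseVec) : Bool := (addMul [⟨-1, 0, 0, false⟩] s t).isEmpty

theorem sum_eq_of_same (f : List (Fin 4) → V) {s t : SparseVec} (h : same s t = true) :
    sum f s = sum f t := by
  have := sum_addMul f [⟨-1, 0, 0, false⟩] s t
  rw [List.isEmpty_iff.1 h] at this
  simp [Mono.eval] at this
  exact (neg_add_eq_zero.1 this.symm)

end SparseVec

/-- The image of `e_y ⊗ v` under an elementary piece, or `none` if `y` is too short to determine it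
as a combination of tensors `e_z ⊗ v`. -/
def genStep : Gen → List (Fin 4) → Option SparseVec
  | .cup a, y => some ([0, 1, 2, 3].map fun i => (i :: i :: y, cupCoef a i))
  | .cap a, i :: j :: y => some (if Nat.beq i.1 j.1 then [(y, capCoef a i)] else [])
  | .crossing a b o, i :: j :: y => some ((row a b o i j).map fun e => (e.1 :: e.2.1 :: y, e.2.2))
  | _, _ => none

theorem genOp_pre {g : Gen} {y : List (Fin 4)} {s : SparseVec} (h : genStep g y = some s)
    (v : Tensor) : genOp g (pre y v) = s.eval v := by
  rcases g with ⟨a, b, o⟩ | a | a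
  · rcases y with _ | ⟨i, _ | ⟨j, y⟩⟩ <;> simp only [genStep, Option.some.injEq, reduceCtorEq] at h
    subst h
    have key : ∀ (L : List (Fin 4 × Fin 4 × Coef)) (x : List (Fin 4)),
        SparseVec.eval (L.map fun e => (e.1 :: e.2.1 :: y, e.2.2)) v x =
          match x with
          | k :: l :: r =>
            (L.map fun e => if (k, l) = (e.1, e.2.1) then e.2.2.eval else 0).sum * pre y v r
          | _ => 0 := by
      intro L x
      induction L with
      | nil => rcases x with _ | ⟨k, _ | ⟨l, r⟩⟩ <;> simp
      | cons e L ih =>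
        rw [List.map_cons, SparseVec.eval_cons, Pi.add_apply, ih]
        rcases x with _ | ⟨k, _ | ⟨l, r⟩⟩
        · simp
        · simp
        · by_cases hk : k = e.1 <;> by_cases hl : l = e.2.1 <;> simp [hk, hl, add_mul]
    funext x
    rw [key]
    rcases x with _ | ⟨k, _ | ⟨l, r⟩⟩
    · rfl
    · rfl
    · simp only [genOp, crossOp, LinearMap.coe_mk, AddHom.coe_mk, pre_cons, consL_cons]
      rw [Finset.sum_eq_single i (by intro i' _ h; simp [h]) (by simp),
        Finset.sum_eq_single j (by intro i' _ h; simp [h]) (by simp)]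
      simp [crossMatrix]
  · simp only [genStep, Option.some.injEq] at h
    subst h
    funext x
    simp only [genOp, cupOp, LinearMap.coe_mk, AddHom.coe_mk, List.map_cons, List.map_nil,
      SparseVec.eval_cons, SparseVec.eval_nil, pre_cons, Pi.add_apply, Pi.smul_apply]
    rcases x with _ | ⟨k, _ | ⟨l, r⟩⟩
    · simp
    · simp
    · fin_cases k <;> fin_cases l <;> simp
  · rcases y with _ | ⟨i, _ | ⟨j, y⟩⟩ <;> simp only [genStep, Option.some.injEq, reduceCtorEq] at h
    subst h
    funext r
    simp only [genOp, capOp, LinearMap.coe_mk, AddHom.coe_mk, pre_cons, consL_cons]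
    rw [Finset.sum_eq_single i (by intro i' _ h; simp [h]) (by simp), if_pos rfl]
    by_cases hij : i = j
    · simp [hij, Nat.beq_refl]
    · have : Nat.beq i.1 j.1 = false := by
        rw [Bool.eq_false_iff]
        exact fun h => hij (Fin.ext (Nat.eq_of_beq_eq_true h))
      simp [hij, this]

/-- The image of `e_y ⊗ v` under an elementary piece with `p` strands on its left. -/
def stepAt : ℕ → Gen → List (Fin 4) → Option SparseVec
  | 0, g, y => genStep g y
  | _ + 1, _, [] => none
  | p + 1, g, i :: y =>
    match stepAt p g y with
    | none => none
    | some s => some (s.map fun e => (i :: e.1, e.2))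

theorem lift_iterate_pre {g : Gen} {p : ℕ} {y : List (Fin 4)} {s : SparseVec}
    (h : stepAt p g y = some s) (v : Tensor) : (lift^[p] (genOp g)) (pre y v) = s.eval v := by
  induction p generalizing y s with
  | zero => exact genOp_pre h v
  | succ p ih =>
    rcases y with _ | ⟨i, y⟩
    · simp [stepAt] at h
    · rw [stepAt] at h
      split at h
      · simp at h
      · next t ht =>
        obtain rfl := Option.some.inj h
        rw [Function.iterate_succ_apply', pre_cons, lift_consL, ih ht]
        clear h ht
        induction t with
        | nil => simp
        | cons e t iht => simp [iht]

/-- The image of a combination of words under a slice. -/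
def sparseStep (x : Slice) : SparseVec → Option SparseVec
  | [] => some []
  | e :: s =>
    match sparseStep x s, stepAt x.left.length x.gen e.1 with
    | some acc, some t => some (SparseVec.addMul e.2 t acc)
    | _, _ => none

theorem sliceOp_eval {x : Slice} {s t : SparseVec} (h : sparseStep x s = some t) (v : Tensor) :
    sliceOp x (s.eval v) = t.eval v := by
  induction s generalizing t with
  | nil =>
    obtain rfl := Option.some.inj h
    simp
  | cons e s ih =>
    rw [sparseStep] at h
    split at h
    · next acc r hacc hr =>
      obtain rfl := Option.some.inj h
      rw [SparseVec.eval_cons, map_add, map_smul, ih hacc, SparseVec.eval_addMul, sliceOp,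
        lift_iterate_pre hr]
    · simp at h

/-- The image of a combination of words under a tangle diagram. -/
def run : List Slice → SparseVec → Option SparseVec
  | [], s => some s
  | x :: w, s =>
    match sparseStep x s with
    | none => none
    | some t => run w t

theorem wordOp_eval {w : List Slice} {s t : SparseVec} (h : run w s = some t) (v : Tensor) :
    wordOp w (s.eval v) = t.eval v := by
  induction w generalizing s with
  | nil =>
    obtain rfl := Option.some.inj h
    rfl
  | cons x w ih =>
    rw [run] at h
    split at h
    · simp at h
    · next r hr =>
      rw [wordOp, LinearMap.comp_apply, sliceOp_eval hr, ih h]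

/-- The word `y` as a combination of words. -/
def unitVec (y : List (Fin 4)) : SparseVec := [(y, [⟨1, 0, 0, false⟩])]

theorem eval_unitVec (y : List (Fin 4)) (v : Tensor) : (unitVec y).eval v = pre y v := by
  simp [unitVec, Mono.eval]

/-- All words of length `n`. -/
def words : ℕ → List (List (Fin 4))
  | 0 => [[]]
  | n + 1 => [0, 1, 2, 3].flatMap fun i => (words n).map (i :: ·)

theorem mem_words {y : List (Fin 4)} : y ∈ words y.length := by
  induction y with
  | nil => simp [words]
  | cons i y ih =>
    simp only [List.length_cons, words, List.mem_flatMap, List.mem_map]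
    exact ⟨i, by fin_cases i <;> simp, y, ih, rfl⟩

/-- Whether two diagrams have the same effect on all tensors `e_y ⊗ v` with `y` of length `n`.  Only
finitely many computations, without any division, decide this. -/
def sameOn (n : ℕ) (v w : List Slice) : Bool :=
  (words n).all fun y =>
    match run v (unitVec y), run w (unitVec y) with
    | some s, some t => s.same t
    | _, _ => false

theorem wordOp_pre_eq {n : ℕ} {p q : List Slice} (h : sameOn n p q = true) {y : List (Fin 4)}
    (hy : y.length = n) (v : Tensor) : wordOp p (pre y v) = wordOp q (pre y v) := by
  have := List.all_eq_true.1 h y (hy ▸ mem_words)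
  split at this
  · next s t hs ht =>
    rw [← eval_unitVec, wordOp_eval hs, wordOp_eval ht]
    exact SparseVec.sum_eq_of_same _ this
  · simp at this

/-! ### Tensors of a given order -/

theorem genOp_crossing_apply (a b o : Bool) (u : Tensor) (k l : Fin 4) (r : List (Fin 4)) :
    genOp (.crossing a b o) u (k :: l :: r) =
      ∑ i, ∑ j, crossMatrix a b o (k, l) (i, j) * u (i :: j :: r) := rfl

theorem genOp_cup_apply (a : Bool) (u : Tensor) (k l : Fin 4) (r : List (Fin 4)) :
    genOp (.cup a) u (k :: l :: r) = if k = l then (cupCoef a k).eval * u r else 0 := rfl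

theorem genOp_cap_apply (a : Bool) (u : Tensor) (r : List (Fin 4)) :
    genOp (.cap a) u r = ∑ i, (capCoef a i).eval * u (i :: i :: r) := rfl

/-- The tensor `u` lies in `W^{⊗n}`. -/
def HasOrder (n : ℕ) (u : Tensor) : Prop := ∀ x, x.length ≠ n → u x = 0

theorem HasOrder.tail {n : ℕ} {u : Tensor} (h : HasOrder (n + 1) u) (i : Fin 4) :
    HasOrder n fun y => u (i :: y) := fun x hx => h _ (by simpa using hx)

theorem HasOrder.lift {m n : ℕ} {T : Tensor →ₗ[𝕂] Tensor}
    (hT : ∀ u, HasOrder m u → HasOrder n (T u)) {u : Tensor} (hu : HasOrder (m + 1) u) :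
    HasOrder (n + 1) (lift T u) := by
  rintro (_ | ⟨i, x⟩) hx
  · rfl
  · exact hT _ (hu.tail i) x (by simpa using hx)

theorem HasOrder.genOp {g : Gen} {k : ℕ} {u : Tensor} (hu : HasOrder (g.dom.length + k) u) :
    HasOrder (g.cod.length + k) (genOp g u) := by
  intro x hx
  rcases g with ⟨a, b, o⟩ | a | a
  · rcases x with _ | ⟨i, _ | ⟨j, x⟩⟩
    · rfl
    · rfl
    · rw [genOp_crossing_apply]
      refine Finset.sum_eq_zero fun i' _ => Finset.sum_eq_zero fun j' _ => ?_
      rw [hu, mul_zero]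
      simpa [Gen.dom, Gen.cod] using hx
  · rcases x with _ | ⟨i, _ | ⟨j, x⟩⟩
    · rfl
    · rfl
    · rw [genOp_cup_apply, hu, mul_zero, ite_self]
      simp only [Gen.dom, Gen.cod, List.length_cons, List.length_nil] at hx ⊢
      omega
  · rw [genOp_cap_apply]
    refine Finset.sum_eq_zero fun i' _ => ?_
    rw [hu, mul_zero]
    simp only [Gen.dom, Gen.cod, List.length_cons, List.length_nil] at hx ⊢
    omega

theorem HasOrder.lift_iterate {T : Tensor →ₗ[𝕂] Tensor} {m n : ℕ}
    (hT : ∀ u, HasOrder m u → HasOrder n (T u)) (p : ℕ) {u : Tensor} (hu : HasOrder (m + p) u) :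
    HasOrder (n + p) ((LinksGould.lift^[p] T) u) := by
  induction p generalizing u with
  | zero => exact hT u hu
  | succ p ih =>
    rw [Function.iterate_succ_apply']
    exact HasOrder.lift (fun v hv => ih hv) hu

theorem HasOrder.sliceOp {x : Slice} {k : ℕ} {u : Tensor}
    (hu : HasOrder (x.source.length + k) u) : HasOrder (x.target.length + k) (sliceOp x u) := by
  have h := HasOrder.lift_iterate (T := LinksGould.genOp x.gen)
    (m := x.gen.dom.length + (x.right.length + k)) (n := x.gen.cod.length + (x.right.length + k))
    (fun v hv => HasOrder.genOp hv) x.left.length (u := u)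
  have h1 : x.source.length + k = x.gen.dom.length + (x.right.length + k) + x.left.length := by
    simp [Slice.source]; ring
  have h2 : x.target.length + k = x.gen.cod.length + (x.right.length + k) + x.left.length := by
    simp [Slice.target]; ring
  rw [h1] at hu
  rw [h2]
  exact h hu

theorem HasOrder.wordOp {s t : List Bool} {w : List Slice} (hw : IsTangle s w t) {k : ℕ}
    {u : Tensor} (hu : HasOrder (s.length + k) u) : HasOrder (t.length + k) (wordOp w u) := by
  induction w generalizing s u with
  | nil =>
    obtain rfl : s = t := hw
    exact hu
  | cons x w ih =>
    obtain ⟨rfl, hw⟩ := hw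
    exact ih hw hu.sliceOp

theorem sum_consL {n : ℕ} {u : Tensor} (hu : HasOrder (n + 1) u) :
    u = ∑ i, consL i fun y => u (i :: y) := by
  funext x
  rw [Finset.sum_apply]
  rcases x with _ | ⟨j, x⟩
  · simpa using hu [] (by simp)
  · simp

/-- Two linear maps agree on tensors of order at least `n` as soon as they agree on the
tensors `e_y ⊗ v` for all words `y` of length `n`. -/
theorem eq_of_pre_eq {n k : ℕ} {S T : Tensor →ₗ[𝕂] Tensor}
    (h : ∀ y : List (Fin 4), y.length = n → ∀ v, S (pre y v) = T (pre y v)) {u : Tensor}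
    (hu : HasOrder (n + k) u) : S u = T u := by
  induction n generalizing S T u with
  | zero => exact h [] rfl u
  | succ n ih =>
    rw [Nat.add_right_comm] at hu
    rw [sum_consL hu, map_sum, map_sum]
    refine Finset.sum_congr rfl fun i _ => ?_
    refine ih (S := S ∘ₗ consL i) (T := T ∘ₗ consL i) (fun y hy v => ?_) (hu.tail i)
    exact h (i :: y) (by simp [hy]) v

/-- Two operators agree on tensors of order at least `n`. -/
def AgreeOn (n : ℕ) (p q : Tensor →ₗ[𝕂] Tensor) : Prop :=
  ∀ k u, HasOrder (n + k) u → p u = q u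

theorem agreeOn_of_sameOn {n : ℕ} {p q : List Slice} (h : sameOn n p q = true) :
    AgreeOn n (wordOp p) (wordOp q) := fun _ _ hu =>
  eq_of_pre_eq (fun _ hy v => wordOp_pre_eq h hy v) hu

theorem AgreeOn.lift {n : ℕ} {p q : Tensor →ₗ[𝕂] Tensor} (h : AgreeOn n p q) :
    AgreeOn (n + 1) (lift p) (lift q) := by
  intro k u hu
  rw [Nat.add_right_comm] at hu
  funext x
  rcases x with _ | ⟨i, x⟩
  · rfl
  · exact congrFun (h k _ (hu.tail i)) x

theorem AgreeOn.lift_iterate {n : ℕ} {p q : Tensor →ₗ[𝕂] Tensor} (h : AgreeOn n p q) (l : ℕ) :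
    AgreeOn (n + l) (LinksGould.lift^[l] p) (LinksGould.lift^[l] q) := by
  induction l with
  | zero => exact h
  | succ l ih =>
    rw [Function.iterate_succ_apply', Function.iterate_succ_apply']
    exact ih.lift

theorem lift_id : AgreeOn 1 (lift LinearMap.id) LinearMap.id := by
  intro k u hu
  funext x
  rcases x with _ | ⟨i, x⟩
  · exact (hu [] (by simp; omega)).symm
  · rfl

theorem lift_iterate_id (l : ℕ) : AgreeOn l (lift^[l] LinearMap.id) LinearMap.id := by
  induction l with
  | zero => exact fun _ _ _ => rfl
  | succ l ih =>
    rw [Function.iterate_succ_apply']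
    intro k u hu
    rw [ih.lift k u hu]
    exact lift_id (l + k) u (by rwa [Nat.add_comm 1, Nat.add_right_comm])

theorem wordOp_append (v w : List Slice) : wordOp (v ++ w) = wordOp w ∘ₗ wordOp v := by
  induction v with
  | nil => rfl
  | cons x v ih => rw [List.cons_append, wordOp, ih, wordOp, LinearMap.comp_assoc]

theorem lift_iterate_comp (l : ℕ) (S T : Tensor →ₗ[𝕂] Tensor) :
    lift^[l] (S ∘ₗ T) = lift^[l] S ∘ₗ lift^[l] T := by
  induction l with
  | zero => rfl
  | succ l ih => simp only [Function.iterate_succ_apply', ih, lift_comp]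

theorem sliceOp_whisker (l r : List Bool) (x : Slice) :
    sliceOp ⟨l ++ x.left, x.gen, x.right ++ r⟩ = lift^[l.length] (sliceOp x) := by
  simp only [sliceOp, List.length_append, Function.iterate_add_apply]

theorem wordOp_whisker (l r : List Bool) (w : List Slice) :
    wordOp (whisker l r w) ∘ₗ lift^[l.length] LinearMap.id = lift^[l.length] (wordOp w) := by
  induction w with
  | nil => rfl
  | cons x w ih =>
    have : whisker l r (x :: w) = ⟨l ++ x.left, x.gen, x.right ++ r⟩ :: whisker l r w := rfl
    rw [this, wordOp, sliceOp_whisker, wordOp, lift_iterate_comp, ← ih, LinearMap.comp_assoc,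
      LinearMap.comp_assoc, ← lift_iterate_comp, ← lift_iterate_comp]
    rfl

theorem wordOp_whisker_apply {l r : List Bool} {w : List Slice} {k : ℕ} {u : Tensor}
    (hu : HasOrder (l.length + k) u) :
    wordOp (whisker l r w) u = (lift^[l.length] (wordOp w)) u := by
  rw [← wordOp_whisker l r w, LinearMap.comp_apply, lift_iterate_id _ k u hu]
  rfl

theorem isTangle_append_iff {s t : List Bool} {v w : List Slice} :
    IsTangle s (v ++ w) t ↔ ∃ r, IsTangle s v r ∧ IsTangle r w t := by
  constructor
  · intro h
    induction v generalizing s with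
    | nil => exact ⟨s, rfl, h⟩
    | cons x v ih =>
      obtain ⟨hx, h⟩ := h
      obtain ⟨r, h1, h2⟩ := ih h
      exact ⟨r, ⟨hx, h1⟩, h2⟩
  · rintro ⟨r, h1, h2⟩
    exact h1.append h2

theorem IsTangle.whisker {s t : List Bool} {w : List Slice} (hw : IsTangle s w t)
    (l r : List Bool) : IsTangle (l ++ s ++ r) (whisker l r w) (l ++ t ++ r) := by
  induction w generalizing s with
  | nil =>
    obtain rfl : s = t := hw
    exact rfl
  | cons x w ih =>
    obtain ⟨rfl, hw⟩ := hw
    refine ⟨by simp [Slice.source], ?_⟩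
    have := ih hw
    convert this using 1
    · simp [Slice.target]
    · rfl

/-! ### Exchange of distant pieces -/

/-- The piece `g` on the first factors commutes with an operator `T` on the factors to its right. -/
theorem genOp_lift (g : Gen) (T : Tensor →ₗ[𝕂] Tensor) :
    genOp g ∘ₗ lift^[g.dom.length] T = lift^[g.cod.length] T ∘ₗ genOp g := by
  refine LinearMap.ext fun u => funext fun x => ?_
  rcases g with ⟨a, b, o⟩ | a | a
  · rcases x with _ | ⟨k, _ | ⟨l, r⟩⟩
    · rfl
    · rfl
    · have h : (fun y => genOp (.crossing a b o) u (k :: l :: y)) =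
          ∑ i, ∑ j, crossMatrix a b o (k, l) (i, j) • fun y => u (i :: j :: y) := by
        funext y
        simp [genOp, crossOp]
      show _ = T (fun y => genOp (.crossing a b o) u (k :: l :: y)) r
      rw [h]
      simp only [map_sum, map_smul, Finset.sum_apply, Pi.smul_apply]
      rfl
  · rcases x with _ | ⟨k, _ | ⟨l, r⟩⟩
    · rfl
    · rfl
    · have h : (fun y => genOp (.cup a) u (k :: l :: y)) =
          (if k = l then (cupCoef a k).eval else 0) • u := by
        funext y
        simp [genOp, cupOp]
      show _ = T (fun y => genOp (.cup a) u (k :: l :: y)) r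
      rw [h, map_smul]
      simp [genOp, cupOp, Gen.dom]
  · have h : genOp (.cap a) u = ∑ i, (capCoef a i).eval • fun y => u (i :: i :: y) := by
      funext y
      simp [genOp, capOp]
    show _ = T (genOp (.cap a) u) x
    rw [h]
    simp only [map_sum, map_smul, Finset.sum_apply, Pi.smul_apply]
    rfl

/-- The value at a word `x ++ y` only depends on the part of the tensor that ends in `y`. -/
theorem wordOp_append_apply {s t : List Bool} {w : List Slice} (hw : IsTangle s w t)
    {z z' : Tensor} {y : List (Fin 4)} (hz : ∀ x, x.length = s.length → z (x ++ y) = z' x)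
    {x : List (Fin 4)} (hx : x.length = t.length) : wordOp w z (x ++ y) = wordOp w z' x := by
  have gen : ∀ (g : Gen) (n : ℕ) (z z' : Tensor),
      (∀ x, x.length = g.dom.length + n → z (x ++ y) = z' x) →
      ∀ x, x.length = g.cod.length + n → genOp g z (x ++ y) = genOp g z' x := by
    intro g n z z' hz x hx
    rcases g with ⟨a, b, o⟩ | a | a
    · rcases x with _ | ⟨k, _ | ⟨l, r⟩⟩
      · simp only [Gen.cod, List.length_cons, List.length_nil] at hx; omega
      · simp only [Gen.cod, List.length_cons, List.length_nil] at hx; omega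
      · rw [List.cons_append, List.cons_append, genOp_crossing_apply, genOp_crossing_apply]
        refine Finset.sum_congr rfl fun i _ => Finset.sum_congr rfl fun j _ => ?_
        congr 1
        exact hz (i :: j :: r) (by simpa [Gen.dom, Gen.cod] using hx)
    · rcases x with _ | ⟨k, _ | ⟨l, r⟩⟩
      · simp only [Gen.cod, List.length_cons, List.length_nil] at hx; omega
      · simp only [Gen.cod, List.length_cons, List.length_nil] at hx; omega
      · show (if k = l then _ * z (r ++ y) else 0) = if k = l then _ * z' r else 0
        rw [hz]
        simp [Gen.dom, Gen.cod] at hx ⊢; omega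
    · rw [genOp_cap_apply, genOp_cap_apply]
      refine Finset.sum_congr rfl fun i _ => ?_
      congr 1
      exact hz (i :: i :: x) (by simp [Gen.dom, Gen.cod] at hx ⊢; omega)
  have slice : ∀ (g : Gen) (n p : ℕ) (z z' : Tensor),
      (∀ x, x.length = g.dom.length + n + p → z (x ++ y) = z' x) →
      ∀ x, x.length = g.cod.length + n + p →
        (lift^[p] (genOp g)) z (x ++ y) = (lift^[p] (genOp g)) z' x := by
    intro g n p
    induction p with
    | zero => exact gen g n
    | succ p ih =>
      intro z z' hz x hx
      rw [Function.iterate_succ_apply']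
      rcases x with _ | ⟨i, x⟩
      · simp at hx
      · exact ih _ _ (fun x' hx' => hz (i :: x') (by simp [hx']; ring)) x
          (by simp only [List.length_cons] at hx; omega)
  induction w generalizing s z z' with
  | nil =>
    obtain rfl : s = t := hw
    exact hz x hx
  | cons a w ih =>
    obtain ⟨rfl, hw⟩ := hw
    refine ih hw (fun x hx => ?_)
    refine slice a.gen a.right.length a.left.length z z' (fun x hx => hz x ?_) x ?_
    · simp [Slice.source, hx]; ring
    · simp [hx, Slice.target]; ring

/-! ### Invariance under the elementary moves -/

theorem slideCap_check (a c o : Bool) :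
    sameOn 3 [⟨[c], .cap a, []⟩]
      [⟨[], .crossing c a o, [!a]⟩, ⟨[a], .crossing c (!a) o, []⟩, ⟨[], .cap a, [c]⟩] = true := by
  revert a c o
  decide +kernel

theorem slideCup_check (a c o : Bool) :
    sameOn 1 [⟨[c], .cup a, []⟩]
      [⟨[], .cup a, [c]⟩, ⟨[a], .crossing (!a) c o, []⟩, ⟨[], .crossing a c o, [!a]⟩] = true := by
  revert a c o
  decide +kernel

theorem overCup_check (a c o : Bool) :
    sameOn 1
      [⟨[c], .cup a, []⟩, ⟨[], .crossing c a o, [!a]⟩, ⟨[a], .crossing c (!a) o, []⟩]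
      [⟨[], .cup a, [c]⟩] = true := by
  revert a c o
  decide +kernel

theorem zigzagRight_check (a : Bool) :
    sameOn 1 [⟨[a], .cup (!a), []⟩, ⟨[], .cap a, [a]⟩] [] = true := by
  revert a
  decide +kernel

theorem zigzagLeft_check (a : Bool) :
    sameOn 1 [⟨[], .cup a, [a]⟩, ⟨[a], .cap (!a), []⟩] [] = true := by
  revert a
  decide +kernel

theorem reidemeisterOneRight_check (a o : Bool) :
    sameOn 1 [⟨[a], .cup a, []⟩, ⟨[], .crossing a a o, [!a]⟩, ⟨[a], .cap a, []⟩] [] = true := by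
  revert a o
  decide +kernel

theorem reidemeisterOneLeft_check (a o : Bool) :
    sameOn 1 [⟨[], .cup (!a), [a]⟩, ⟨[!a], .crossing a a o, []⟩, ⟨[], .cap (!a), [a]⟩] [] =
      true := by
  revert a o
  decide +kernel

theorem reidemeisterTwo_check (a b o : Bool) :
    sameOn 2 [⟨[], .crossing a b o, []⟩, ⟨[], .crossing b a (!o), []⟩] [] = true := by
  revert a b o
  decide +kernel

/-- The Yang–Baxter equation for two upward strands and a third strand that passes over or
under both. -/
theorem yangBaxter_check (c o o' : Bool) :
    sameOn 3
      [⟨[c], .crossing true true o', []⟩, ⟨[], .crossing c true o, [true]⟩,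
        ⟨[true], .crossing c true o, []⟩]
      [⟨[], .crossing c true o, [true]⟩, ⟨[true], .crossing c true o, []⟩,
        ⟨[], .crossing true true o', [c]⟩] = true := by
  revert c o o'
  decide +kernel

/-- A crossing of two strands that do not both run upwards is a rotated crossing of two upward
strands. -/
def rotatedCrossing : Bool → Bool → Bool → List Slice
  | true, true, o => [⟨[], .crossing true true o, []⟩]
  | true, false, o => [⟨[], .cup false, [true, false]⟩,
      ⟨[false], .crossing true true (!o), [false]⟩, ⟨[false, true], .cap true, []⟩]
  | false, true, o => [⟨[false, true], .cup true, []⟩,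
      ⟨[false], .crossing true true (!o), [false]⟩, ⟨[], .cap false, [true, false]⟩]
  | false, false, o => [⟨[false, false], .cup true, []⟩,
      ⟨[false, false, true], .cup true, [false]⟩,
      ⟨[false, false], .crossing true true o, [false, false]⟩,
      ⟨[false], .cap false, [true, false, false]⟩, ⟨[], .cap false, [false, false]⟩]

theorem rotatedCrossing_check (a b o : Bool) :
    sameOn 2 [⟨[], .crossing a b o, []⟩] (rotatedCrossing a b o) = true := by
  revert a b o
  decide +kernel

theorem isTangle_rotatedCrossing (a b o : Bool) :
    IsTangle [a, b] (rotatedCrossing a b o) [b, a] := by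
  cases a <;> cases b <;>
    simp [rotatedCrossing, IsTangle, Slice.source, Slice.target, Gen.dom, Gen.cod]

/-- The operator of the strand `c` that starts on the left of the level `s` and
passes over (`o = true`) or under all its strands to the right. -/
noncomputable def slide (c o : Bool) : List Bool → Tensor →ₗ[𝕂] Tensor
  | [] => LinearMap.id
  | a :: s => lift (slide c o s) ∘ₗ genOp (.crossing c a o)

/-- The piece `g` commutes with a strand of orientation `c` that passes over it or under it. -/
def Natural (c o : Bool) (g : Gen) : Prop :=
  AgreeOn (1 + g.dom.length) (slide c o g.cod ∘ₗ lift (genOp g)) (genOp g ∘ₗ slide c o g.dom)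

theorem HasOrder.crossing {n : ℕ} {u : Tensor} (hu : HasOrder n u) (a b o : Bool) :
    HasOrder n (LinksGould.genOp (.crossing a b o) u) := by
  intro x hx
  rcases x with _ | ⟨i, _ | ⟨j, x⟩⟩
  · rfl
  · rfl
  · rw [genOp_crossing_apply]
    refine Finset.sum_eq_zero fun i' _ => Finset.sum_eq_zero fun j' _ => ?_
    rw [hu _ (by simpa using hx), mul_zero]

theorem HasOrder.lift_of_forall {T : Tensor →ₗ[𝕂] Tensor}
    (hT : ∀ n u, HasOrder n u → HasOrder n (T u)) {n : ℕ} {u : Tensor} (hu : HasOrder n u) :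
    HasOrder n (LinksGould.lift T u) := by
  rcases n with _ | n
  · rintro (_ | ⟨i, x⟩) hx
    · rfl
    · have : (fun y => u (i :: y)) = 0 := funext fun y => hu _ (by simp)
      rw [lift_cons, this, map_zero]
      rfl
  · exact HasOrder.lift (fun v hv => hT n v hv) hu

theorem HasOrder.slide (c o : Bool) (s : List Bool) {n : ℕ} {u : Tensor}
    (hu : HasOrder n u) : HasOrder n (slide c o s u) := by
  induction s generalizing u n with
  | nil => exact hu
  | cons a s ih => exact HasOrder.lift_of_forall (fun n v hv => ih hv) (hu.crossing c a o)

theorem slide_pair (c o a b : Bool) {k : ℕ} {u : Tensor} (hu : HasOrder (3 + k) u) :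
    LinksGould.slide c o [a, b] u = lift (genOp (.crossing c b o)) (genOp (.crossing c a o) u) := by
  have h1 : HasOrder (3 + k) (lift (genOp (.crossing c b o)) (genOp (.crossing c a o) u)) :=
    HasOrder.lift_of_forall (fun n v hv => hv.crossing c b o) (hu.crossing c a o)
  have e : LinksGould.slide c o [a, b] u =
      lift (lift LinearMap.id) (lift (genOp (.crossing c b o)) (genOp (.crossing c a o) u)) := by
    simp only [LinksGould.slide, LinearMap.comp_apply, lift_comp]
  rw [e, lift_id.lift (1 + k) _ (by convert h1 using 1; ring),
    lift_id (2 + k) _ (by convert h1 using 1; ring)]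
  rfl

theorem slide_append (c o : Bool) (s t : List Bool) :
    slide c o (s ++ t) = (lift^[s.length] (slide c o t)) ∘ₗ slide c o s := by
  induction s with
  | nil => rfl
  | cons a s ih =>
    rw [List.cons_append, slide, ih, lift_comp, slide, List.length_cons,
      Function.iterate_succ_apply', LinearMap.comp_assoc]

theorem Natural.sliceOp {c o : Bool} {x : Slice} (h : Natural c o x.gen) :
    AgreeOn (1 + x.source.length) (slide c o x.target ∘ₗ lift (sliceOp x))
      (sliceOp x ∘ₗ slide c o x.source) := by
  obtain ⟨l, g, r⟩ := x
  simp only [LinksGould.sliceOp, Slice.source, Slice.target] at h ⊢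
  induction l with
  | nil =>
    intro k u hu
    have h1 := h (r.length + k) u (by simpa [add_assoc] using hu)
    simp only [List.nil_append, List.length_nil, Function.iterate_zero, id_eq, slide_append,
      LinearMap.comp_apply] at h1 ⊢
    rw [h1]
    exact (congrFun (congrArg DFunLike.coe (genOp_lift g (slide c o r))) _).symm
  | cons b l ih =>
    intro k u hu
    simp only [List.cons_append, List.length_cons, slide, LinearMap.comp_apply] at hu ⊢
    rw [Function.iterate_succ_apply']
    have h2 := genOp_lift (.crossing c b o) (lift^[l.length] (genOp g))
    have h3 := congrFun (congrArg DFunLike.coe h2) u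
    have h4 := hu.crossing c b o
    simp only [Gen.dom, Gen.cod, List.length_cons, List.length_nil, zero_add,
      LinearMap.comp_apply, Function.iterate_succ_apply', Function.iterate_zero, id] at h3
    rw [h3]
    funext x
    rcases x with _ | ⟨i, x⟩
    · rfl
    · exact congrFun (ih k _ (HasOrder.tail (by convert h4 using 1; ring) i)) x

/-- A strand slides across a tangle diagram if it slides across each of its pieces. -/
theorem AgreeOn.slide_wordOp {c o : Bool} {s t : List Bool} {w : List Slice}
    (hw : IsTangle s w t) (h : ∀ x ∈ w, Natural c o x.gen) :
    AgreeOn (1 + s.length) (slide c o t ∘ₗ LinksGould.lift (wordOp w)) (wordOp w ∘ₗ slide c o s) := by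
  induction w generalizing s with
  | nil =>
    obtain rfl : s = t := hw
    intro k u hu
    show slide c o s (LinksGould.lift LinearMap.id u) = slide c o s u
    rw [lift_id (s.length + k) u (by rwa [← add_assoc])]
    rfl
  | cons x w ih =>
    obtain ⟨rfl, hw⟩ := hw
    intro k u hu
    have h1 := (h x (by simp)).sliceOp k u hu
    have h2 : HasOrder (1 + x.target.length + k) (LinksGould.lift (LinksGould.sliceOp x) u) := by
      have := HasOrder.lift (m := x.source.length + k) (n := x.target.length + k)
        (fun v hv => HasOrder.sliceOp hv) (u := u) (by convert hu using 1; ring)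
      convert this using 1
      ring
    have h3 := ih hw (fun y hy => h y (by simp [hy])) k _ h2
    simp only [LinearMap.comp_apply, wordOp, lift_comp] at h1 h3 ⊢
    rw [h3, h1]

theorem natural_cap (c o a : Bool) : Natural c o (.cap a) := by
  intro k u hu
  have := agreeOn_of_sameOn (slideCap_check a c o) k u hu
  exact this

theorem natural_cup (c o a : Bool) : Natural c o (.cup a) := by
  intro k u hu
  have h := agreeOn_of_sameOn (overCup_check a c o) k u hu
  have h1 : HasOrder (3 + k) (lift (genOp (.cup a)) u) := by
    have := HasOrder.lift (m := k) (n := 2 + k) (T := genOp (.cup a))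
      (fun v hv => HasOrder.genOp (g := .cup a) (by simpa [Gen.dom] using hv)) (u := u)
      (by simpa [Gen.dom, add_comm] using hu)
    convert this using 1
    ring
  exact (slide_pair c o a (!a) h1).trans h

/-- The case of two upward strands is the Yang–Baxter equation; all other crossings are reduced to it. -/
theorem natural_upUp (c o o' : Bool) : Natural c o (.crossing true true o') := by
  intro k u hu
  have h := agreeOn_of_sameOn (yangBaxter_check c o o') k u hu
  have h1 : HasOrder (3 + k) (lift (genOp (.crossing true true o')) u) :=
    HasOrder.lift_of_forall (fun n v hv => hv.crossing true true o') hu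
  refine (slide_pair c o true true h1).trans (h.trans ?_)
  exact congrArg (genOp (.crossing true true o')) (slide_pair c o true true hu).symm

/-- A strand slides across every piece: a crossing of any orientation is a composite of extrema and one
crossing of two upward strands. -/
theorem natural (c o : Bool) (g : Gen) : Natural c o g := by
  rcases g with ⟨a, b, o'⟩ | a | a
  · have hw := isTangle_rotatedCrossing a b o'
    have he := agreeOn_of_sameOn (rotatedCrossing_check a b o')
    have hn : ∀ x ∈ rotatedCrossing a b o', Natural c o x.gen := by
      cases a <;> cases b <;>
        simp [rotatedCrossing, natural_upUp, natural_cup, natural_cap]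
    intro k u hu
    have h1 := AgreeOn.slide_wordOp hw hn k u hu
    have h2 := he.lift k u hu
    have h3 := he (1 + k) (slide c o [a, b] u)
      (HasOrder.slide c o _ (by convert hu using 1; simp [Gen.dom]; ring))
    simp only [LinearMap.comp_apply] at h1
    rw [← h2, ← h3] at h1
    exact h1
  · exact natural_cup c o a
  · exact natural_cap c o a

/-- Every tangle commutes with a strand that passes over it or under it. -/
theorem tangle_natural (c o : Bool) {s t : List Bool} {w : List Slice} (hw : IsTangle s w t) :
    AgreeOn (1 + s.length) (slide c o t ∘ₗ lift (wordOp w)) (wordOp w ∘ₗ slide c o s) :=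
  AgreeOn.slide_wordOp hw fun x _ => natural c o x.gen

/-- The third Reidemeister move is the sliding of the strand `a` over the crossing of the other two. -/
theorem reidemeisterThree_agreeOn (a b c : Bool) :
    AgreeOn 3
      (wordOp [⟨[], .crossing a b true, [c]⟩, ⟨[b], .crossing a c true, []⟩,
          ⟨[], .crossing b c true, [a]⟩])
      (wordOp [⟨[a], .crossing b c true, []⟩, ⟨[], .crossing a c true, [b]⟩,
          ⟨[c], .crossing a b true, []⟩]) := by
  intro k u hu
  have h := natural a true (.crossing b c true) k u hu
  have h1 : HasOrder (3 + k) (lift (genOp (.crossing b c true)) u) :=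
    HasOrder.lift_of_forall (fun n v hv => hv.crossing b c true) hu
  have h2 := slide_pair a true c b h1
  have h3 := slide_pair a true b c hu
  simp only [LinearMap.comp_apply, Gen.dom, Gen.cod] at h
  rw [h2, h3] at h
  exact h.symm

theorem exchange_wordOp (g h : Gen) (m : List Bool) :
    wordOp [⟨[], g, m ++ h.dom⟩, ⟨g.cod ++ m, h, []⟩] =
      wordOp [⟨g.dom ++ m, h, []⟩, ⟨[], g, m ++ h.cod⟩] := by
  have e := genOp_lift g (lift^[m.length] (genOp h))
  simp only [← Function.iterate_add_apply] at e
  simp only [wordOp, sliceOp, List.length_append]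
  exact congrArg (fun T => LinearMap.id ∘ₗ T) e.symm

/-- An elementary move does not change the operator of a tangle diagram. -/
theorem ElemMove.agreeOn {p q : List Slice} (h : ElemMove p q) :
    ∃ s t, IsTangle s p t ∧ IsTangle s q t ∧ p ≠ [] ∧ (s ≠ [] ∨ t ≠ []) ∧
      AgreeOn s.length (wordOp p) (wordOp q) := by
  cases h with
  | exchange g h m =>
    refine ⟨g.dom ++ m ++ h.dom, g.cod ++ m ++ h.cod, ?_, ?_, by simp, ?_,
      fun k u _ => by rw [exchange_wordOp]⟩
    · simp [IsTangle, Slice.source, Slice.target]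
    · simp [IsTangle, Slice.source, Slice.target]
    · cases g <;> simp [Gen.dom, Gen.cod]
  | zigzagRight a =>
    exact ⟨[a], [a], by simp [IsTangle, Slice.source, Slice.target, Gen.dom, Gen.cod], rfl,
      by simp, by simp, agreeOn_of_sameOn (zigzagRight_check a)⟩
  | zigzagLeft a =>
    exact ⟨[a], [a], by simp [IsTangle, Slice.source, Slice.target, Gen.dom, Gen.cod], rfl,
      by simp, by simp, agreeOn_of_sameOn (zigzagLeft_check a)⟩
  | slideCap a c o =>
    exact ⟨[c, a, !a], [c], by simp [IsTangle, Slice.source, Slice.target, Gen.dom, Gen.cod],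
      by simp [IsTangle, Slice.source, Slice.target, Gen.dom, Gen.cod],
      by simp, by simp, agreeOn_of_sameOn (slideCap_check a c o)⟩
  | slideCup a c o =>
    exact ⟨[c], [c, a, !a], by simp [IsTangle, Slice.source, Slice.target, Gen.dom, Gen.cod],
      by simp [IsTangle, Slice.source, Slice.target, Gen.dom, Gen.cod],
      by simp, by simp, agreeOn_of_sameOn (slideCup_check a c o)⟩
  | reidemeisterOneRight a o =>
    exact ⟨[a], [a], by simp [IsTangle, Slice.source, Slice.target, Gen.dom, Gen.cod], rfl,
      by simp, by simp, agreeOn_of_sameOn (reidemeisterOneRight_check a o)⟩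
  | reidemeisterOneLeft a o =>
    exact ⟨[a], [a], by simp [IsTangle, Slice.source, Slice.target, Gen.dom, Gen.cod], rfl,
      by simp, by simp, agreeOn_of_sameOn (reidemeisterOneLeft_check a o)⟩
  | reidemeisterTwo a b o =>
    exact ⟨[a, b], [a, b], by simp [IsTangle, Slice.source, Slice.target, Gen.dom, Gen.cod], rfl,
      by simp, by simp, agreeOn_of_sameOn (reidemeisterTwo_check a b o)⟩
  | reidemeisterThree a b c =>
    exact ⟨[a, b, c], [c, b, a], by simp [IsTangle, Slice.source, Slice.target, Gen.dom, Gen.cod],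
      by simp [IsTangle, Slice.source, Slice.target, Gen.dom, Gen.cod],
      by simp, by simp, reidemeisterThree_agreeOn a b c⟩

/-! ### Cutting a closed diagram -/

/-- The weight of a strand in the state `eᵢ` when it is closed by an arc on its right: `μ` for an upward
strand, `μ⁻¹` for a downward one.  An arc on the left contributes `weight (!a)`. -/
noncomputable def weight (a : Bool) (i : Fin 4) : 𝕂 := if a then μ i else (μ i)⁻¹

theorem eval_muCoef (i : Fin 4) : (muCoef i).eval = μ i := by
  have h0 : s₀ ^ (-2 : ℤ) = t₀⁻¹ := by rw [zpow_neg, ← s₀_sq]; norm_cast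
  have h1 : s₁ ^ (2 : ℤ) = t₁ := by rw [← s₁_sq]; norm_cast
  fin_cases i <;> simp [muCoef, Mono.eval, μ, h0, h1]

theorem eval_muInvCoef (i : Fin 4) : (muInvCoef i).eval = (μ i)⁻¹ := by
  have h0 : s₀ ^ (2 : ℤ) = t₀ := by rw [← s₀_sq]; norm_cast
  have h1 : s₁ ^ (-2 : ℤ) = t₁⁻¹ := by rw [zpow_neg, ← s₁_sq]; norm_cast
  fin_cases i <;> simp [muInvCoef, Mono.eval, μ, h0, h1, inv_neg]

theorem μ_ne_zero (i : Fin 4) : μ i ≠ 0 := by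
  fin_cases i <;> simp [μ, t₀_ne_zero, t₁_ne_zero]

/-- The formal sums of the weights. -/
def weightCoef (a : Bool) (i : Fin 4) : Coef := if a then muCoef i else muInvCoef i

theorem eval_weightCoef (a : Bool) (i : Fin 4) : (weightCoef a i).eval = weight a i := by
  cases a
  · exact eval_muInvCoef i
  · exact eval_muCoef i

theorem weight_mul_not (a : Bool) (i : Fin 4) : weight a i * weight (!a) i = 1 := by
  cases a
  · exact inv_mul_cancel₀ (μ_ne_zero i)
  · exact mul_inv_cancel₀ (μ_ne_zero i)

theorem cup_mul_cap (a : Bool) (i : Fin 4) :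
    (cupCoef a i).eval * (capCoef a i).eval = weight a i := by
  cases a <;> simp [cupCoef, capCoef, eval_muCoef, eval_muInvCoef, weight, Mono.eval]

/-- A crossing only relates basis tensors of equal total weight.  The parameter `e` replaces all weights
by their inverses. -/
theorem row_weight_check : ∀ a b o e : Bool, ∀ i j : Fin 4,
    ((row a b o i j).all fun t =>
      SparseVec.same
        [([], Coef.mul (weightCoef (a ^^ e) i) (weightCoef (b ^^ e) j))]
        [([], Coef.mul (weightCoef (b ^^ e) t.1) (weightCoef (a ^^ e) t.2.1))]) = true := by
  decide +kernel

theorem crossMatrix_weight (a b o e : Bool) (k l i j : Fin 4) :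
    weight (b ^^ e) k * weight (a ^^ e) l * crossMatrix a b o (k, l) (i, j) =
      crossMatrix a b o (k, l) (i, j) * (weight (a ^^ e) i * weight (b ^^ e) j) := by
  have h := List.all_eq_true.1 (row_weight_check a b o e i j)
  simp only [crossMatrix]
  generalize row a b o i j = L at h
  induction L with
  | nil => simp
  | cons t L ih =>
    simp only [List.map_cons, List.sum_cons, mul_add, add_mul]
    rw [ih fun x hx => h x (List.mem_cons_of_mem _ hx)]
    congr 1
    split_ifs with hk
    · have h1 := SparseVec.sum_eq_of_same (fun _ => (1 : 𝕂)) (h t (by simp))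
      simp only [SparseVec.sum_cons, SparseVec.sum_nil, Coef.eval_mul, eval_weightCoef,
        smul_eq_mul, mul_one, add_zero] at h1
      obtain ⟨rfl, rfl⟩ := Prod.mk.inj hk
      rw [h1]
      ring
    · simp

/-- The operator `diag(w) ⊗ T`. -/
noncomputable def diagL (w : Fin 4 → 𝕂) (T : Tensor →ₗ[𝕂] Tensor) : Tensor →ₗ[𝕂] Tensor where
  toFun u x :=
    match x with
    | [] => 0
    | i :: x => w i * T (fun y => u (i :: y)) x
  map_add' u v := by
    funext x
    rcases x with _ | ⟨i, x⟩
    · simp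
    · have := congrFun (T.map_add (fun y => u (i :: y)) (fun y => v (i :: y))) x
      show w i * T ((fun y => u (i :: y)) + fun y => v (i :: y)) x = _
      rw [this]
      exact mul_add _ _ _
  map_smul' c u := by
    funext x
    rcases x with _ | ⟨i, x⟩
    · simp
    · have := congrFun (T.map_smul c (fun y => u (i :: y))) x
      show w i * T (c • fun y => u (i :: y)) x = _
      rw [this]
      exact mul_left_comm _ _ _

@[simp] theorem diagL_nil (w : Fin 4 → 𝕂) (T : Tensor →ₗ[𝕂] Tensor) (u : Tensor) :
    diagL w T u [] = 0 := rfl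
@[simp] theorem diagL_cons (w : Fin 4 → 𝕂) (T : Tensor →ₗ[𝕂] Tensor) (u : Tensor) (i : Fin 4)
    (x : List (Fin 4)) : diagL w T u (i :: x) = w i * T (fun y => u (i :: y)) x := rfl

/-- Multiply by the weights of the strands `s` and apply `T` to the remaining factors. -/
noncomputable def weigh : List Bool → (Tensor →ₗ[𝕂] Tensor) → (Tensor →ₗ[𝕂] Tensor)
  | [], T => T
  | a :: s, T => diagL (weight a) (weigh s T)

theorem weigh_append (s t : List Bool) (T : Tensor →ₗ[𝕂] Tensor) :
    weigh (s ++ t) T = weigh s (weigh t T) := by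
  induction s with
  | nil => rfl
  | cons a s ih => rw [List.cons_append, weigh, ih, weigh]

theorem diagL_comp_lift {w : Fin 4 → 𝕂} {S S' A : Tensor →ₗ[𝕂] Tensor} (h : S ∘ₗ A = A ∘ₗ S') :
    diagL w S ∘ₗ lift A = lift A ∘ₗ diagL w S' := by
  refine LinearMap.ext fun u => funext fun x => ?_
  rcases x with _ | ⟨i, x⟩
  · rfl
  · show w i * (S ∘ₗ A) (fun y => u (i :: y)) x = A (w i • S' fun y => u (i :: y)) x
    rw [h, map_smul]
    rfl

theorem weigh_comp_lift (s : List Bool) {S S' A : Tensor →ₗ[𝕂] Tensor} (h : S ∘ₗ A = A ∘ₗ S') :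
    weigh s S ∘ₗ lift^[s.length] A = lift^[s.length] A ∘ₗ weigh s S' := by
  induction s with
  | nil => exact h
  | cons a s ih =>
    rw [List.length_cons, Function.iterate_succ_apply']
    exact diagL_comp_lift ih

/-- The pieces of a diagram preserve the weights of the states: `μ^{⊗n}`, with `μ⁻¹` on the downward
strands, commutes with them.  For `e = true` all weights are inverted. -/
theorem weigh_comp_genOp (e : Bool) (g : Gen) (T : Tensor →ₗ[𝕂] Tensor) :
    weigh (g.cod.map (· ^^ e)) T ∘ₗ genOp g = genOp g ∘ₗ weigh (g.dom.map (· ^^ e)) T := by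
  refine LinearMap.ext fun u => funext fun x => ?_
  rcases g with ⟨a, b, o⟩ | a | a
  · rcases x with _ | ⟨k, _ | ⟨l, r⟩⟩
    · rfl
    · simp [Gen.cod, Gen.dom, weigh, genOp, crossOp]
    · have h : (fun y => genOp (.crossing a b o) u (k :: l :: y)) =
          ∑ i, ∑ j, crossMatrix a b o (k, l) (i, j) • fun y => u (i :: j :: y) := by
        funext y
        simp [genOp, crossOp]
      show weight (b ^^ e) k * (weight (a ^^ e) l *
        T (fun y => genOp (.crossing a b o) u (k :: l :: y)) r) = _
      rw [LinearMap.comp_apply, genOp_crossing_apply, h]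
      simp only [map_sum, map_smul, Finset.sum_apply, Pi.smul_apply, Finset.mul_sum, smul_eq_mul]
      refine Finset.sum_congr rfl fun i _ => Finset.sum_congr rfl fun j _ => ?_
      have := crossMatrix_weight a b o e k l i j
      simp only [Gen.dom, List.map_cons, List.map_nil, weigh, diagL_cons]
      linear_combination (T (fun y => u (i :: j :: y)) r) * this
  · rcases x with _ | ⟨k, _ | ⟨l, r⟩⟩
    · rfl
    · simp [Gen.cod, Gen.dom, weigh, genOp, cupOp]
    · have h : (fun y => genOp (.cup a) u (k :: l :: y)) =
          (if k = l then (cupCoef a k).eval else 0) • u := by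
        funext y
        simp [genOp, cupOp]
      show weight (a ^^ e) k * (weight (!a ^^ e) l *
        T (fun y => genOp (.cup a) u (k :: l :: y)) r) = _
      rw [LinearMap.comp_apply, genOp_cup_apply, h, map_smul]
      simp only [Gen.dom, List.map_nil, weigh, Pi.smul_apply, smul_eq_mul]
      have hw := weight_mul_not (a ^^ e) k
      rw [← Bool.not_xor] at hw
      split_ifs with hk
      · subst hk
        linear_combination ((cupCoef a k).eval * T u r) * hw
      · ring
  · have h : genOp (.cap a) u = ∑ i, (capCoef a i).eval • fun y => u (i :: i :: y) := by
      funext y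
      simp [genOp, capOp]
    show T (genOp (.cap a) u) x = _
    rw [LinearMap.comp_apply, genOp_cap_apply, h]
    simp only [map_sum, map_smul, Finset.sum_apply, Pi.smul_apply, smul_eq_mul]
    refine Finset.sum_congr rfl fun i _ => ?_
    simp only [Gen.dom, List.map_cons, List.map_nil, weigh, diagL_cons]
    have hw := weight_mul_not (a ^^ e) i
    rw [← Bool.not_xor] at hw
    linear_combination (-(capCoef a i).eval * T (fun y => u (i :: i :: y)) x) * hw

theorem weigh_comp_slice (e : Bool) (l r : List Bool) (g : Gen) (T : Tensor →ₗ[𝕂] Tensor) :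
    weigh ((l ++ g.cod ++ r).map (· ^^ e)) T ∘ₗ lift^[l.length] (genOp g) =
      lift^[l.length] (genOp g) ∘ₗ weigh ((l ++ g.dom ++ r).map (· ^^ e)) T := by
  have h := weigh_comp_lift (l.map (· ^^ e))
    (weigh_comp_genOp e g (weigh (r.map (· ^^ e)) T))
  simpa only [List.map_append, weigh_append, List.append_assoc, List.length_map] using h

/-- The part of a tensor that starts with the word `x`. -/
noncomputable def dropL (x : List (Fin 4)) : Tensor →ₗ[𝕂] Tensor where
  toFun u r := u (x ++ r)
  map_add' _ _ := rfl
  map_smul' _ _ := rfl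

/-- Cut the strands between `l` and `r`, put the state `x` on their lower ends and the
state `x'` on their upper ends, and weigh the other strands. -/
noncomputable def cutOp (l : List Bool) (x x' : List (Fin 4)) (r : List Bool) :
    Tensor →ₗ[𝕂] Tensor :=
  weigh (l.map not) (pre x' ∘ₗ weigh r LinearMap.id ∘ₗ dropL x)

/-- A piece on the left of the cut passes from above the cut to below it. -/
theorem cutOp_comp_left (g : Gen) (l₁ l₂ r : List Bool) (x x' : List (Fin 4)) :
    cutOp (l₁ ++ g.cod ++ l₂) x x' r ∘ₗ lift^[l₁.length] (genOp g) =
      lift^[l₁.length] (genOp g) ∘ₗ cutOp (l₁ ++ g.dom ++ l₂) x x' r := by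
  have h : (fun a : Bool => a ^^ true) = not := by funext a; simp
  have := weigh_comp_slice true l₁ l₂ g (pre x' ∘ₗ weigh r LinearMap.id ∘ₗ dropL x)
  rwa [h] at this

theorem dropL_comp_lift (x : List (Fin 4)) (A : Tensor →ₗ[𝕂] Tensor) :
    dropL x ∘ₗ lift^[x.length] A = A ∘ₗ dropL x := by
  refine LinearMap.ext fun u => ?_
  induction x generalizing u with
  | nil => rfl
  | cons i x ih =>
    rw [List.length_cons, Function.iterate_succ_apply']
    exact ih fun y => u (i :: y)

theorem lift_comp_pre (x : List (Fin 4)) (A : Tensor →ₗ[𝕂] Tensor) :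
    lift^[x.length] A ∘ₗ pre x = pre x ∘ₗ A := by
  refine LinearMap.ext fun u => ?_
  induction x with
  | nil => rfl
  | cons i x ih =>
    rw [List.length_cons, Function.iterate_succ_apply']
    simp only [LinearMap.comp_apply, pre_cons, lift_consL] at ih ⊢
    rw [ih]

/-- A piece on the right of the cut passes from above the cut to below it. -/
theorem cutOp_comp_right (g : Gen) (l r₁ r₂ : List Bool) {x x' : List (Fin 4)}
    (hx : x'.length = x.length) :
    cutOp l x x' (r₁ ++ g.cod ++ r₂) ∘ₗ lift^[l.length + x.length + r₁.length] (genOp g) =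
      lift^[l.length + x.length + r₁.length] (genOp g) ∘ₗ cutOp l x x' (r₁ ++ g.dom ++ r₂) := by
  have h0 := weigh_comp_slice false r₁ r₂ g LinearMap.id
  have he : (fun a : Bool => a ^^ false) = id := by funext a; simp
  rw [he, List.map_id, List.map_id] at h0
  have h1 : (pre x' ∘ₗ weigh (r₁ ++ g.cod ++ r₂) LinearMap.id ∘ₗ dropL x) ∘ₗ
        lift^[x.length] (lift^[r₁.length] (genOp g)) =
      lift^[x.length] (lift^[r₁.length] (genOp g)) ∘ₗ
        (pre x' ∘ₗ weigh (r₁ ++ g.dom ++ r₂) LinearMap.id ∘ₗ dropL x) := by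
    refine LinearMap.ext fun u => ?_
    have e1 := LinearMap.congr_fun (dropL_comp_lift x (lift^[r₁.length] (genOp g))) u
    have e2 := LinearMap.congr_fun h0 (dropL x u)
    have e3 := LinearMap.congr_fun (lift_comp_pre x' (lift^[r₁.length] (genOp g)))
      (weigh (r₁ ++ g.dom ++ r₂) LinearMap.id (dropL x u))
    simp only [LinearMap.comp_apply] at e1 e2 e3 ⊢
    rw [e1, e2, ← e3, hx]
  have h2 := weigh_comp_lift (l.map not) h1
  rw [List.length_map] at h2
  simpa only [Function.iterate_add_apply, cutOp] using h2

/-- The scalar `1` as a tensor without factors. -/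
noncomputable def vac : Tensor := fun x => if x = [] then 1 else 0

theorem hasOrder_vac : HasOrder 0 vac := fun x hx => if_neg (by rintro rfl; exact hx rfl)

theorem HasOrder.eq_smul_vac {u : Tensor} (hu : HasOrder 0 u) : u = u [] • vac := by
  funext x
  rcases x with _ | ⟨i, x⟩
  · simp [vac]
  · rw [hu _ (by simp)]
    simp [vac]

theorem hasOrder_pre (x : List (Fin 4)) {n : ℕ} {v : Tensor} (hv : HasOrder n v) :
    HasOrder (n + x.length) (pre x v) := by
  induction x with
  | nil => exact hv
  | cons i x ih =>
    rintro (_ | ⟨j, y⟩) hy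
    · rfl
    · rw [pre_cons, consL_cons]
      split_ifs
      · exact ih y (by simp only [List.length_cons] at hy; omega)
      · rfl

theorem hasOrder_pre_vac (x : List (Fin 4)) : HasOrder x.length (pre x vac) := by
  simpa using hasOrder_pre x hasOrder_vac

theorem pre_append (x y : List (Fin 4)) (v : Tensor) : pre (x ++ y) v = pre x (pre y v) := by
  induction x with
  | nil => rfl
  | cons i x ih => rw [List.cons_append, pre_cons, ih, pre_cons]

theorem pre_apply_append {x x' : List (Fin 4)} (h : x.length = x'.length) (v : Tensor)
    (y : List (Fin 4)) : pre x v (x' ++ y) = if x' = x then v y else 0 := by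
  induction x generalizing x' with
  | nil =>
    obtain rfl := List.eq_nil_of_length_eq_zero h.symm
    simp
  | cons i x ih =>
    rcases x' with _ | ⟨j, x'⟩
    · simp at h
    · rw [List.cons_append, pre_cons, consL_cons, ih (by simpa using h)]
      by_cases hj : j = i <;> simp [hj]

/-- Evaluate the diagram `w₁` below and the diagram `w₂` above a level whose strands between
`l` and `r` are cut open. -/
noncomputable def cutVal (w₁ w₂ : List Slice) (l : List Bool) (x x' : List (Fin 4))
    (r : List Bool) : 𝕂 :=
  wordOp w₂ (cutOp l x x' r (wordOp w₁ vac)) []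

theorem weigh_sum (s : List Bool) (c : Fin 4 → 𝕂) (T : Fin 4 → Tensor →ₗ[𝕂] Tensor) :
    weigh s (∑ i, c i • T i) = ∑ i, c i • weigh s (T i) := by
  induction s with
  | nil => rfl
  | cons a s ih =>
    rw [weigh, ih]
    refine LinearMap.ext fun u => funext fun x => ?_
    rcases x with _ | ⟨j, x⟩
    · simp [weigh, LinearMap.sum_apply]
    · simp only [diagL_cons, weigh, LinearMap.sum_apply, Finset.sum_apply, LinearMap.smul_apply,
        Pi.smul_apply, smul_eq_mul, Finset.mul_sum]
      exact Finset.sum_congr rfl fun i _ => mul_left_comm _ _ _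

theorem diagL_eq_sum (w : Fin 4 → 𝕂) (T : Tensor →ₗ[𝕂] Tensor) :
    diagL w T = ∑ i, w i • (consL i ∘ₗ T ∘ₗ dropL [i]) := by
  refine LinearMap.ext fun u => funext fun x => ?_
  rw [LinearMap.sum_apply, Finset.sum_apply]
  rcases x with _ | ⟨j, x⟩
  · simp
  · simp [dropL]

theorem cutOp_right (l r : List Bool) (x x' : List (Fin 4)) (c : Bool) :
    cutOp l x x' (c :: r) = ∑ i, weight c i • cutOp l (x ++ [i]) (x' ++ [i]) r := by
  simp only [cutOp]
  rw [← weigh_sum, weigh, diagL_eq_sum]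
  congr 1
  refine LinearMap.ext fun u => ?_
  simp only [LinearMap.comp_apply, LinearMap.sum_apply, map_sum, LinearMap.smul_apply, map_smul,
    pre_append, pre_cons, pre_nil]
  refine Finset.sum_congr rfl fun i _ => ?_
  have : dropL [i] (dropL x u) = dropL (x ++ [i]) u := by
    funext y
    simp [dropL]
  rw [this]

theorem cutOp_left (l r : List Bool) (x x' : List (Fin 4)) (c : Bool) :
    cutOp (l ++ [c]) x x' r = ∑ i, weight (!c) i • cutOp l (i :: x) (i :: x') r := by
  simp only [cutOp]
  rw [← weigh_sum, List.map_append, weigh_append]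
  simp only [List.map_cons, List.map_nil, weigh]
  rw [diagL_eq_sum]
  congr 1

/-- The first strand on the right of the cut may be cut open as well, with a weighted sum over its
states. -/
theorem cutVal_right (w₁ w₂ : List Slice) (l r : List Bool) (x x' : List (Fin 4)) (c : Bool) :
    cutVal w₁ w₂ l x x' (c :: r) =
      ∑ i, weight c i * cutVal w₁ w₂ l (x ++ [i]) (x' ++ [i]) r := by
  simp [cutVal, cutOp_right, LinearMap.sum_apply]

/-- The last strand on the left of the cut may be cut open as well, with a weighted sum over its
states. -/
theorem cutVal_left (w₁ w₂ : List Slice) (l r : List Bool) (x x' : List (Fin 4)) (c : Bool) :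
    cutVal w₁ w₂ (l ++ [c]) x x' r =
      ∑ i, weight (!c) i * cutVal w₁ w₂ l (i :: x) (i :: x') r := by
  simp [cutVal, cutOp_left, LinearMap.sum_apply]

theorem lift_iterate_append (T : Tensor →ₗ[𝕂] Tensor) (u : Tensor) (x y : List (Fin 4)) :
    (lift^[x.length] T) u (x ++ y) = T (fun r => u (x ++ r)) y := by
  have := congrFun (LinearMap.congr_fun (dropL_comp_lift x T) u) y
  exact this

theorem wordOp_singleton (x : Slice) : wordOp [x] = sliceOp x := rfl

theorem wordOp_whisker_nil (r : List Bool) (w : List Slice) : wordOp (whisker [] r w) = wordOp w := by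
  simpa using wordOp_whisker [] r w

/-- A local minimum inserts `∑ᵢ cᵢ eᵢ ⊗ eᵢ` on the left. -/
theorem genOp_cup_eq_sum (a : Bool) (z : Tensor) :
    genOp (.cup a) z = ∑ i, (cupCoef a i).eval • consL i (consL i z) := by
  funext x
  rw [Finset.sum_apply]
  rcases x with _ | ⟨k, _ | ⟨l, x⟩⟩
  · simp [genOp, cupOp]
  · simp [genOp, cupOp]
  · rw [genOp_cup_apply]
    simp [eq_comm]

/-- The matrix of a tangle: the coefficient of `e_x` in the image of `e_{x'}`. -/
noncomputable def entry (w : List Slice) (x x' : List (Fin 4)) : 𝕂 := wordOp w (pre x' vac) x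

/-- The last strand of a tangle, closed by an arc on the right, gives the right partial trace. -/
theorem entry_closeRight {s : List Bool} {c : Bool} {w : List Slice}
    (hw : IsTangle (s ++ [c]) w (s ++ [c])) {x x' : List (Fin 4)} (hx : x.length = s.length)
    (hx' : x'.length = s.length) :
    entry ([⟨s, .cup c, []⟩] ++ whisker [] [!c] w ++ [⟨s, .cap c, []⟩]) x x' =
      ∑ i, weight c i * entry w (x ++ [i]) (x' ++ [i]) := by
  have h1 : sliceOp ⟨s, .cup c, []⟩ (pre x' vac) =
      ∑ i, (cupCoef c i).eval • pre (x' ++ [i] ++ [i]) vac := by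
    have := LinearMap.congr_fun (lift_comp_pre x' (genOp (.cup c))) vac
    rw [sliceOp, ← hx']
    rw [LinearMap.comp_apply] at this
    rw [this, LinearMap.comp_apply, genOp_cup_eq_sum c vac, map_sum]
    refine Finset.sum_congr rfl fun i _ => ?_
    rw [map_smul, pre_append, pre_append]
    rfl
  have h2 : ∀ u : Tensor, sliceOp ⟨s, .cap c, []⟩ u x =
      ∑ i, (capCoef c i).eval * u (x ++ [i] ++ [i]) := by
    intro u
    have := lift_iterate_append (genOp (.cap c)) u x []
    rw [hx, List.append_nil] at this
    rw [sliceOp, this, genOp_cap_apply]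
    simp
  have h3 : ∀ i j : Fin 4, wordOp w (pre (x' ++ [j] ++ [j]) vac) (x ++ [i] ++ [i]) =
      if i = j then entry w (x ++ [i]) (x' ++ [i]) else 0 := by
    intro i j
    have h := wordOp_append_apply hw (z := pre (x' ++ [j] ++ [j]) vac)
      (z' := if i = j then pre (x' ++ [j]) vac else 0) (y := [i]) (fun y hy => ?_)
      (x := x ++ [i]) (by simp [hx])
    · rw [h]
      split_ifs with hij
      · subst hij
        rfl
      · simp
    · rw [pre_append, pre_apply_append (by simp [hy, hx'])]
      by_cases hij : i = j
      · subst hij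
        have := pre_apply_append (x := x' ++ [i]) (x' := y) (by simp [hy, hx']) vac []
        rw [List.append_nil] at this
        simp [this, vac]
      · simp [hij]
  rw [entry, wordOp_append, wordOp_append, wordOp_singleton, wordOp_singleton,
    wordOp_whisker_nil, LinearMap.comp_apply, LinearMap.comp_apply, h1, h2]
  refine Finset.sum_congr rfl fun i _ => ?_
  simp only [map_sum, map_smul, Finset.sum_apply, Pi.smul_apply, h3, smul_eq_mul]
  rw [Finset.sum_eq_single i (by intro j _ hj; simp [hj.symm]) (by simp), if_pos rfl,
    ← cup_mul_cap]
  ring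

/-- The first strand of a tangle, closed by an arc on the left, gives the left partial trace. -/
theorem entry_closeLeft {s : List Bool} {c : Bool} {w : List Slice} {x x' : List (Fin 4)} :
    entry ([⟨[], .cup (!c), s⟩] ++ whisker [!c] [] w ++ [⟨[], .cap (!c), s⟩]) x x' =
      ∑ i, weight (!c) i * entry w (i :: x) (i :: x') := by
  have h1 : sliceOp ⟨[], .cup (!c), s⟩ (pre x' vac) =
      ∑ i, (cupCoef (!c) i).eval • pre (i :: i :: x') vac :=
    genOp_cup_eq_sum (!c) (pre x' vac)
  have h2 : ∀ u : Tensor, sliceOp ⟨[], .cap (!c), s⟩ u x =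
      ∑ i, (capCoef (!c) i).eval * u (i :: i :: x) := fun _ => rfl
  rw [entry, wordOp_append, wordOp_append, wordOp_singleton, wordOp_singleton,
    LinearMap.comp_apply, LinearMap.comp_apply, h1, h2]
  refine Finset.sum_congr rfl fun i _ => ?_
  have h3 : ∀ j : Fin 4, wordOp (whisker [!c] [] w) (pre (j :: j :: x') vac) (i :: i :: x) =
      if i = j then entry w (i :: x) (i :: x') else 0 := by
    intro j
    have h := wordOp_whisker_apply (l := [!c]) (r := []) (w := w) (k := x'.length + 1)
      (u := pre (j :: j :: x') vac)
      (by have := hasOrder_pre_vac (j :: j :: x'); convert this using 1; simp; ring)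
    rw [h]
    show wordOp w (fun y => pre (j :: j :: x') vac (i :: y)) (i :: x) = _
    have e : (fun y => pre (j :: j :: x') vac (i :: y)) =
        if i = j then pre (j :: x') vac else 0 := by
      funext y
      rw [pre_cons, consL_cons]
      split_ifs <;> rfl
    rw [e]
    split_ifs with hij
    · subst hij
      rfl
    · simp
  simp only [map_sum, map_smul, Finset.sum_apply, Pi.smul_apply, h3, smul_eq_mul]
  rw [Finset.sum_eq_single i (by intro j _ hj; simp [hj.symm]) (by simp), if_pos rfl,
    ← cup_mul_cap]
  ring

/-- The values of a cut diagram are the matrix entries of a tangle. -/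
theorem exists_entry_eq_cutVal (w₁ w₂ : List Slice) (l m r : List Bool)
    (h₁ : IsTangle [] w₁ (l ++ m ++ r)) (h₂ : IsTangle (l ++ m ++ r) w₂ []) :
    ∃ w, IsTangle m w m ∧ ∀ x x' : List (Fin 4), x.length = m.length → x'.length = m.length →
      entry w x x' = cutVal w₁ w₂ l x x' r := by
  induction l using List.reverseRecOn generalizing m with
  | nil =>
    induction r generalizing m with
    | nil =>
      rw [List.nil_append, List.append_nil] at h₁ h₂
      refine ⟨w₂ ++ w₁, h₂.append h₁, fun x x' hx hx' => ?_⟩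
      have o1 : HasOrder m.length (wordOp w₁ vac) :=
        HasOrder.wordOp (k := 0) h₁ (by simpa using hasOrder_vac)
      have o2 : HasOrder 0 (wordOp w₂ (pre x' vac)) :=
        HasOrder.wordOp (k := 0) h₂ (by simpa [hx'] using hasOrder_pre_vac x')
      have o3 : HasOrder 0 (dropL x (wordOp w₁ vac)) := fun y hy =>
        o1 _ (by simp [hx]; rintro rfl; exact hy rfl)
      rw [entry, wordOp_append, LinearMap.comp_apply, o2.eq_smul_vac, map_smul]
      show _ = wordOp w₂ (pre x' (dropL x (wordOp w₁ vac))) []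
      rw [o3.eq_smul_vac, map_smul, map_smul]
      simp [dropL, mul_comm]
    | cons c r ih =>
      obtain ⟨w, hw, h⟩ := ih (m ++ [c]) (by simpa using h₁) (by simpa using h₂)
      refine ⟨[⟨m, .cup c, []⟩] ++ whisker [] [!c] w ++ [⟨m, .cap c, []⟩],
        IsTangle.append (IsTangle.append (t := m ++ [c] ++ [!c]) ?_ (hw.whisker [] [!c])) ?_, ?_⟩
      · simp [IsTangle, Slice.source, Slice.target, Gen.dom, Gen.cod]
      · simp [IsTangle, Slice.source, Slice.target, Gen.dom, Gen.cod]
      · intro x x' hx hx'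
        rw [entry_closeRight hw hx hx', cutVal_right]
        exact Finset.sum_congr rfl fun i _ => by rw [h _ _ (by simp [hx]) (by simp [hx'])]
  | append_singleton l c ih =>
    obtain ⟨w, hw, h⟩ := ih ([c] ++ m) (by simpa using h₁) (by simpa using h₂)
    refine ⟨[⟨[], .cup (!c), m⟩] ++ whisker [!c] [] w ++ [⟨[], .cap (!c), m⟩],
      IsTangle.append (IsTangle.append (t := [!c] ++ ([c] ++ m) ++ []) ?_ (hw.whisker [!c] [])) ?_,
      ?_⟩
    · simp [IsTangle, Slice.source, Slice.target, Gen.dom, Gen.cod]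
    · simp [IsTangle, Slice.source, Slice.target, Gen.dom, Gen.cod]
    · intro x x' hx hx'
      rw [entry_closeLeft, cutVal_left]
      exact Finset.sum_congr rfl fun i _ => by rw [h _ _ (by simp [hx]) (by simp [hx'])]

/-! ### Tangles with few end points -/

/-- Every tensor of order `n` is the sum of its coordinates times basis tensors. -/
theorem eq_sum_words {n : ℕ} {u : Tensor} (hu : HasOrder n u) :
    u = ((words n).map fun m => u m • pre m vac).sum := by
  induction n generalizing u with
  | zero =>
    rw [hu.eq_smul_vac]
    simp [words, vac]
  | succ n ih =>
    have hs := sum_consL hu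
    have h : ∀ i, consL i (fun y => u (i :: y)) =
        (((words n).map (i :: ·)).map fun m => u m • pre m vac).sum := by
      intro i
      conv_lhs => rw [ih (hu.tail i)]
      rw [map_list_sum, List.map_map, List.map_map]
      congr 1
      refine List.map_congr_left fun m _ => ?_
      simp
    simp only [words, List.flatMap_cons, List.flatMap_nil, List.sum_append,
      List.append_nil, List.map_append]
    rw [← h 0, ← h 1, ← h 2, ← h 3]
    conv_lhs => rw [hs]
    rw [Fin.sum_univ_four]
    abel

/-- A tangle `w` with `n` end points below and above commutes with the strand `sw` that passes over or
under it.  This is the side where `w` acts last: the coefficient at the word `out` of the image of the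
basis tensor `inp`, as a formal combination of the matrix entries of `w`.  The word `x ++ y` stands
for `entry w x y`. -/
def slideThenTangle (sw : List Slice) (n : ℕ) (inp out : List (Fin 4)) : SparseVec :=
  match run sw (unitVec inp) with
  | none => []
  | some t => (t.filter fun e => SparseVec.sameWord (e.1.drop n) (out.drop n)).map
      fun e => (out.take n ++ e.1.take n, e.2)

/-- The side of the same equation where the tangle `w` acts first. -/
def tangleThenSlide (sw : List Slice) (n : ℕ) (inp out : List (Fin 4)) : SparseVec :=
  (words n).flatMap fun m =>
    match run sw (unitVec (inp.take 1 ++ m)) with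
    | none => []
    | some t => (t.filter fun e => SparseVec.sameWord e.1 out).map
        fun e => (m ++ inp.drop 1, e.2)

/-- Whether the diagram `sw` can be computed on all words of length `n`, with images of the same length. -/
def runsOn (sw : List Slice) (n : ℕ) : Bool :=
  (words n).all fun y =>
    match run sw (unitVec y) with
    | none => false
    | some t => t.all fun e => e.1.length == n

/-- The value of a formal word as a matrix entry. -/
noncomputable def entryOf (w : List Slice) (n : ℕ) (x : List (Fin 4)) : 𝕂 :=
  entry w (x.take n) (x.drop n)

theorem sameWord_iff {x y : List (Fin 4)} : SparseVec.sameWord x y = true ↔ x = y := by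
  refine ⟨SparseVec.eq_of_sameWord, ?_⟩
  rintro rfl
  induction x with
  | nil => rfl
  | cons i x ih => simp [SparseVec.sameWord, ih, Nat.beq_refl]

theorem sum_filter_map (f : List (Fin 4) → 𝕂) (g : List (Fin 4) → List (Fin 4))
    (P : List (Fin 4) → Bool) (t : SparseVec) :
    SparseVec.sum f ((t.filter fun e => P e.1).map fun e => (g e.1, e.2)) =
      SparseVec.sum (fun y => if P y then f (g y) else 0) t := by
  induction t with
  | nil => rfl
  | cons e t ih =>
    rw [List.filter_cons]
    split_ifs with h
    · rw [List.map_cons, SparseVec.sum_cons, SparseVec.sum_cons, ih, if_pos h]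
    · rw [SparseVec.sum_cons, ih, if_neg h]
      simp

theorem sum_append (f : List (Fin 4) → 𝕂) (s t : SparseVec) :
    SparseVec.sum f (s ++ t) = SparseVec.sum f s + SparseVec.sum f t := by
  simp [SparseVec.sum]

theorem map_sum_apply (T : Tensor →ₗ[𝕂] Tensor) (x : List (Fin 4)) (t : SparseVec) :
    T (t.eval vac) x = SparseVec.sum (fun y => T (pre y vac) x) t := by
  induction t with
  | nil => simp
  | cons e t ih =>
    rw [SparseVec.eval_cons, map_add, map_smul, SparseVec.sum_cons, Pi.add_apply, ih]
    rfl

theorem pre_vac_apply (y x : List (Fin 4)) : pre y vac x = if x = y then 1 else 0 := by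
  induction y generalizing x with
  | nil => rfl
  | cons i y ih =>
    rcases x with _ | ⟨j, x⟩
    · simp
    · rw [pre_cons, consL_cons, ih]
      by_cases h : j = i <;> simp [h]

/-- A tangle commutes with a strand that slides across it; this is an identity between the
matrix entries of the tangle. -/
theorem slide_entries {s : List Bool} {w sw : List Slice} {o : Bool} (hw : IsTangle s w s)
    (hsw : AgreeOn (1 + s.length) (wordOp sw) (slide true o s))
    (hr : runsOn sw (1 + s.length) = true) {inp out : List (Fin 4)}
    (hi : inp.length = 1 + s.length) (ho : out.length = 1 + s.length) :
    SparseVec.sum (entryOf w s.length) (tangleThenSlide sw s.length inp out) =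
      SparseVec.sum (entryOf w s.length) (slideThenTangle sw s.length inp out) := by
  rcases inp with _ | ⟨p, x⟩
  · simp at hi; omega
  have hx : x.length = s.length := by simp at hi; omega
  have hord : HasOrder (1 + s.length + 0) (pre (p :: x) vac) := by
    have := hasOrder_pre_vac (p :: x)
    rwa [hi] at this
  have nat := congrFun (tangle_natural true o hw 0 _ hord) out
  have hrun : ∀ y : List (Fin 4), y.length = 1 + s.length → ∃ t, run sw (unitVec y) = some t ∧
      wordOp sw (pre y vac) = t.eval vac ∧ ∀ e ∈ t, e.1.length = 1 + s.length := by
    intro y hy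
    have := List.all_eq_true.1 hr y (hy ▸ mem_words)
    split at this
    · simp at this
    · next t ht =>
      refine ⟨t, ht, by rw [← eval_unitVec, wordOp_eval ht], fun e he => ?_⟩
      simpa using List.all_eq_true.1 this e he
  have oW : HasOrder s.length (wordOp w (pre x vac)) :=
    HasOrder.wordOp (k := 0) hw (by simpa [hx] using hasOrder_pre_vac x)
  have hL : SparseVec.sum (entryOf w s.length) (tangleThenSlide sw s.length (p :: x) out) =
      (slide true o s ∘ₗ lift (wordOp w)) (pre (p :: x) vac) out := by
    have key : ∀ L : List (List (Fin 4)), (∀ m ∈ L, m.length = s.length) →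
        SparseVec.sum (entryOf w s.length) (L.flatMap fun m =>
          match run sw (unitVec ([p] ++ m)) with
          | none => []
          | some t => (t.filter fun e => SparseVec.sameWord e.1 out).map fun e => (m ++ x, e.2)) =
        slide true o s (consL p (L.map fun m => wordOp w (pre x vac) m • pre m vac).sum) out := by
      intro L hL
      induction L with
      | nil => simp
      | cons m L ih =>
        have hm : m.length = s.length := hL m (by simp)
        obtain ⟨t, ht, he, -⟩ := hrun ([p] ++ m) (by simp [hm]; ring)
        have hs : slide true o s (pre (p :: m) vac) = t.eval vac := by
          rw [← he, ← hsw 0 _ (by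
            have := hasOrder_pre_vac (p :: m)
            convert this using 1
            simp [hm]; ring)]
          rfl
        rw [List.flatMap_cons, sum_append, ih fun m' h' => hL m' (by simp [h']), ht,
          List.map_cons, List.sum_cons, map_add, map_add, map_smul, map_smul, Pi.add_apply,
          ← pre_cons, hs]
        congr 1
        have h2 := map_sum_apply LinearMap.id out t
        simp only [LinearMap.id_apply] at h2
        rw [Pi.smul_apply, h2]
        have h3 := sum_filter_map (entryOf w s.length) (fun _ => m ++ x)
          (fun y => SparseVec.sameWord y out) t
        simp only at h3 ⊢
        rw [h3]
        have h4 : entryOf w s.length (m ++ x) = wordOp w (pre x vac) m := by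
          simp [entryOf, entry, ← hm]
        rw [h4]
        simp only [pre_vac_apply, sameWord_iff]
        clear h3 h2 ht he hs
        induction t with
        | nil => simp
        | cons e t iht =>
          rw [SparseVec.sum_cons, SparseVec.sum_cons, iht, smul_add]
          congr 1
          by_cases h : e.1 = out
          · simp [h, mul_comm]
          · simp [h, Ne.symm h]
    have hwords : ∀ (n : ℕ), ∀ m ∈ words n, m.length = n := by
      intro n
      induction n with
      | zero => simp [words]
      | succ n ih =>
        intro m hm
        simp only [words, List.mem_flatMap, List.mem_map] at hm
        obtain ⟨i, -, y, hy, rfl⟩ := hm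
        simp [ih y hy]
    rw [LinearMap.comp_apply, pre_cons, lift_consL, eq_sum_words oW, ← key _ (hwords _)]
    rfl
  have hR : SparseVec.sum (entryOf w s.length) (slideThenTangle sw s.length (p :: x) out) =
      (wordOp w ∘ₗ slide true o s) (pre (p :: x) vac) out := by
    obtain ⟨t, ht, he, hlen⟩ := hrun (p :: x) hi
    rw [LinearMap.comp_apply, ← hsw 0 _ hord, he, map_sum_apply, slideThenTangle, ht]
    have h3 := sum_filter_map (entryOf w s.length) (fun y => out.take s.length ++ y.take s.length)
      (fun y => SparseVec.sameWord (y.drop s.length) (out.drop s.length)) t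
    simp only at h3 ⊢
    rw [h3]
    clear h3 ht he
    induction t with
    | nil => rfl
    | cons e t iht =>
      rw [SparseVec.sum_cons, SparseVec.sum_cons, iht fun e' h' => hlen e' (by simp [h'])]
      congr 2
      have hel := hlen e (by simp)
      have ho1 : (out.take s.length).length = s.length := by simp; omega
      have hval := wordOp_append_apply hw (z := pre e.1 vac)
        (z' := if out.drop s.length = e.1.drop s.length then pre (e.1.take s.length) vac else 0)
        (y := out.drop s.length) (fun y hy => ?_) ho1
      · rw [List.take_append_drop] at hval
        rw [hval]
        simp only [sameWord_iff, eq_comm (a := e.1.drop s.length)]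
        split_ifs with h
        · have h5 : (out.take s.length ++ e.1.take s.length).take s.length = out.take s.length := by
            rw [List.take_append_of_le_length (by omega), List.take_take, min_self]
          have h6 : (out.take s.length ++ e.1.take s.length).drop s.length =
              e.1.take s.length := by
            rw [List.drop_append_of_le_length (by omega), List.drop_take]
            simp
          simp only [entryOf, entry, h5, h6]
        · simp
      · conv_lhs => rw [← List.take_append_drop s.length e.1]
        rw [pre_append, pre_apply_append (by simp; omega)]
        have := pre_apply_append (x := e.1.take s.length) (x' := y) (by simp; omega) vac []
        rw [List.append_nil] at this
        by_cases h : out.drop s.length = e.1.drop s.length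
        · rw [if_pos h, this, pre_vac_apply, if_pos h]
          simp [vac]
        · rw [if_neg h, pre_vac_apply, if_neg h]
          simp
  rw [hL, hR]
  exact nat

theorem t₀_ne_one : t₀ ≠ 1 := fun h => by
  have h1 : (MvPolynomial.X 0 : MvPolynomial (Fin 2) ℂ) = 1 :=
    algebraMap_MvPolynomial_injective (h.trans (by simp))
  simpa using congrArg (MvPolynomial.eval fun _ => (0 : ℂ)) h1

theorem t₁_ne_one : t₁ ≠ 1 := fun h => by
  have h1 : (MvPolynomial.X 1 : MvPolynomial (Fin 2) ℂ) = 1 :=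
    algebraMap_MvPolynomial_injective (h.trans (by simp))
  simpa using congrArg (MvPolynomial.eval fun _ => (0 : ℂ)) h1

theorem t₀_ne_t₁ : t₀ ≠ t₁ := fun h => by
  have h1 : (MvPolynomial.X 0 : MvPolynomial (Fin 2) ℂ) = MvPolynomial.X 1 :=
    algebraMap_MvPolynomial_injective h
  simpa using congrArg (MvPolynomial.eval ![(0 : ℂ), 1]) h1

theorem t₀_mul_t₁_ne_one : t₀ * t₁ ≠ 1 := fun h => by
  have h1 : (MvPolynomial.X 0 * MvPolynomial.X 1 : MvPolynomial (Fin 2) ℂ) = 1 :=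
    algebraMap_MvPolynomial_injective ((by simp [t₀, t₁] : _ = t₀ * t₁).trans (h.trans (by simp)))
  simpa using congrArg (MvPolynomial.eval fun _ => (0 : ℂ)) h1

theorem Y_ne_zero : Y ≠ 0 := fun h => by
  have := Y_sq
  rw [h] at this
  have h1 : (t₀ - 1) * (1 - t₁) ≠ 0 :=
    mul_ne_zero (sub_ne_zero.2 t₀_ne_one) (sub_ne_zero.2 t₁_ne_one.symm)
  exact h1 (by rw [← this]; simp)

/-- The formal sum of `1`. -/
def one : Coef := [⟨1, 0, 0, false⟩]
/-- The formal sum of `-1`. -/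
def negOne : Coef := [⟨-1, 0, 0, false⟩]

@[simp] theorem eval_one : one.eval = 1 := by simp [one, Mono.eval]
@[simp] theorem eval_negOne : negOne.eval = -1 := by simp [negOne, Mono.eval]

/-- The difference of the two sides of `slide_entries`: a linear combination of matrix entries which is
zero for every tangle. -/
def slideDiff (sw : List Slice) (n : ℕ) (inp out : List (Fin 4)) : SparseVec :=
  SparseVec.addMul one (tangleThenSlide sw n inp out)
    (SparseVec.addMul negOne (slideThenTangle sw n inp out) [])

/-- The diagram of an upward strand that passes over or under one or two other strands. -/
def slideWord (o : Bool) : List Bool → List Slice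
  | [a] => [⟨[], .crossing true a o, []⟩]
  | [a, b] => [⟨[], .crossing true a o, [b]⟩, ⟨[a], .crossing true b o, []⟩]
  | _ => []

theorem slideWord_agreeOn_one (o a : Bool) :
    AgreeOn (1 + 1) (wordOp (slideWord o [a])) (slide true o [a]) := by
  intro k u hu
  show genOp (.crossing true a o) u = lift LinearMap.id (genOp (.crossing true a o) u)
  rw [lift_id (1 + k)]
  · rfl
  · rw [← add_assoc]
    exact hu.crossing true a o

theorem slideWord_agreeOn_two (o a b : Bool) :
    AgreeOn (1 + 2) (wordOp (slideWord o [a, b])) (slide true o [a, b]) := by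
  intro k u hu
  rw [slide_pair true o a b (k := k) (by convert hu using 1)]
  rfl

theorem slideWord_one_check : ∀ o a : Bool, runsOn (slideWord o [a]) 2 = true := by decide +kernel
theorem slideWord_two_check : ∀ o a b : Bool, runsOn (slideWord o [a, b]) 3 = true := by
  decide +kernel

theorem sum_slideDiff_one {a : Bool} (o : Bool) {w : List Slice} (hw : IsTangle [a] w [a])
    (inp out : List (Fin 4)) (hi : inp.length = 2) (ho : out.length = 2) :
    (slideDiff (slideWord o [a]) 1 inp out).sum (entryOf w 1) = 0 := by
  have := slide_entries hw (slideWord_agreeOn_one o a) (slideWord_one_check o a) hi ho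
  simp only [List.length_cons, List.length_nil, zero_add] at this
  rw [slideDiff, SparseVec.sum_addMul, SparseVec.sum_addMul, this]
  simp

theorem sum_slideDiff_two {a b : Bool} (o : Bool) {w : List Slice}
    (hw : IsTangle [a, b] w [a, b]) (inp out : List (Fin 4)) (hi : inp.length = 3)
    (ho : out.length = 3) :
    (slideDiff (slideWord o [a, b]) 2 inp out).sum (entryOf w 2) = 0 := by
  have := slide_entries hw (slideWord_agreeOn_two o a b) (slideWord_two_check o a b) hi ho
  simp only [List.length_cons, List.length_nil, zero_add, Nat.reduceAdd] at this
  rw [slideDiff, SparseVec.sum_addMul, SparseVec.sum_addMul, this]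
  simp

/-- The combination `c * x - d * y` of two words. -/
def keyDiff (c : Coef) (x : List (Fin 4)) (d : Coef) (y : List (Fin 4)) : SparseVec :=
  SparseVec.addMul c [(x, one)] (SparseVec.addMul d [(y, negOne)] [])

theorem sum_keyDiff (f : List (Fin 4) → 𝕂) (c : Coef) (x : List (Fin 4)) (d : Coef)
    (y : List (Fin 4)) : (keyDiff c x d y).sum f = c.eval * f x - d.eval * f y := by
  simp only [keyDiff, SparseVec.sum_addMul, SparseVec.sum_cons, SparseVec.sum_nil, eval_one,
    eval_negOne, smul_eq_mul]
  ring

/-- The eigenvalues of the operator that a strand in the state `e₂` induces when it passes over an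
upward strand. -/
def charCoef : Fin 4 → Coef
  | 0 => [⟨1, 1, 0, false⟩]
  | 1 => [⟨-1, 0, 0, false⟩]
  | 2 => [⟨-1, 1, 1, false⟩]
  | 3 => [⟨1, 0, 1, false⟩]

/-- The off-diagonal entries of a tangle with one upward strand, multiplied by a difference of
eigenvalues, vanish. -/
theorem charCoef_check : ∀ x x' : Fin 4,
    SparseVec.same (slideDiff (slideWord true [true]) 1 [1, x] [x', 1])
      (keyDiff (charCoef x') [x', x] (charCoef x) [x', x]) = true := by
  decide +kernel

theorem charCoef_injective {x y : Fin 4} (h : (charCoef x).eval = (charCoef y).eval) : x = y := by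
  have h0 := s₀_ne_zero
  have h1 := s₁_ne_zero
  have a1 : s₀ ≠ -1 := fun h => t₀_ne_one (by rw [← s₀_sq, h]; ring)
  have a2 : s₁ ≠ -1 := fun h => t₁_ne_one (by rw [← s₁_sq, h]; ring)
  have a3 : s₀ ≠ s₁ := fun h => t₀_ne_t₁ (by rw [← s₀_sq, h, s₁_sq])
  have a4 : s₀ * s₁ ≠ 1 := fun h => t₀_mul_t₁_ne_one (by
    rw [← s₀_sq, ← s₁_sq, ← mul_pow, h, one_pow])
  have e0 : (charCoef 0).eval = s₀ := by simp [charCoef, Mono.eval]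
  have e1 : (charCoef 1).eval = -1 := by simp [charCoef, Mono.eval]
  have e2 : (charCoef 2).eval = -(s₀ * s₁) := by simp [charCoef, Mono.eval]
  have e3 : (charCoef 3).eval = s₁ := by simp [charCoef, Mono.eval]
  have b1 : s₀ ≠ -(s₀ * s₁) := fun h => a2 (mul_left_cancel₀ h0 (by linear_combination h))
  have b2 : -1 ≠ -(s₀ * s₁) := fun h => a4 (by linear_combination h)
  have b3 : -(s₀ * s₁) ≠ s₁ := fun h => a1 (mul_left_cancel₀ h1 (by linear_combination -h))
  fin_cases x <;> fin_cases y <;>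
    simp only [Fin.zero_eta, Fin.mk_one, Fin.reduceFinMk, e0, e1, e2, e3] at h ⊢ <;>
    first
      | exact absurd h a1 | exact absurd h.symm a1 | exact absurd h a2 | exact absurd h.symm a2
      | exact absurd h a3 | exact absurd h.symm a3 | exact absurd h b1 | exact absurd h.symm b1
      | exact absurd h b2 | exact absurd h.symm b2 | exact absurd h b3 | exact absurd h.symm b3

/-- The formal sum of `t₀ - 1`. -/
def tSubOne₀ : Coef := [⟨1, 2, 0, false⟩, ⟨-1, 0, 0, false⟩]
/-- The formal sum of `t₁ - 1`. -/
def tSubOne₁ : Coef := [⟨1, 0, 2, false⟩, ⟨-1, 0, 0, false⟩]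

theorem eval_tSubOne₀ : tSubOne₀.eval = t₀ - 1 := by
  have h2 : s₀ ^ (2 : ℤ) = s₀ ^ 2 := zpow_ofNat _ _
  simp [tSubOne₀, Mono.eval, h2, s₀_sq, sub_eq_add_neg]

theorem eval_tSubOne₁ : tSubOne₁.eval = t₁ - 1 := by
  have h2 : s₁ ^ (2 : ℤ) = s₁ ^ 2 := zpow_ofNat _ _
  simp [tSubOne₁, Mono.eval, h2, s₁_sq, sub_eq_add_neg]

/-- The diagonal entries of a tangle with one upward strand agree, up to nonzero factors. -/
theorem diagonal_check :
    SparseVec.same (slideDiff (slideWord true [true]) 1 [1, 0] [1, 0])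
      (keyDiff tSubOne₀ [0, 0] tSubOne₀ [1, 1]) = true ∧
    SparseVec.same (slideDiff (slideWord true [true]) 1 [2, 0] [2, 0])
      (keyDiff tSubOne₀ [0, 0] tSubOne₀ [2, 2]) = true ∧
    SparseVec.same (slideDiff (slideWord true [true]) 1 [1, 2] [3, 0])
      (keyDiff [⟨-1, 1, 1, true⟩] [2, 2] [⟨-1, 1, 1, true⟩] [3, 3]) = true := by
  decide +kernel

/-- A tangle with one upward strand acts by a scalar.  The sliding of a strand in the state `e₂` across it
yields that the matrix commutes with a diagonal matrix with distinct entries (`charCoef`), and further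
states of that strand yield that the diagonal entries agree. -/
theorem entry_upward {w : List Slice} (hw : IsTangle [true] w [true]) (x x' : Fin 4) :
    entry w [x] [x'] = if x = x' then entry w [1] [1] else 0 := by
  have hf : ∀ x x' : Fin 4, entryOf w 1 [x, x'] = entry w [x] [x'] := fun _ _ => rfl
  split_ifs with h
  · subst h
    obtain ⟨h1, h2, h3⟩ := diagonal_check
    have k1 := sum_slideDiff_one true hw [1, 0] [1, 0] rfl rfl
    have k2 := sum_slideDiff_one true hw [2, 0] [2, 0] rfl rfl
    have k3 := sum_slideDiff_one true hw [1, 2] [3, 0] rfl rfl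
    rw [SparseVec.sum_eq_of_same _ h1, sum_keyDiff, hf, hf, ← mul_sub, eval_tSubOne₀] at k1
    rw [SparseVec.sum_eq_of_same _ h2, sum_keyDiff, hf, hf, ← mul_sub, eval_tSubOne₀] at k2
    rw [SparseVec.sum_eq_of_same _ h3, sum_keyDiff, hf, hf, ← mul_sub] at k3
    have c3 : Coef.eval [⟨-1, 1, 1, true⟩] ≠ 0 := by
      simp [Mono.eval, s₀_ne_zero, s₁_ne_zero, Y_ne_zero]
    have m1 := sub_eq_zero.1 ((mul_eq_zero.1 k1).resolve_left (sub_ne_zero.2 t₀_ne_one))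
    have m2 := sub_eq_zero.1 ((mul_eq_zero.1 k2).resolve_left (sub_ne_zero.2 t₀_ne_one))
    have m3 := sub_eq_zero.1 ((mul_eq_zero.1 k3).resolve_left c3)
    fin_cases x
    · exact m1
    · rfl
    · exact m2.symm.trans m1
    · exact m3.symm.trans (m2.symm.trans m1)
  · have k := sum_slideDiff_one true hw [1, x'] [x, 1] rfl rfl
    rw [SparseVec.sum_eq_of_same _ (charCoef_check x' x), sum_keyDiff, hf, ← sub_mul] at k
    exact (mul_eq_zero.1 k).resolve_left (sub_ne_zero.2 fun e => h (charCoef_injective e))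

/-- Multipliers for the equations `slideDiff`; the sum of the multiples is `traceDiff`, so that the two
partial traces of an endomorphism of two strands agree.  An entry `(c, o, inp, out)` is the multiplier
`c`, the choice whether the sliding strand passes over or under, and the input and output words of the
equation. -/
def traceCertificate : Bool → Bool → List (Coef × Bool × List (Fin 4) × List (Fin 4))
  | true, true => [
    (Coef.mul tSubOne₁ [⟨-1, -3, -1, false⟩], true, [2, 1, 0], [1, 2, 0]),
    (Coef.mul tSubOne₀ [⟨1, 0, 1, false⟩], false, [1, 3, 1], [1, 1, 3]),
    (Coef.mul tSubOne₁ [⟨1, 1, -2, false⟩], true, [3, 2, 1], [1, 3, 2]),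
    ([⟨-1, 3, 2, true⟩], false, [1, 2, 1], [0, 1, 3]),
    (Coef.mul tSubOne₁ [⟨-1, 1, 2, false⟩], false, [2, 3, 1], [1, 2, 3]),
    (Coef.mul tSubOne₀ [⟨-1, 0, 1, false⟩], true, [3, 1, 1], [1, 3, 1])]
  | true, false => [
    (Coef.mul tSubOne₀ [⟨-1, 0, -2, false⟩], false, [1, 1, 1], [1, 3, 3]),
    ([⟨-1, 1, -2, true⟩], true, [2, 1, 1], [3, 1, 0]),
    ([⟨-1, 2, 0, true⟩], false, [1, 1, 0], [1, 2, 3]),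
    (Coef.mul tSubOne₁ [⟨-1, 3, 0, false⟩], false, [0, 1, 0], [2, 2, 1]),
    (Coef.mul tSubOne₁ [⟨-1, 1, -2, false⟩], true, [1, 0, 1], [2, 2, 0]),
    (Coef.mul tSubOne₁ [⟨-1, 3, 0, false⟩], true, [2, 0, 1], [2, 1, 0])]
  | false, true => [
    (Coef.mul tSubOne₁ [⟨-1, -1, 1, false⟩], true, [2, 1, 0], [1, 2, 0]),
    ([⟨-1, -2, 1, true⟩], false, [1, 0, 1], [2, 1, 3]),
    (Coef.mul tSubOne₁ [⟨1, -2, -1, false⟩], true, [3, 0, 0], [2, 3, 2]),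
    (Coef.mul tSubOne₁ [⟨1, 0, 1, false⟩], false, [2, 0, 0], [3, 2, 3]),
    (Coef.mul tSubOne₀ [⟨-1, 0, 4, false⟩], true, [3, 3, 1], [3, 3, 1]),
    ([⟨1, 0, 3, true⟩], false, [0, 1, 3], [3, 3, 2])]
  | false, false => [
    ([⟨-1, -1, 1, true⟩], true, [3, 2, 1], [0, 1, 1]),
    (Coef.mul tSubOne₀ [⟨-1, 0, -2, false⟩], false, [1, 1, 1], [1, 3, 3]),
    (Coef.mul tSubOne₀ [⟨1, 0, 4, false⟩], true, [3, 3, 1], [1, 1, 1]),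
    (Coef.mul tSubOne₁ [⟨-1, 0, -1, false⟩], true, [1, 3, 1], [0, 3, 0]),
    (Coef.mul tSubOne₁ [⟨1, 2, 1, false⟩], false, [0, 3, 0], [1, 3, 1]),
    ([⟨-1, 2, 0, true⟩], false, [1, 1, 0], [1, 2, 3])]

/-- The combination of the equations `slideDiff` with the multipliers of the certificate. -/
def certificateSum (a b : Bool) : SparseVec :=
  (traceCertificate a b).foldr
    (fun e acc => SparseVec.addMul e.1 (slideDiff (slideWord e.2.1 [a, b]) 2 e.2.2.1 e.2.2.2) acc) []

/-- The difference of the right and the left partial trace, in the state `e₂` of the open strand, times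
`(t₀ - 1) (t₁ - 1)`. -/
def traceDiff (a b : Bool) : SparseVec :=
  SparseVec.addMul (Coef.mul tSubOne₀ tSubOne₁)
    (([0, 1, 2, 3].map fun i => ([1, i, 1, i], weightCoef b i)) ++
      ([0, 1, 2, 3].map fun i => ([i, 1, i, 1], Coef.mul negOne (weightCoef (!a) i)))) []

theorem traceCertificate_check : ∀ a b : Bool,
    SparseVec.same (certificateSum a b) (traceDiff a b) = true ∧
      ((traceCertificate a b).all fun e => e.2.2.1.length == 3 && e.2.2.2.length == 3) = true := by
  decide +kernel

/-- The right and the left partial trace of an endomorphism of two strands agree. -/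
theorem partialTrace_eq {a b : Bool} {w : List Slice} (hw : IsTangle [a, b] w [a, b]) :
    ∑ i, weight b i * entry w [1, i] [1, i] = ∑ i, weight (!a) i * entry w [i, 1] [i, 1] := by
  obtain ⟨h1, h2⟩ := traceCertificate_check a b
  have h3 : (certificateSum a b).sum (entryOf w 2) = 0 := by
    rw [certificateSum]
    generalize traceCertificate a b = L at h2
    induction L with
    | nil => rfl
    | cons e L ih =>
      rw [List.all_cons, Bool.and_eq_true, Bool.and_eq_true, beq_iff_eq, beq_iff_eq] at h2
      rw [List.foldr_cons, SparseVec.sum_addMul, ih h2.2,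
        sum_slideDiff_two e.2.1 hw _ _ h2.1.1 h2.1.2]
      simp
  rw [SparseVec.sum_eq_of_same _ h1, traceDiff, SparseVec.sum_addMul, Coef.eval_mul, eval_tSubOne₀,
    eval_tSubOne₁] at h3
  have hD : (t₀ - 1) * (t₁ - 1) ≠ 0 :=
    mul_ne_zero (sub_ne_zero.2 t₀_ne_one) (sub_ne_zero.2 t₁_ne_one)
  simp only [sum_append, List.map_cons, List.map_nil, SparseVec.sum_cons, SparseVec.sum_nil,
    Coef.eval_mul, eval_weightCoef, eval_negOne, smul_eq_mul, add_zero] at h3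
  have h4 := (mul_eq_zero.1 h3).resolve_left hD
  have hf : ∀ x y x' y' : Fin 4, entryOf w 2 [x, y, x', y'] = entry w [x, y] [x', y'] :=
    fun _ _ _ _ => rfl
  simp only [hf] at h4
  rw [Fin.sum_univ_four, Fin.sum_univ_four]
  linear_combination h4

/-! ### Independence of the cut -/

theorem HasOrder.weigh (s : List Bool) {T : Tensor →ₗ[𝕂] Tensor} {m n : ℕ}
    (hT : ∀ u, HasOrder m u → HasOrder n (T u)) {u : Tensor} (hu : HasOrder (m + s.length) u) :
    HasOrder (n + s.length) (weigh s T u) := by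
  induction s generalizing u with
  | nil => exact hT u hu
  | cons a s ih =>
    rintro (_ | ⟨i, x⟩) hx
    · rfl
    · show weight a i * _ = 0
      rw [ih (hu.tail i) x (by simp only [List.length_cons] at hx; omega), mul_zero]

theorem HasOrder.cutOp (l r : List Bool) {x x' : List (Fin 4)} (hx : x'.length = x.length)
    {n : ℕ} (hn : n = l.length + x.length + r.length) {u : Tensor} (hu : HasOrder n u) :
    HasOrder n (cutOp l x x' r u) := by
  have h := HasOrder.weigh (l.map not) (T := pre x' ∘ₗ LinksGould.weigh r LinearMap.id ∘ₗ dropL x)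
    (m := r.length + x.length) (n := r.length + x.length) (fun v hv => ?_) (u := u)
    (by convert hu using 1; rw [hn, List.length_map]; ring)
  · have hl : n = r.length + x.length + (l.map not).length := by
      rw [hn, List.length_map]
      ring
    rw [hl]
    exact h
  · have h1 : HasOrder (0 + r.length) (dropL x v) := fun y hy =>
      hv _ (by rw [List.length_append]; omega)
    have h2 := HasOrder.weigh r (T := LinearMap.id) (m := 0) (n := 0) (fun _ h => h) h1
    have h3 := hasOrder_pre x' h2
    rwa [zero_add, hx] at h3

/-- The cut moves from a strand to its right neighbour: this is `partialTrace_eq` for the tangle with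
these two strands that arises from the rest of the diagram. -/
theorem cutVal_succ {w₁ w₂ : List Slice} {l r : List Bool} {a b : Bool}
    (h₁ : IsTangle [] w₁ (l ++ [a, b] ++ r)) (h₂ : IsTangle (l ++ [a, b] ++ r) w₂ []) :
    cutVal w₁ w₂ l [1] [1] (b :: r) = cutVal w₁ w₂ (l ++ [a]) [1] [1] r := by
  obtain ⟨w, hw, h⟩ := exists_entry_eq_cutVal w₁ w₂ l [a, b] r h₁ h₂
  have h3 : ∀ i j k m : Fin 4, entry w [i, j] [k, m] = cutVal w₁ w₂ l [i, j] [k, m] r :=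
    fun i j k m => h _ _ rfl rfl
  have h4 := partialTrace_eq hw
  simp only [h3] at h4
  rw [cutVal_right, cutVal_left]
  exact h4

/-- The value of a closed diagram that is cut open at the leftmost strand of a level `s`. -/
noncomputable def cutLevel (w₁ w₂ : List Slice) (s : List Bool) : 𝕂 :=
  cutVal w₁ w₂ [] [1] [1] s.tail

/-- All strands of a level give the same value. -/
theorem cutVal_eq_cutLevel {w₁ w₂ : List Slice} {s : List Bool} (h₁ : IsTangle [] w₁ s)
    (h₂ : IsTangle s w₂ []) (l r : List Bool) (a : Bool) (hs : s = l ++ a :: r) :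
    cutVal w₁ w₂ l [1] [1] r = cutLevel w₁ w₂ s := by
  induction l using List.reverseRecOn generalizing a r with
  | nil => rw [cutLevel, hs]; rfl
  | append_singleton l c ih =>
    have hs' : s = l ++ [c, a] ++ r := by simp [hs]
    rw [← ih (a :: r) c (by simp [hs]), cutVal_succ (hs' ▸ h₁) (hs' ▸ h₂)]

/-- A cut moves past a slice whose piece lies on its left. -/
theorem cutVal_slice_left (w₁ w₂ : List Slice) (g : Gen) (l₁ l₂ r r' : List Bool)
    (x x' : List (Fin 4)) :
    cutVal w₁ (⟨l₁, g, r'⟩ :: w₂) (l₁ ++ g.dom ++ l₂) x x' r =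
      cutVal (w₁ ++ [⟨l₁, g, r'⟩]) w₂ (l₁ ++ g.cod ++ l₂) x x' r := by
  have h := LinearMap.congr_fun (cutOp_comp_left g l₁ l₂ r x x') (wordOp w₁ vac)
  simp only [LinearMap.comp_apply] at h
  rw [cutVal, cutVal, wordOp_append, wordOp, LinearMap.comp_apply, LinearMap.comp_apply,
    wordOp_singleton]
  exact congrFun (congrArg (wordOp w₂) h.symm) []

/-- A cut moves past a slice whose piece lies on its right. -/
theorem cutVal_slice_right (w₁ w₂ : List Slice) (g : Gen) (l r₁ r₂ : List Bool) (a : Bool)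
    (i i' : Fin 4) :
    cutVal w₁ (⟨l ++ a :: r₁, g, r₂⟩ :: w₂) l [i] [i'] (r₁ ++ g.dom ++ r₂) =
      cutVal (w₁ ++ [⟨l ++ a :: r₁, g, r₂⟩]) w₂ l [i] [i'] (r₁ ++ g.cod ++ r₂) := by
  have h := LinearMap.congr_fun (cutOp_comp_right g l r₁ r₂ (x := [i]) (x' := [i']) rfl)
    (wordOp w₁ vac)
  have hl : (l ++ a :: r₁).length = l.length + [i].length + r₁.length := by simp; ring
  rw [← hl] at h
  simp only [LinearMap.comp_apply] at h
  rw [cutVal, cutVal, wordOp_append, wordOp, LinearMap.comp_apply, LinearMap.comp_apply,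
    wordOp_singleton]
  exact congrFun (congrArg (wordOp w₂) h.symm) []

theorem HasOrder.wordOp_vac {w : List Slice} {s : List Bool} (hw : IsTangle [] w s) :
    HasOrder s.length (LinksGould.wordOp w vac) :=
  HasOrder.wordOp (k := 0) hw (by simpa using hasOrder_vac)

theorem sliceOp_comp_lift (x : Slice) (T : Tensor →ₗ[𝕂] Tensor) :
    sliceOp x ∘ₗ lift^[x.source.length] T = lift^[x.target.length] T ∘ₗ sliceOp x := by
  have h := genOp_lift x.gen (lift^[x.right.length] T)
  have h2 := congrArg (lift^[x.left.length]) h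
  rw [lift_iterate_comp, lift_iterate_comp] at h2
  simpa only [← Function.iterate_add_apply, Slice.source, Slice.target, List.length_append,
    add_assoc, sliceOp] using h2

/-- The last strand above a slice may go up, down and up again along the right side of the slice: a
minimum below the slice and a maximum above it cancel. -/
theorem wordOp_insert_zigzag {x : Slice} {t : List Bool} {a : Bool} (ht : x.target = t ++ [a])
    {u : Tensor} (hu : HasOrder x.source.length u) :
    wordOp [⟨x.source, .cup (!a), []⟩, ⟨x.left, x.gen, x.right ++ [!a, a]⟩, ⟨t, .cap a, [a]⟩] u =
      sliceOp x u := by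
  have h1 := LinearMap.congr_fun (sliceOp_comp_lift x (genOp (.cup (!a)))) u
  have ho : HasOrder (x.target.length + 0) (sliceOp x u) := hu.sliceOp (k := 0)
  have h2 := (agreeOn_of_sameOn (zigzagRight_check a)).lift_iterate t.length 0 (sliceOp x u)
    (by convert ho using 1; rw [ht]; simp; ring)
  have h3 := lift_iterate_id t.length 1 (sliceOp x u) (by convert ho using 1; rw [ht]; simp)
  simp only [wordOp, lift_iterate_comp, LinearMap.comp_apply, ht, List.length_append,
    List.length_cons, List.length_nil, sliceOp, Function.iterate_zero, id_eq, zero_add,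
    LinearMap.id_apply] at h1 h2 h3 ⊢
  rw [h3] at h2
  rw [h1, Function.iterate_add_apply]
  refine Eq.trans (lift_iterate_id t.length 1 _ ?_).symm h2
  have hc : HasOrder (1 + 2 + t.length) ((lift^[t.length] (lift^[1] (genOp (.cup (!a)))))
      ((lift^[x.left.length] (genOp x.gen)) u)) := by
    have := HasOrder.sliceOp (x := ⟨t ++ [a], .cup (!a), []⟩) (k := 0)
      (u := sliceOp x u) (by
        convert ho using 1
        simp [Slice.source, Gen.dom, ht])
    simp only [Slice.target, Gen.cod, sliceOp, List.length_append, List.length_cons,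
      List.length_nil, Function.iterate_add_apply] at this
    convert this using 1
    · omega
    · rfl
  have := HasOrder.lift_iterate (T := genOp (.cap a)) (m := 3) (n := 1)
    (fun v hv => HasOrder.genOp (g := .cap a) (k := 1) hv) t.length hc
  convert this using 1
  · omega
  · rfl

theorem cutVal_congr {w₁ w₁' w₂ w₂' : List Slice} {l r : List Bool} {a : Bool} {i i' : Fin 4}
    (h₁ : wordOp w₁ vac = wordOp w₁' vac) (hw : IsTangle [] w₁ (l ++ a :: r))
    (h₂ : ∀ u, HasOrder (l ++ a :: r).length u → wordOp w₂ u = wordOp w₂' u) :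
    cutVal w₁ w₂ l [i] [i'] r = cutVal w₁' w₂' l [i] [i'] r := by
  rw [cutVal, cutVal, ← h₁, h₂]
  exact HasOrder.cutOp l r (x := [i]) (x' := [i']) rfl (by simp; ring) (HasOrder.wordOp_vac hw)

/-- The levels below and above a slice give the same value.  A cut can only move past a slice if some
strand runs vertically beside the piece; a zigzag on the right of the slice provides such a strand. -/
theorem cutLevel_slice {w₁ w₂ : List Slice} {x : Slice} (h₁ : IsTangle [] w₁ x.source)
    (h₂ : IsTangle x.target w₂ []) (hs : x.source ≠ []) (ht : x.target ≠ []) :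
    cutLevel w₁ (x :: w₂) x.source = cutLevel (w₁ ++ [x]) w₂ x.target := by
  obtain ⟨t, a, hta⟩ : ∃ t a, x.target = t ++ [a] :=
    ⟨_, _, (List.dropLast_append_getLast ht).symm⟩
  obtain ⟨c, s, hcs⟩ := List.exists_cons_of_ne_nil hs
  set c₁ : Slice := ⟨x.source, .cup (!a), []⟩ with hc₁
  set x₁ : Slice := ⟨x.left, x.gen, x.right ++ [!a, a]⟩ with hx₁
  set c₂ : Slice := ⟨t, .cap a, [a]⟩ with hc₂
  have e₁ : c₁.source = x.source := by simp [hc₁, Slice.source, Gen.dom]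
  have e₂ : c₁.target = x.source ++ [!a, a] := by simp [hc₁, Slice.target, Gen.cod]
  have e₃ : x₁.source = x.source ++ [!a, a] := by simp [hx₁, Slice.source]
  have e₄ : x₁.target = x.target ++ [!a, a] := by simp [hx₁, Slice.target]
  have e₅ : c₂.source = x.target ++ [!a, a] := by simp [hc₂, Slice.source, Gen.dom, hta]
  have e₆ : c₂.target = x.target := by
    rw [hta]
    simp [hc₂, Slice.target, Gen.cod]
  have t₃ : IsTangle [] (w₁ ++ [c₁]) (x.source ++ [!a, a]) := h₁.append ⟨e₁, e₂⟩
  have t₄ : IsTangle [] (w₁ ++ [c₁] ++ [x₁]) (x.target ++ [!a, a]) := t₃.append ⟨e₃, e₄⟩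
  have b₄ : IsTangle (x.target ++ [!a, a]) (c₂ :: w₂) [] := ⟨e₅, by rw [e₆]; exact h₂⟩
  have b₃ : IsTangle (x.source ++ [!a, a]) (x₁ :: c₂ :: w₂) [] := ⟨e₃, by rw [e₄]; exact b₄⟩
  have hz : ∀ u, HasOrder x.source.length u → wordOp [c₁, x₁, c₂] u = sliceOp x u :=
    fun u hu => wordOp_insert_zigzag hta hu
  -- Insert the zigzag above the cut, and move the cut past the minimum on its right.
  have s₁ : cutLevel w₁ (x :: w₂) x.source = cutVal w₁ (c₁ :: x₁ :: c₂ :: w₂) [] [1] [1] s := by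
    rw [cutLevel, hcs]
    refine cutVal_congr (a := c) rfl (hcs ▸ h₁) fun u hu => ?_
    have := hz u (by rw [hcs]; exact hu)
    show wordOp w₂ (sliceOp x u) = wordOp w₂ (wordOp [c₁, x₁, c₂] u)
    rw [this]
  have s₂ : cutVal w₁ (c₁ :: x₁ :: c₂ :: w₂) [] [1] [1] s =
      cutVal (w₁ ++ [c₁]) (x₁ :: c₂ :: w₂) [] [1] [1] (s ++ [!a, a]) := by
    have := cutVal_slice_right w₁ (x₁ :: c₂ :: w₂) (.cup (!a)) [] s [] c 1 1
    simp only [List.nil_append, ← hcs, Gen.dom, Gen.cod, List.append_nil, Bool.not_not] at this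
    exact this
  -- At the enlarged level, move the cut to the last strand, which belongs to the zigzag.
  have s₃ : cutVal (w₁ ++ [c₁]) (x₁ :: c₂ :: w₂) [] [1] [1] (s ++ [!a, a]) =
      cutVal (w₁ ++ [c₁]) (x₁ :: c₂ :: w₂) (x.source ++ [!a]) [1] [1] [] := by
    rw [cutVal_eq_cutLevel t₃ b₃ (x.source ++ [!a]) [] a (by simp),
      cutVal_eq_cutLevel t₃ b₃ [] (s ++ [!a, a]) c (by simp [hcs])]
  -- On this strand the cut passes the piece of the slice and the maximum of the zigzag.
  have s₄ := cutVal_slice_left (w₁ ++ [c₁]) (c₂ :: w₂) x.gen x.left (x.right ++ [!a]) []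
    (x.right ++ [!a, a]) [1] [1]
  have s₅ := cutVal_slice_left (w₁ ++ [c₁] ++ [x₁]) w₂ (.cap a) t [] [] [a] [1] [1]
  have s₆ : cutVal (w₁ ++ [c₁] ++ [x₁] ++ [c₂]) w₂ t [1] [1] [] =
      cutVal (w₁ ++ [x]) w₂ t [1] [1] [] := by
    refine cutVal_congr (a := a) ?_ ?_ fun _ _ => rfl
    · have e : w₁ ++ [c₁] ++ [x₁] ++ [c₂] = w₁ ++ [c₁, x₁, c₂] := by simp
      rw [e, wordOp_append, wordOp_append, LinearMap.comp_apply, LinearMap.comp_apply,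
        hz _ (HasOrder.wordOp_vac h₁)]
      rfl
    · rw [← hta]
      exact t₄.append ⟨e₅, e₆⟩
  have f₁ : x.left ++ x.gen.dom ++ (x.right ++ [!a]) = x.source ++ [!a] := by simp [Slice.source]
  have f₂ : x.left ++ x.gen.cod ++ (x.right ++ [!a]) = t ++ [a] ++ [!a] := by
    rw [← hta]
    simp [Slice.target]
  rw [f₁, f₂] at s₄
  simp only [Gen.dom, Gen.cod, List.append_nil] at s₅
  have f₃ : t ++ [a] ++ [!a] = t ++ [a, !a] := by simp
  rw [s₁, s₂, s₃, s₄, f₃, s₅, s₆]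
  exact cutVal_eq_cutLevel (h₁.append (show IsTangle x.source [x] x.target from ⟨rfl, rfl⟩)) h₂
    t [] a hta

theorem weigh_wordOp (e : Bool) {w : List Slice} {s t : List Bool} (hw : IsTangle s w t) :
    weigh (t.map (· ^^ e)) LinearMap.id ∘ₗ wordOp w =
      wordOp w ∘ₗ weigh (s.map (· ^^ e)) LinearMap.id := by
  induction w generalizing s with
  | nil =>
    obtain rfl : s = t := hw
    rfl
  | cons x w ih =>
    obtain ⟨rfl, hw⟩ := hw
    rw [wordOp, ← LinearMap.comp_assoc, ih hw, LinearMap.comp_assoc, LinearMap.comp_assoc]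
    congr 1
    exact weigh_comp_slice e x.left x.right x.gen LinearMap.id

theorem sum_weight (a : Bool) : ∑ i, weight a i = 0 := by
  rw [Fin.sum_univ_four]
  cases a <;> simp [weight, μ, inv_neg]

/-- The quantum dimension of the representation is zero, and so is the value of every
closed diagram. -/
theorem wordOp_closed {w : List Slice} (hw : IsTangle [] w []) (hne : w ≠ []) :
    wordOp w vac = 0 := by
  obtain ⟨x, v, rfl⟩ := List.exists_cons_of_ne_nil hne
  obtain ⟨hx, hv⟩ := hw
  obtain ⟨l, g, r⟩ := x
  obtain ⟨rfl, hg, rfl⟩ : l = [] ∧ g.dom = [] ∧ r = [] := by simpa [Slice.source] using hx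
  obtain ⟨a, rfl⟩ : ∃ a, g = .cup a := by
    cases g with
    | cup a => exact ⟨a, rfl⟩
    | _ => simp [Gen.dom] at hg
  set x : Slice := ⟨[], .cup a, []⟩ with hxdef
  have ht : x.target = [a, !a] := rfl
  have h₁ : IsTangle [] [x] [a, !a] := ⟨rfl, rfl⟩
  rw [ht] at hv
  have hval : wordOp (x :: v) vac [] = 0 := by
    have hw1 : ∀ e : Bool, weigh ([a, !a].map (· ^^ e)) LinearMap.id (wordOp [x] vac) =
        wordOp [x] vac := fun e => LinearMap.congr_fun (weigh_wordOp e h₁) vac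
    -- The diagram is closed by the upward leg of its first minimum.  Cut open there, it acts by a
    -- scalar, and the closure multiplies the scalar with the sum of the weights, which is zero.
    cases a with
    | true =>
      obtain ⟨w, hw, h⟩ := exists_entry_eq_cutVal [x] v [] [true] [false] h₁ hv
      have hr := cutVal_right [x] v [] [false] [] [] true
      have hl : cutVal [x] v [] [] [] [true, false] = wordOp (x :: v) vac [] := by
        have := hw1 false
        simp only [Bool.not_true, List.map_cons, List.map_nil, Bool.xor_false] at this
        show wordOp v (weigh [true, false] LinearMap.id (wordOp [x] vac)) [] = _
        rw [this]
        rfl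
      rw [← hl, hr]
      simp only [List.nil_append]
      have : ∀ i : Fin 4, cutVal [x] v [] [i] [i] [false] = entry w [1] [1] := fun i => by
        rw [← h [i] [i] rfl rfl, entry_upward hw, if_pos rfl]
      simp only [this]
      rw [← Finset.sum_mul, sum_weight, zero_mul]
    | false =>
      obtain ⟨w, hw, h⟩ := exists_entry_eq_cutVal [x] v [false] [true] [] h₁ hv
      have hr := cutVal_left [x] v [false] [] [] [] true
      have hl : cutVal [x] v ([false] ++ [true]) [] [] [] = wordOp (x :: v) vac [] := by
        have := hw1 true
        simp only [Bool.not_false, List.map_cons, List.map_nil, Bool.xor_true, Bool.not_true] at this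
        show wordOp v (weigh [true, false] LinearMap.id (wordOp [x] vac)) [] = _
        rw [this]
        rfl
      rw [← hl, hr]
      have : ∀ i : Fin 4, cutVal [x] v [false] [i] [i] [] = entry w [1] [1] := fun i => by
        rw [← h [i] [i] rfl rfl, entry_upward hw, if_pos rfl]
      simp only [this]
      rw [← Finset.sum_mul, sum_weight, zero_mul]
  have ho : HasOrder 0 (wordOp (x :: v) vac) := HasOrder.wordOp_vac (s := [])
    (show IsTangle [] (x :: v) [] from ⟨hx, hv⟩)
  rw [ho.eq_smul_vac, hval, zero_smul]

/-- All non-empty levels of a closed diagram give the same value. -/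
theorem cutLevel_word {w₁ v w₂ : List Slice} {s t : List Bool} (h₁ : IsTangle [] w₁ s)
    (hv : IsTangle s v t) (h₂ : IsTangle t w₂ []) (hs : s ≠ []) (ht : t ≠ []) :
    cutLevel w₁ (v ++ w₂) s = cutLevel (w₁ ++ v) w₂ t := by
  induction v generalizing w₁ s with
  | nil =>
    obtain rfl : s = t := hv
    rw [List.append_nil, List.nil_append]
  | cons x v ih =>
    obtain ⟨rfl, hv⟩ := hv
    have h₃ : IsTangle [] (w₁ ++ [x]) x.target :=
      h₁.append (show IsTangle x.source [x] x.target from ⟨rfl, rfl⟩)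
    by_cases hx : x.target = []
    · -- An empty level splits the diagram into two closed parts, and both values vanish.
      rw [hx] at hv h₃
      have hne : v ≠ [] := by
        rintro rfl
        exact ht hv.symm
      have z₁ : wordOp (v ++ w₂) vac = 0 := wordOp_closed (hv.append h₂) (by simp [hne])
      have z₂ : wordOp (w₁ ++ [x]) vac = 0 := wordOp_closed h₃ (by simp)
      obtain ⟨c, s', hcs⟩ := List.exists_cons_of_ne_nil hs
      have o₁ : HasOrder x.source.length (cutOp [] [1] [1] x.source.tail (wordOp w₁ vac)) :=
        HasOrder.cutOp [] _ rfl (by rw [hcs]; simp; ring) (HasOrder.wordOp_vac h₁)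
      have o₂ : HasOrder 0 (sliceOp x (cutOp [] [1] [1] x.source.tail (wordOp w₁ vac))) := by
        have := HasOrder.sliceOp (k := 0) o₁
        rwa [hx] at this
      have l₁ : cutLevel w₁ (x :: v ++ w₂) x.source = 0 := by
        show wordOp (v ++ w₂) (sliceOp x (cutOp [] [1] [1] x.source.tail (wordOp w₁ vac))) [] = 0
        rw [o₂.eq_smul_vac, map_smul, z₁, smul_zero]
        rfl
      have l₂ : cutLevel (w₁ ++ x :: v) w₂ t = 0 := by
        have e : w₁ ++ x :: v = w₁ ++ [x] ++ v := by simp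
        rw [cutLevel, cutVal, e, wordOp_append, LinearMap.comp_apply, z₂]
        simp
      rw [l₁, l₂]
    · rw [List.cons_append, cutLevel_slice h₁ (hv.append h₂) hs hx, ih h₃ hv hx]
      simp

theorem IsTangle.target_unique {s t t' : List Bool} {w : List Slice} (h : IsTangle s w t)
    (h' : IsTangle s w t') : t = t' := by
  induction w generalizing s with
  | nil => exact Eq.trans (Eq.symm h) h'
  | cons x w ih => exact ih h.2 h'.2

theorem IsTangle.source_unique {s s' t t' : List Bool} {w : List Slice} (h : IsTangle s w t)
    (h' : IsTangle s' w t') (hw : w ≠ []) : s = s' := by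
  obtain ⟨x, v, rfl⟩ := List.exists_cons_of_ne_nil hw
  exact h.1.symm.trans h'.1

/-- Every cut of the diagram `D` has the value `c`. -/
def HasCutValue (D : LinkDiagram) (c : 𝕂) : Prop :=
  ∀ w₁ w₂ s, D.word = w₁ ++ w₂ → IsTangle [] w₁ s → s ≠ [] → cutLevel w₁ w₂ s = c

/-- The value of a single cut determines the value of all cuts. -/
theorem hasCutValue_of_cut {D : LinkDiagram} {w₁ w₂ : List Slice} {s : List Bool}
    (hD : D.word = w₁ ++ w₂) (h₁ : IsTangle [] w₁ s) (hs : s ≠ []) : HasCutValue D (cutLevel w₁ w₂ s) := by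
  have key : ∀ (w₁ v w₂ : List Slice) (s t : List Bool), D.word = w₁ ++ (v ++ w₂) →
      IsTangle [] w₁ s → IsTangle [] (w₁ ++ v) t → s ≠ [] → t ≠ [] →
      cutLevel w₁ (v ++ w₂) s = cutLevel (w₁ ++ v) w₂ t := by
    intro w₁ v w₂ s t hD h₁ h₃ hs ht
    obtain ⟨s', h₄, h₅⟩ := isTangle_append_iff.1 h₃
    obtain rfl := h₄.target_unique h₁
    have hc := D.closed
    rw [hD, ← List.append_assoc] at hc
    obtain ⟨t', h₆, h₇⟩ := isTangle_append_iff.1 hc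
    obtain rfl := h₆.target_unique h₃
    exact cutLevel_word h₁ h₅ h₇ hs ht
  intro w₁' w₂' s' hD' h₁' hs'
  rcases List.append_eq_append_iff.1 (hD.symm.trans hD') with ⟨v, rfl, rfl⟩ | ⟨v, rfl, rfl⟩
  · exact (key _ _ _ _ _ hD h₁ h₁' hs hs').symm
  · exact key _ _ _ _ _ hD' h₁' h₁ hs' hs

/-- An elementary move does not change the value of the cuts: the cut is made at a level below or above
the place where the move happens, and the operator of the changed part stays the same. -/
theorem LinkDiagram.Move.hasCutValue_iff {D E : LinkDiagram} (h : D.Move E) (c : 𝕂) :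
    HasCutValue D c ↔ HasCutValue E c := by
  obtain ⟨u, v, l, r, p, q, hpq, hD, hE⟩ := h
  obtain ⟨s, t, hp, hq, hne, hst, hag⟩ := hpq.agreeOn
  have hwp := hp.whisker l r
  have hwq := hq.whisker l r
  have hc := D.closed
  rw [hD] at hc
  obtain ⟨t', hc', -⟩ := isTangle_append_iff.1 hc
  obtain ⟨s', hu, hp'⟩ := isTangle_append_iff.1 hc'
  obtain rfl := hp'.source_unique hwp (by simpa [whisker] using hne)
  have hagree : ∀ z, HasOrder (l ++ s ++ r).length z →
      wordOp (whisker l r p) z = wordOp (whisker l r q) z := by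
    intro z hz
    have hz1 : HasOrder (l.length + (s.length + r.length)) z := by
      simpa [add_assoc] using hz
    rw [wordOp_whisker_apply hz1, wordOp_whisker_apply hz1]
    exact hag.lift_iterate l.length r.length z (by convert hz1 using 1; ring)
  have key : ∃ w₁ w₂ w₁' w₂' s, D.word = w₁ ++ w₂ ∧ E.word = w₁' ++ w₂' ∧ IsTangle [] w₁ s ∧
      IsTangle [] w₁' s ∧ s ≠ [] ∧ cutLevel w₁ w₂ s = cutLevel w₁' w₂' s := by
    -- The level below the place of the move may be empty; then the level above it is not.
    by_cases hs : l ++ s ++ r = []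
    · refine ⟨u ++ whisker l r p, v, u ++ whisker l r q, v, l ++ t ++ r, hD, hE, hu.append hwp,
        hu.append hwq, ?_, ?_⟩
      · rcases hst with h | h
        · simp at hs
          exact absurd hs.2.1 h
        · simp [h]
      · rw [cutLevel, cutLevel, cutVal, cutVal, wordOp_append, wordOp_append,
          LinearMap.comp_apply, LinearMap.comp_apply, hagree _ (HasOrder.wordOp_vac hu)]
    · refine ⟨u, whisker l r p ++ v, u, whisker l r q ++ v, l ++ s ++ r, by rw [hD]; simp,
        by rw [hE]; simp, hu, hu, hs, ?_⟩
      obtain ⟨a, s', has⟩ := List.exists_cons_of_ne_nil hs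
      rw [has] at hu hagree ⊢
      refine cutVal_congr (a := a) rfl hu fun z hz => ?_
      rw [wordOp_append, wordOp_append, LinearMap.comp_apply, LinearMap.comp_apply, hagree z hz]
  obtain ⟨w₁, w₂, w₁', w₂', s, hD', hE', h₁, h₁', hs, he⟩ := key
  constructor
  · intro h
    rw [← h w₁ w₂ s hD' h₁ hs, he]
    exact hasCutValue_of_cut hE' h₁' hs
  · intro h
    rw [← h w₁' w₂' s hE' h₁' hs, ← he]
    exact hasCutValue_of_cut hD' h₁ hs

/-- The value of the cuts is an invariant of oriented links. -/
theorem HasCutValue.of_toLink_eq {D E : LinkDiagram} (h : D.toLink = E.toLink) {c : 𝕂}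
    (hE : HasCutValue E c) : HasCutValue D c := by
  have := congrArg (Quot.lift (HasCutValue · c) fun _ _ hm => propext (hm.hasCutValue_iff c)) h
  exact (iff_of_eq this).2 hE

/-! ### Closed braids -/

/-- The coefficient of `e_k ⊗ e_l` in a row of the table. -/
def rowCoef (k l : Fin 4) : List (Fin 4 × Fin 4 × Coef) → Coef
  | [] => []
  | e :: L =>
    if Nat.beq k.1 e.1.1 && Nat.beq l.1 e.2.1.1 then e.2.2 ++ rowCoef k l L
    else rowCoef k l L

theorem crossMatrix_eq_rowCoef (a b o : Bool) (k l i j : Fin 4) :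
    crossMatrix a b o (k, l) (i, j) = (rowCoef k l (row a b o i j)).eval := by
  rw [crossMatrix]
  generalize row a b o (i, j).1 (i, j).2 = L
  induction L with
  | nil => rfl
  | cons e L ih =>
    rw [List.map_cons, List.sum_cons, ih, rowCoef]
    simp only [Bool.and_eq_true, Nat.beq_eq, ← Fin.ext_iff, Prod.mk.injEq]
    split_ifs with h
    · simp [Coef.eval]
    · rw [zero_add]

/-- The operator of a positive crossing of upward strands is the R-matrix. -/
theorem crossMatrix_positive : crossMatrix true true true = R := by
  have h0 : s₀ ^ (2 : ℤ) = t₀ := by rw [← s₀_sq]; norm_cast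
  have h1 : s₁ ^ (2 : ℤ) = t₁ := by rw [← s₁_sq]; norm_cast
  have hY : Y ^ 2 = -1 + (t₁ + (t₀ + -(t₀ * t₁))) := by rw [Y_sq]; ring
  ext ⟨i, j⟩ ⟨k, l⟩
  rw [crossMatrix_eq_rowCoef]
  fin_cases k <;> fin_cases l <;> fin_cases i <;> fin_cases j <;>
    first
    | exact Coef.eval_nil
    | simp [rowCoef, row, extra, extraUpUp, swapMono, Mono.eval, h0, h1, R, hY, Nat.beq]
  all_goals ring

/-- The operator of a negative crossing of upward strands is the inverse R-matrix. -/
theorem crossMatrix_negative : crossMatrix true true false = R⁻¹ := by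
  refine (Matrix.inv_eq_left_inv ?_).symm
  rw [← crossMatrix_positive]
  have h := agreeOn_of_sameOn (n := 2)
    (p := [⟨[], .crossing true true true, []⟩, ⟨[], .crossing true true false, []⟩]) (q := [])
    (by decide +kernel)
  ext ⟨i, j⟩ ⟨k, l⟩
  have h1 := congrFun (h 0 (pre [k, l] vac) (hasOrder_pre_vac [k, l])) [i, j]
  have h2 : ∀ (a b : Fin 4), pre [k, l] vac [a, b] = if a = k then if b = l then 1 else 0 else 0 :=
    fun a b => by simp [vac]
  simp only [wordOp, LinearMap.comp_apply, sliceOp, List.length_nil, Function.iterate_zero, id_eq,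
    LinearMap.id_apply, genOp_crossing_apply, h2] at h1
  rw [Matrix.mul_apply, Fintype.sum_prod_type, Matrix.one_apply]
  simp only [Prod.mk.injEq]
  rw [ite_and, ← h1]
  simp

/-- Nested minima create each word together with its reversal. -/
theorem wordOp_nestedCups (n : ℕ) {a b : List (Fin 4)} (ha : a.length = n) (hb : b.length = n) :
    wordOp (nestedCups n) vac (a ++ b) = if b = a.reverse then 1 else 0 := by
  induction n generalizing a b with
  | zero =>
    obtain rfl := List.eq_nil_of_length_eq_zero ha
    obtain rfl := List.eq_nil_of_length_eq_zero hb
    simp [nestedCups, wordOp, vac]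
  | succ n ih =>
    obtain ⟨a, i, rfl⟩ : ∃ a' i, a = a' ++ [i] :=
      ⟨_, _, (List.dropLast_append_getLast (List.ne_nil_of_length_eq_add_one ha)).symm⟩
    obtain ⟨j, b, rfl⟩ := List.exists_cons_of_length_eq_add_one hb
    have ha' : a.length = n := by simpa using ha
    have hb' : b.length = n := by simpa using hb
    rw [nestedCups, wordOp_append, LinearMap.comp_apply, wordOp_singleton, sliceOp,
      List.length_replicate, List.append_assoc, ← ha', lift_iterate_append, List.cons_append,
      List.nil_append, genOp_cup_apply, ha', ih ha' hb']
    by_cases h : i = j <;> simp [h, cupCoef, Mono.eval]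
    exact fun h' => absurd h'.symm h

/-- Nested maxima contract each word with its reversal, with the weights of the trace. -/
theorem wordOp_nestedCaps (n : ℕ) (z : Tensor) :
    wordOp (nestedCaps n) z [] =
      ∑ f : Fin n → Fin 4, (∏ l, μ (f l)) * z (List.ofFn f ++ (List.ofFn f).reverse) := by
  induction n generalizing z with
  | zero => simp [nestedCaps, wordOp]
  | succ n ih =>
    rw [nestedCaps, wordOp, LinearMap.comp_apply, ih,
      ← (Fin.snocEquiv fun _ : Fin (n + 1) => Fin 4).sum_comp, Fintype.sum_prod_type_right]
    refine Finset.sum_congr rfl fun f _ => ?_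
    have h : sliceOp ⟨List.replicate n true, .cap true, List.replicate n false⟩ z
        (List.ofFn f ++ (List.ofFn f).reverse) =
          ∑ i, μ i * z (List.ofFn f ++ i :: i :: (List.ofFn f).reverse) := by
      have := lift_iterate_append (genOp (.cap true)) z (List.ofFn f) (List.ofFn f).reverse
      rw [List.length_ofFn] at this
      rw [sliceOp, List.length_replicate, this, genOp_cap_apply]
      simp [capCoef, eval_muCoef]
    rw [h, Finset.mul_sum]
    refine Finset.sum_congr rfl fun i _ => ?_
    simp [Fin.snocEquiv, Fin.prod_univ_castSucc, List.ofFn_succ', List.concat_eq_append,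
      -List.ofFn_succ]
    ring

theorem ofFn_update_update {k : ℕ} (f : Fin (k + 1) → Fin 4) (p : Fin k) (i j : Fin 4) :
    List.ofFn (Function.update (Function.update f p.castSucc i) p.succ j) =
      (List.ofFn f).take p ++ i :: j :: (List.ofFn f).drop (p + 2) := by
  have hp := p.2
  have ht : ((List.ofFn f).take p).length = p := by simp [-List.ofFn_succ]; omega
  refine List.ext_getElem (by simp [-List.ofFn_succ]; omega) fun n h₁ h₂ => ?_
  have hn : n < k + 1 := by simpa [-List.ofFn_succ] using h₁
  rw [List.getElem_ofFn]
  rcases lt_trichotomy n p with h | rfl | h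
  · rw [List.getElem_append_left (by omega), Function.update_of_ne, Function.update_of_ne]
    · simp [-List.ofFn_succ]
    · simp [Fin.ext_iff]; omega
    · simp [Fin.ext_iff]; omega
  · rw [List.getElem_append_right (by omega), Function.update_of_ne]
    · simp only [ht, Nat.sub_self, List.getElem_cons_zero]
      exact Function.update_self _ _ _
    · simp [Fin.ext_iff]
  · obtain ⟨q, rfl⟩ := Nat.exists_eq_add_of_lt h
    have e : p.1 + q + 1 - p = q + 1 := by omega
    rw [List.getElem_append_right (by omega)]
    simp only [ht, e, List.getElem_cons_succ]
    rcases q with _ | q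
    · exact Function.update_self _ _ _
    · rw [Function.update_of_ne, Function.update_of_ne]
      · simp only [List.getElem_cons_succ, List.getElem_drop, List.getElem_ofFn]
        congr 2
        omega
      · simp [Fin.ext_iff]; omega
      · simp [Fin.ext_iff]

/-- A slice of a braid acts on the upward strands as the operator of the letter. -/
theorem sliceOp_braidSlice {k : ℕ} (x : Fin k × Bool) (z : Tensor) (f : Fin (k + 1) → Fin 4)
    (r : List (Fin 4)) :
    sliceOp (braidSlice x) z (List.ofFn f ++ r) =
      ∑ g, letterOp x f g * z (List.ofFn g ++ r) := by
  obtain ⟨p, o⟩ := x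
  have hp := p.2
  have hM : crossMatrix true true o = if o then R else R⁻¹ := by
    cases o
    · exact crossMatrix_negative
    · exact crossMatrix_positive
  have hf : List.ofFn f = (List.ofFn f).take p ++
      f p.castSucc :: f p.succ :: (List.ofFn f).drop (p + 2) := by
    rw [← ofFn_update_update]
    simp
  have hlen : ((List.ofFn f).take p).length = p := by
    rw [List.length_take, List.length_ofFn]
    omega
  have h1 : sliceOp (braidSlice (p, o)) z (List.ofFn f ++ r) =
      ∑ i, ∑ j, (if o then R else R⁻¹) (f p.castSucc, f p.succ) (i, j) *
        z (List.ofFn (Function.update (Function.update f p.castSucc i) p.succ j) ++ r) := by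
    have := lift_iterate_append (genOp (.crossing true true o)) z ((List.ofFn f).take p)
      (f p.castSucc :: f p.succ :: ((List.ofFn f).drop (p + 2) ++ r))
    rw [hlen] at this
    rw [hf, sliceOp, braidSlice, List.length_replicate, List.append_assoc, List.cons_append,
      List.cons_append, this, genOp_crossing_apply, hM]
    simp only [ofFn_update_update, List.append_assoc, List.cons_append]
  rw [h1, ← Fintype.sum_prod_type' (f := fun i j => (if o then R else R⁻¹)
    (f p.castSucc, f p.succ) (i, j) *
        z (List.ofFn (Function.update (Function.update f p.castSucc i) p.succ j) ++ r))]
  have hne : p.castSucc ≠ p.succ := Fin.castSucc_lt_succ.ne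
  refine Finset.sum_of_injOn
    (fun q : Fin 4 × Fin 4 => Function.update (Function.update f p.castSucc q.1) p.succ q.2)
    ?_ (by simp) ?_ ?_
  · rintro ⟨i, j⟩ - ⟨i', j'⟩ - h
    have h2 := congrFun h p.castSucc
    have h3 := congrFun h p.succ
    simp [hne] at h2 h3
    rw [h2, h3]
  · intro g _ hg
    rw [letterOp, if_neg, zero_mul]
    intro h
    refine hg ⟨(g p.castSucc, g p.succ), by simp, ?_⟩
    funext j
    by_cases h2 : j = p.succ
    · simp [h2]
    · by_cases h3 : j = p.castSucc
      · simp [h3, hne]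
      · simp [h2, h3, h j h3 h2]
  · rintro ⟨i, j⟩ -
    have hc : ∀ j', j' ≠ p.castSucc → j' ≠ p.succ →
        f j' = Function.update (Function.update f p.castSucc i) p.succ j j' := fun j' h2 h3 => by
      rw [Function.update_of_ne h3, Function.update_of_ne h2]
    show _ = letterOp (p, o) f _ * _
    rw [letterOp, if_pos hc, Function.update_self, Function.update_of_ne hne, Function.update_self]

/-- The diagram of a braid acts on the upward strands as `b_R(β)`. -/
theorem wordOp_braid {k : ℕ} (β : BraidWord k) (z : Tensor) (f : Fin (k + 1) → Fin 4)
    (r : List (Fin 4)) :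
    wordOp (β.map braidSlice) z (List.ofFn f ++ r) = ∑ g, braidOp β f g * z (List.ofFn g ++ r) := by
  induction β using List.reverseRecOn generalizing f with
  | nil => simp [braidOp, wordOp, Matrix.one_apply]
  | append_singleton β x ih =>
    have h : braidOp (β ++ [x]) = letterOp x * braidOp β := by simp [braidOp]
    rw [List.map_append, wordOp_append, LinearMap.comp_apply, List.map_cons, List.map_nil,
      wordOp_singleton, sliceOp_braidSlice, h]
    simp only [ih, Matrix.mul_apply, Finset.mul_sum, Finset.sum_mul]
    rw [Finset.sum_comm]
    simp only [mul_assoc]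

/-- A basis tensor is multiplied by the product of the weights of its factors. -/
theorem weigh_apply {s : List Bool} {x : List (Fin 4)} (h : x.length = s.length) (u : Tensor) :
    weigh s LinearMap.id u x = (List.zipWith weight s x).prod * u x := by
  induction s generalizing x u with
  | nil =>
    obtain rfl := List.eq_nil_of_length_eq_zero h
    simp [weigh]
  | cons a s ih =>
    obtain ⟨i, x, rfl⟩ := List.exists_cons_of_length_eq_add_one h
    rw [weigh, diagL_cons, ih (by simpa using h)]
    simp [mul_assoc]

/-- The quantum trace of a braid is the value of its closure, cut open at the first strand. -/
theorem quantumTrace_eq_cutVal {k : ℕ} (β : BraidWord k) (x x' : Fin 4) :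
    quantumTrace (braidOp β) x x' =
      cutVal (nestedCups (k + 1)) (β.map braidSlice ++ nestedCaps (k + 1)) [] [x] [x']
        (List.replicate k true ++ List.replicate (k + 1) false) := by
  -- The upward strands 2, …, k + 1 and the downward strands that close them have inverse weights, so
  -- that only the downward strand that belongs to the open first strand contributes.
  have hw : ∀ f : Fin k → Fin 4, (List.zipWith weight
      (List.replicate k true ++ List.replicate (k + 1) false)
      (List.ofFn f ++ ((List.ofFn f).reverse ++ [x]))).prod = (μ x)⁻¹ := by
    intro f
    have hz : ∀ (a : Bool) (n : ℕ) (l : List (Fin 4)), l.length = n →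
        List.zipWith weight (List.replicate n a) l = l.map (weight a) := by
      rintro a n l rfl
      induction l with
      | nil => rfl
      | cons i l ih => simp [List.replicate_succ, ih]
    rw [List.zipWith_append (by simp), hz _ _ _ (by simp), hz _ _ _ (by simp), List.map_append,
      List.prod_append, List.prod_append, ← mul_assoc, List.map_reverse, List.prod_reverse,
      ← List.prod_map_mul]
    have : ∀ i, weight true i * weight false i = 1 := weight_mul_not true
    simp only [this, List.map_const', List.prod_replicate, one_pow]
    simp [weight]
  set z := cutOp [] [x] [x'] (List.replicate k true ++ List.replicate (k + 1) false)
    (wordOp (nestedCups (k + 1)) vac) with hz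
  have hz1 : ∀ (g f : Fin (k + 1) → Fin 4), z (List.ofFn g ++ (List.ofFn f).reverse) =
      if g 0 = x' then if f = Fin.cons x (Fin.tail g) then (μ x)⁻¹ else 0 else 0 := by
    intro g f
    have h1 : List.ofFn g = g 0 :: List.ofFn (Fin.tail g) := by rw [List.ofFn_succ]; rfl
    rw [h1, List.cons_append, hz]
    show pre [x'] (weigh _ LinearMap.id (dropL [x] (wordOp (nestedCups (k + 1)) vac))) _ = _
    rw [pre_cons, pre_nil, consL_cons]
    congr 1
    rw [weigh_apply (by simp)]
    have h2 : dropL [x] (wordOp (nestedCups (k + 1)) vac)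
        (List.ofFn (Fin.tail g) ++ (List.ofFn f).reverse) =
          if f = Fin.cons x (Fin.tail g) then 1 else 0 := by
      show wordOp (nestedCups (k + 1)) vac (x :: List.ofFn (Fin.tail g) ++ _) = _
      have : x :: List.ofFn (Fin.tail g) =
          List.ofFn (Fin.cons x (Fin.tail g) : Fin (k + 1) → Fin 4) := by
        simp [List.ofFn_succ]
      rw [wordOp_nestedCups (k + 1) (by simp) (by simp), this]
      simp only [List.reverse_inj, List.ofFn_inj]
    rw [h2]
    split_ifs with h
    · rw [h, mul_one, ← hw (Fin.tail g)]
      simp [List.ofFn_succ]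
    · rw [mul_zero]
  rw [cutVal, wordOp_append, LinearMap.comp_apply, ← hz, wordOp_nestedCaps]
  simp only [wordOp_braid, hz1]
  have key : ∀ f : Fin (k + 1) → Fin 4, (∑ g, braidOp β f g *
      if g 0 = x' then if f = Fin.cons x (Fin.tail g) then (μ x)⁻¹ else 0 else 0) =
        ∑ h, if f = Fin.cons x h then braidOp β f (Fin.cons x' h) * (μ x)⁻¹ else 0 := by
    intro f
    rw [← (Fin.consEquiv fun _ : Fin (k + 1) => Fin 4).sum_comp, Fintype.sum_prod_type,
      Fintype.sum_eq_single x' fun a ha => by simp [Fin.consEquiv, ha]]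
    simp [Fin.consEquiv]
  simp only [key, Finset.mul_sum]
  rw [Finset.sum_comm, quantumTrace]
  refine Finset.sum_congr rfl fun h _ => ?_
  rw [Fintype.sum_eq_single (Fin.cons x h) fun f hf => by rw [if_neg hf, mul_zero], if_pos rfl,
    Fin.prod_univ_succ]
  simp only [Fin.cons_zero, Fin.cons_succ]
  have := μ_ne_zero x
  field_simp

/-- If the cuts of the closure of a braid have the value `c`, the quantum trace is `c • id`, because a
tangle with one upward strand acts by a scalar. -/
theorem quantumTrace_of_hasCutValue {k : ℕ} {β : BraidWord k} {c : 𝕂}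
    (h : HasCutValue (braidClosure β) c) :
    quantumTrace (braidOp β) = c • (1 : Matrix (Fin 4) (Fin 4) 𝕂) := by
  have hs : List.replicate (k + 1) true ++ List.replicate (k + 1) false =
      [] ++ [true] ++ (List.replicate k true ++ List.replicate (k + 1) false) := by
    simp [List.replicate_succ]
  have h₁ := isTangle_nestedCups (k + 1)
  have h₂ := (isTangle_braid β).append (isTangle_nestedCaps (k + 1))
  have hc := h _ _ _ rfl h₁ (by simp [List.replicate_succ])
  rw [hs] at h₁ h₂ hc
  obtain ⟨w, hw, he⟩ := exists_entry_eq_cutVal _ _ _ _ _ h₁ h₂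
  ext x x'
  rw [quantumTrace_eq_cutVal, ← he [x] [x'] rfl rfl, entry_upward hw, he [1] [1] rfl rfl]
  rw [Matrix.smul_apply, Matrix.one_apply, ← hc]
  simp only [cutLevel, smul_eq_mul, mul_ite, mul_one, mul_zero]
  rfl

/-! ### Twist regions -/

/-- A linear combination of diagrams without end points at the bottom, computed as a vector. -/
def linComb : List (Coef × List Slice) → Option SparseVec
  | [] => some []
  | e :: L =>
    match run e.2 (unitVec []), linComb L with
    | some s, some t => some (SparseVec.addMul e.1 s t)
    | _, _ => none

theorem sum_wordOp_vac_eq_zero {L : List (Coef × List Slice)} (h : linComb L = some []) :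
    (L.map fun e => e.1.eval • wordOp e.2 vac).sum = 0 := by
  have key : ∀ (L : List (Coef × List Slice)) (t : SparseVec), linComb L = some t →
      (L.map fun e => e.1.eval • wordOp e.2 vac).sum = t.eval vac := by
    intro L
    induction L with
    | nil =>
      intro t h
      obtain rfl := Option.some.inj h
      rfl
    | cons e L ih =>
      intro t h
      rw [linComb] at h
      split at h
      · next s t' hs ht =>
        obtain rfl := Option.some.inj h
        have := wordOp_eval hs vac
        rw [eval_unitVec, pre_nil] at this
        rw [List.map_cons, List.sum_cons, ih _ ht, this, SparseVec.eval_addMul]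
      · simp at h
  exact key L [] h

/-- The two ways to join four strands at the bottom: the strands 2, 3 and 1, 4 (`true`) or the
strands 1, 2 and 3, 4 (`false`). -/
def arcs : Bool → List Slice
  | true => bottomArcs
  | false => [⟨[], .cup true, []⟩, ⟨[], .cup true, [true, false]⟩]

/-- The full twist of the strands 1, 2 (`true`) or 2, 3 (`false`). -/
def twist (e : Bool) : List Slice := if e then fullTwistOne else fullTwistTwo

/-- The eigenvalue of a full twist that is different from `1`. -/
def eigenCoef : Bool → Coef
  | true => [⟨1, -2, -2, false⟩]
  | false => [⟨1, 2, 2, false⟩]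

/-- The formal sum of `(t₀ - 1) (t₁ - 1)`, up to a factor `(t₀ t₁)⁻¹` in the first case. -/
def mixCoef : Bool → Coef
  | true => [⟨1, 0, 0, false⟩, ⟨-1, 0, -2, false⟩, ⟨-1, -2, 0, false⟩, ⟨1, -2, -2, false⟩]
  | false => [⟨1, 2, 2, false⟩, ⟨-1, 2, 0, false⟩, ⟨-1, 0, 2, false⟩, ⟨1, 0, 0, false⟩]

/-- The relations of the twist regions: a full twist fixes the arcs that join the twisted strands, on
the other arcs two twists reduce to one, and the vectors that belong to the two kinds of twists span
the same space. -/
theorem twist_check : ∀ e : Bool,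
    (linComb [(one, arcs (!e) ++ twist e), (negOne, arcs (!e))]).any List.isEmpty = true ∧
    (linComb [(one, arcs e ++ twist e ++ twist e), (negOne, arcs e ++ twist e),
      (Coef.mul negOne (eigenCoef e), arcs e ++ twist e), (eigenCoef e, arcs e),
      (Coef.add (mixCoef e) (mixCoef e), arcs (!e))]).any List.isEmpty = true ∧
    (linComb [(one, arcs e ++ twist e), (negOne, arcs e), (mixCoef e, arcs e),
      (mixCoef e, arcs (!e)), (eigenCoef e, arcs (!e) ++ twist (!e)),
      (Coef.mul negOne (eigenCoef e), arcs (!e))]).any List.isEmpty = true := by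
  decide +kernel

/-- The vector in `W^{⊗4}` of four strands joined by two arcs. -/
noncomputable def arcVec (e : Bool) : Tensor := wordOp (arcs e) vac

/-- What a full twist changes on the arcs that it acts on nontrivially. -/
noncomputable def twistVec (e : Bool) : Tensor := wordOp (twist e) (arcVec e) - arcVec e

theorem eq_some_nil_of_any_isEmpty {o : Option SparseVec} (h : o.any List.isEmpty = true) :
    o = some [] := by
  cases o with
  | none => simp at h
  | some s => simpa using h

theorem twist_arcVec_not (e : Bool) : wordOp (twist e) (arcVec (!e)) = arcVec (!e) := by
  have h := sum_wordOp_vac_eq_zero (eq_some_nil_of_any_isEmpty (twist_check e).1)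
  simp only [List.map_cons, List.map_nil, List.sum_cons, List.sum_nil, wordOp_append,
    LinearMap.comp_apply, eval_one, eval_negOne] at h
  funext x
  have hx := congrFun h x
  simp only [arcVec, Pi.add_apply, Pi.smul_apply, Pi.zero_apply, smul_eq_mul] at hx ⊢
  linear_combination hx

theorem twist_twistVec (e : Bool) : wordOp (twist e) (twistVec e) =
    (eigenCoef e).eval • twistVec e - (2 * (mixCoef e).eval) • arcVec (!e) := by
  have h := sum_wordOp_vac_eq_zero (eq_some_nil_of_any_isEmpty (twist_check e).2.1)
  simp only [List.map_cons, List.map_nil, List.sum_cons, List.sum_nil, wordOp_append,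
    LinearMap.comp_apply, eval_one, eval_negOne, Coef.eval_mul, Coef.eval_add] at h
  funext x
  have hx := congrFun h x
  simp only [arcVec, twistVec, map_sub, Pi.add_apply, Pi.sub_apply, Pi.smul_apply,
    Pi.zero_apply, smul_eq_mul] at hx ⊢
  linear_combination hx

theorem twistVec_eq (e : Bool) : twistVec e =
    -(mixCoef e).eval • (arcVec e + arcVec (!e)) - (eigenCoef e).eval • twistVec (!e) := by
  have h := sum_wordOp_vac_eq_zero (eq_some_nil_of_any_isEmpty (twist_check e).2.2)
  simp only [List.map_cons, List.map_nil, List.sum_cons, List.sum_nil, wordOp_append,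
    LinearMap.comp_apply, eval_one, eval_negOne, Coef.eval_mul] at h
  funext x
  have hx := congrFun h x
  simp only [arcVec, twistVec, Pi.add_apply, Pi.sub_apply, Pi.smul_apply,
    Pi.zero_apply, smul_eq_mul] at hx ⊢
  linear_combination hx

/-! ### Closing the twist regions -/

/-- The coefficient of a word in a combination of words. -/
def coefAt (s : SparseVec) (x : List (Fin 4)) : Coef :=
  s.foldr (fun e acc => if SparseVec.sameWord x e.1 then Coef.add e.2 acc else acc) []

theorem eval_coefAt (s : SparseVec) (x : List (Fin 4)) : (coefAt s x).eval = s.eval vac x := by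
  induction s with
  | nil => rfl
  | cons e s ih =>
    have : coefAt (e :: s) x =
      if SparseVec.sameWord x e.1 then Coef.add e.2 (coefAt s x) else coefAt s x := rfl
    rw [this, SparseVec.eval_cons, Pi.add_apply, Pi.smul_apply, pre_vac_apply, ← ih]
    simp only [sameWord_iff]
    split_ifs
    · rw [Coef.eval_add, smul_eq_mul, mul_one]
    · rw [smul_zero, zero_add]

/-- The functional `L`, evaluated at the vector `s`. -/
def pairing (L s : SparseVec) : Coef :=
  L.foldr (fun e acc => Coef.add (Coef.mul e.2 (coefAt s e.1)) acc) []

theorem eval_pairing (L s : SparseVec) : (pairing L s).eval = L.sum (s.eval vac) := by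
  induction L with
  | nil => rfl
  | cons e L ih =>
    have : pairing (e :: L) s = Coef.add (Coef.mul e.2 (coefAt s e.1)) (pairing L s) := rfl
    rw [this, Coef.eval_add, Coef.eval_mul, ih, eval_coefAt, SparseVec.sum_cons, smul_eq_mul]

/-- The functional that closes four strands with top arcs and cuts the first strand open, in the state
`e₂`: `∑ⱼ μⱼ u(1, 1, j, j)` for the arcs that join the strands 1, 2 and 3, 4 (`true`), and
`∑ⱼ u(1, j, j, 1)` for the arcs that join the strands 2, 3 and 1, 4 (`false`). -/
def topForm : Bool → SparseVec
  | true => [0, 1, 2, 3].map fun j => ([1, 1, j, j], muCoef j)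
  | false => [0, 1, 2, 3].map fun j => ([1, j, j, 1], one)

/-- The functional for the arcs of kind `e` is `1` on `arcVec e`, `0` on `arcVec (!e)` and `1` on the twisted
arcs of kind `e`. -/
theorem topForm_check : ∀ e : Bool,
    ((run (arcs e) (unitVec [])).any fun s =>
      (Coef.add negOne (pairing (topForm e) s)).isEmpty) = true ∧
    ((run (arcs (!e)) (unitVec [])).any fun s =>
      (pairing (topForm e) s).isEmpty) = true ∧
    ((run (arcs e ++ twist e) (unitVec [])).any fun s =>
      (Coef.add negOne (pairing (topForm e) s)).isEmpty) = true := by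
  decide +kernel

theorem topForm_eval {e : Bool} {w : List Slice} {c : Coef}
    (h : ((run w (unitVec [])).any fun s =>
      (Coef.add c (pairing (topForm e) s)).isEmpty) = true) :
    (topForm e).sum (wordOp w vac) = -c.eval := by
  cases hs : run w (unitVec []) with
  | none => simp [hs] at h
  | some s =>
    rw [hs, Option.any_some] at h
    have h1 := Coef.eval_add c (pairing (topForm e) s)
    have h2 := wordOp_eval hs vac
    rw [eval_unitVec, pre_nil] at h2
    rw [List.isEmpty_iff.1 h, Coef.eval_nil] at h1
    rw [h2, ← eval_pairing]
    linear_combination -h1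

theorem topForm_arcVec (e : Bool) : (topForm e).sum (arcVec e) = 1 := by
  rw [arcVec, topForm_eval (topForm_check e).1, eval_negOne, neg_neg]

theorem topForm_arcVec_not (e : Bool) : (topForm e).sum (arcVec (!e)) = 0 := by
  rw [arcVec, topForm_eval (c := []) (topForm_check e).2.1, Coef.eval_nil, neg_zero]

theorem sum_add_vec (L : SparseVec) (u v : Tensor) : L.sum (u + v) = L.sum u + L.sum v := by
  induction L with
  | nil => simp
  | cons e L ih =>
    rw [SparseVec.sum_cons, SparseVec.sum_cons, SparseVec.sum_cons, ih, Pi.add_apply, smul_add]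
    abel

theorem sum_smul_vec (L : SparseVec) (c : 𝕂) (u : Tensor) : L.sum (c • u) = c * L.sum u := by
  induction L with
  | nil => simp
  | cons e L ih =>
    rw [SparseVec.sum_cons, SparseVec.sum_cons, ih, Pi.smul_apply, smul_eq_mul, smul_eq_mul,
      smul_eq_mul]
    ring

theorem topForm_twistVec (e : Bool) : (topForm e).sum (twistVec e) = 0 := by
  have h1 := topForm_eval (topForm_check e).2.2
  rw [wordOp_append, LinearMap.comp_apply] at h1
  have h2 : twistVec e = wordOp (twist e) (wordOp (arcs e) vac) + (-1 : 𝕂) • arcVec e := by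
    rw [twistVec, arcVec, neg_one_smul, sub_eq_add_neg]
  rw [h2, sum_add_vec, sum_smul_vec, h1, topForm_arcVec, eval_negOne]
  ring

/-- The closed diagram, cut open at its first strand, is the value of `topForm` on the part below the top
arcs. -/
theorem cutLevel_topArcs (w : List Slice) (m : ℕ) :
    cutLevel w (topArcs m) [true, false, true, false] =
      (topForm (decide (Even m))).sum (wordOp w vac) := by
  have h := μ_ne_zero
  rw [cutLevel, cutVal]
  by_cases hm : Even m
  · rw [topArcs, if_pos hm, decide_eq_true hm]
    simp [wordOp, sliceOp, genOp_cap_apply, topForm, cutOp, weigh, dropL, capCoef, eval_muCoef,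
      Fin.sum_univ_four, weight, h]
    ring
  · rw [topArcs, if_neg hm, decide_eq_false hm]
    simp [wordOp, sliceOp, genOp_cap_apply, topForm, cutOp, weigh, dropL, capCoef, eval_muCoef,
      Fin.sum_univ_four, weight, h, Mono.eval]
    linear_combination (wordOp w vac [1, 0, 0, 1] + wordOp w vac [1, 1, 1, 1] +
      wordOp w vac [1, 2, 2, 1] + wordOp w vac [1, 3, 3, 1]) * mul_inv_cancel₀ (h 1)

/-- Twist regions with `n` full twists for each entry `n` of a list, alternately on the strands
1, 2 and 2, 3. -/
def regions : Bool → List ℕ → List Slice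
  | _, [] => []
  | e, n :: L => (List.replicate n (twist e)).flatten ++ regions (!e) L

theorem twistRegions_eq {m : ℕ} (b : Fin m → ℕ) : twistRegions b = regions true (List.ofFn b) := by
  have key : ∀ (m : ℕ) (b : Fin m → ℕ) (e : Bool), ((List.finRange m).map fun i =>
      (List.replicate (b i) (twist (e == decide (Even (i : ℕ))))).flatten).flatten =
        regions e (List.ofFn b) := by
    intro m
    induction m with
    | zero => intro b e; rfl
    | succ m ih =>
      intro b e
      rw [List.ofFn_succ, regions, ← ih, List.finRange_succ, List.map_cons, List.flatten_cons,
        List.map_map]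
      congr 1
      · simp
      · congr 1
        refine List.map_congr_left fun i _ => ?_
        simp only [Function.comp_apply, Fin.val_succ, Nat.even_add_one]
        congr 3
        cases e <;> by_cases h : Even (i : ℕ) <;> simp [h]
  rw [← key, twistRegions]
  congr 2
  funext i
  simp [twist]

/-! ### Laurent polynomials -/

/-- The value of a Laurent polynomial at `t₀`, `t₁`, as a ring homomorphism. -/
noncomputable def toFieldHom : Laurent →+* 𝕂 :=
  (AddMonoidAlgebra.lift ℤ 𝕂 (ℤ × ℤ)
    { toFun := fun e => t₀ ^ e.toAdd.1 * t₁ ^ e.toAdd.2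
      map_one' := by simp
      map_mul' := fun a b => by
        simp only [toAdd_mul, Prod.fst_add, Prod.snd_add, zpow_add₀ t₀_ne_zero,
          zpow_add₀ t₁_ne_zero]
        ring }).toRingHom

theorem toFieldHom_apply (P : Laurent) : toFieldHom P = P.toField := by
  show AddMonoidAlgebra.lift ℤ 𝕂 (ℤ × ℤ) _ P = _
  rw [AddMonoidAlgebra.lift_apply, Laurent.toField]
  refine Finsupp.sum_congr fun e _ => ?_
  rw [Algebra.smul_def, eq_intCast]
  rfl

/-- The Laurent polynomial `t₀^i t₁^j`. -/
noncomputable def monomial (i j : ℤ) : Laurent := AddMonoidAlgebra.single (i, j) 1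

theorem toFieldHom_monomial (i j : ℤ) : toFieldHom (monomial i j) = t₀ ^ i * t₁ ^ j := by
  show AddMonoidAlgebra.lift ℤ 𝕂 (ℤ × ℤ) _ _ = _
  rw [monomial, AddMonoidAlgebra.lift_single, Algebra.smul_def, eq_intCast, Int.cast_one,
    one_mul]
  rfl

theorem coeff_monomial_mul (i j : ℤ) (P : Laurent) (e : ℤ × ℤ) :
    (monomial i j * P).coeff e = P.coeff (e.1 - i, e.2 - j) := by
  rw [monomial, AddMonoidAlgebra.coeff_single_mul_apply, one_mul]
  congr 1
  ext <;> simp <;> ring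

/-- The sums of the coefficients in the degrees `i - j`. -/
noncomputable def degreeHom : Laurent →+* AddMonoidAlgebra ℤ ℤ :=
  AddMonoidAlgebra.mapDomainRingHom ℤ (AddMonoidHom.fst ℤ ℤ - AddMonoidHom.snd ℤ ℤ)

/-- The sum of the coefficients of the terms `t₀^i t₁^j` with `i - j = d`. -/
noncomputable def degreeSum (d : ℤ) (P : Laurent) : ℤ := (degreeHom P).coeff d

theorem degreeSum_add (d : ℤ) (P Q : Laurent) :
    degreeSum d (P + Q) = degreeSum d P + degreeSum d Q := by
  rw [degreeSum, map_add]
  rfl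

theorem degreeSum_sub (d : ℤ) (P Q : Laurent) :
    degreeSum d (P - Q) = degreeSum d P - degreeSum d Q := by
  rw [degreeSum, map_sub]
  rfl

theorem degreeSum_monomial_mul (d i j : ℤ) (P : Laurent) :
    degreeSum d (monomial i j * P) = degreeSum (d - (i - j)) P := by
  have h : degreeHom (monomial i j) = AddMonoidAlgebra.single (i - j) 1 := by
    simp [degreeHom, monomial]
  rw [degreeSum, map_mul, h, AddMonoidAlgebra.coeff_single_mul_apply, one_mul, degreeSum]
  congr 1
  ring

theorem exists_of_degreeSum_ne_zero {d : ℤ} {P : Laurent} (h : degreeSum d P ≠ 0) :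
    ∃ e, P.coeff e ≠ 0 ∧ e.1 - e.2 = d := by
  have h1 : (Finsupp.mapDomain (fun e : ℤ × ℤ => e.1 - e.2) P.coeff) d ≠ 0 := h
  have h2 := Finsupp.mapDomain_support (Finsupp.mem_support_iff.2 h1)
  obtain ⟨e, he, rfl⟩ := Finset.mem_image.1 h2
  exact ⟨e, Finsupp.mem_support_iff.1 he, rfl⟩

/-- All degrees of `P` lie between `-k` and `k`, and the sum of the coefficients is `a` in each of
the two extreme degrees. -/
structure HasEdges (k : ℕ) (a : ℤ) (P : Laurent) : Prop where
  coeff_eq_zero : ∀ e : ℤ × ℤ, (k : ℤ) < |e.1 - e.2| → P.coeff e = 0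
  top : degreeSum k P = a
  bot : degreeSum (-k) P = a

namespace HasEdges

variable {k : ℕ} {a b : ℤ} {P Q : Laurent}

theorem degreeSum_eq_zero (h : HasEdges k a P) {d : ℤ} (hd : (k : ℤ) < |d|) :
    degreeSum d P = 0 := by
  by_contra hne
  obtain ⟨e, he, rfl⟩ := exists_of_degreeSum_ne_zero hne
  exact he (h.coeff_eq_zero e hd)

theorem add (hP : HasEdges k a P) (hQ : HasEdges k b Q) : HasEdges k (a + b) (P + Q) where
  coeff_eq_zero e he := by
    show P.coeff e + Q.coeff e = 0
    rw [hP.coeff_eq_zero e he, hQ.coeff_eq_zero e he, add_zero]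
  top := by rw [degreeSum_add, hP.top, hQ.top]
  bot := by rw [degreeSum_add, hP.bot, hQ.bot]

theorem sub (hP : HasEdges k a P) (hQ : HasEdges k b Q) : HasEdges k (a - b) (P - Q) where
  coeff_eq_zero e he := by
    show P.coeff e - Q.coeff e = 0
    rw [hP.coeff_eq_zero e he, hQ.coeff_eq_zero e he, sub_zero]
  top := by rw [degreeSum_sub, hP.top, hQ.top]
  bot := by rw [degreeSum_sub, hP.bot, hQ.bot]

theorem zero : HasEdges k 0 (0 : Laurent) where
  coeff_eq_zero _ _ := rfl
  top := by rw [degreeSum, map_zero]; rfl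
  bot := by rw [degreeSum, map_zero]; rfl

theorem neg (hP : HasEdges k a P) : HasEdges k (-a) (-P) := by
  rw [← zero_sub, ← zero_sub P]
  exact zero.sub hP

theorem succ (hP : HasEdges k a P) : HasEdges (k + 1) 0 P where
  coeff_eq_zero e he := hP.coeff_eq_zero e (by push_cast at he; omega)
  top := hP.degreeSum_eq_zero (by rw [abs_of_nonneg (by positivity)]; push_cast; omega)
  bot := hP.degreeSum_eq_zero (by rw [abs_neg, abs_of_nonneg (by positivity)]; push_cast; omega)

theorem diagonal_mul (n : ℤ) (hP : HasEdges k a P) : HasEdges k a (monomial n n * P) where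
  coeff_eq_zero e he := by
    rw [coeff_monomial_mul]
    exact hP.coeff_eq_zero _ (by simpa using he)
  top := by rw [degreeSum_monomial_mul, sub_self, sub_zero, hP.top]
  bot := by rw [degreeSum_monomial_mul, sub_self, sub_zero, hP.bot]

end HasEdges

/-- The Laurent polynomial `(t₀ - 1) (t₁ - 1)`, up to a factor `(t₀ t₁)⁻¹`. -/
noncomputable def mixPoly : Bool → Laurent
  | true => monomial (-1) (-1) * (monomial 1 1 - monomial 1 0 - monomial 0 1 + 1)
  | false => monomial 1 1 - monomial 1 0 - monomial 0 1 + 1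

/-- The eigenvalue `eigenCoef` as a Laurent polynomial. -/
noncomputable def eigenPoly : Bool → Laurent
  | true => monomial (-1) (-1)
  | false => monomial 1 1

theorem HasEdges.eigenPoly_mul (e : Bool) {k : ℕ} {a : ℤ} {P : Laurent} (hP : HasEdges k a P) :
    HasEdges k a (eigenPoly e * P) := by
  cases e
  · exact hP.diagonal_mul 1
  · exact hP.diagonal_mul (-1)

/-- The extreme terms of `mixPoly` are those of degree `1` and `-1`, and both have the coefficient `-1`. -/
theorem HasEdges.mixPoly_mul (e : Bool) {k : ℕ} {a : ℤ} {P : Laurent} (hP : HasEdges k a P) :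
    HasEdges (k + 1) (-a) (mixPoly e * P) := by
  have h : HasEdges (k + 1) (-a) (mixPoly false * P) := by
    have hm : mixPoly false * P =
        monomial 1 1 * P - monomial 1 0 * P - monomial 0 1 * P + P := by
      rw [mixPoly]
      ring
    have hz : ∀ d : ℤ, (k : ℤ) < |d| → degreeSum d P = 0 := fun d hd => hP.degreeSum_eq_zero hd
    rw [hm]
    refine ⟨fun e he => ?_, ?_, ?_⟩
    · have hc : ∀ e' : ℤ × ℤ, (k : ℤ) < |e'.1 - e'.2| → P.coeff e' = 0 := hP.coeff_eq_zero
      show (monomial 1 1 * P).coeff e - (monomial 1 0 * P).coeff e - (monomial 0 1 * P).coeff e +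
        P.coeff e = 0
      push_cast at he
      rw [lt_abs] at he
      rw [coeff_monomial_mul, coeff_monomial_mul, coeff_monomial_mul,
        hc _ (lt_abs.2 (by dsimp only; omega)), hc _ (lt_abs.2 (by dsimp only; omega)),
        hc _ (lt_abs.2 (by dsimp only; omega)), hc _ (lt_abs.2 (by omega))]
      rfl
    · have h₀ : (↑(k + 1) : ℤ) - (1 - 0) = k := by push_cast; ring
      rw [degreeSum_add, degreeSum_sub, degreeSum_sub, degreeSum_monomial_mul,
        degreeSum_monomial_mul, degreeSum_monomial_mul, h₀, hP.top,
        hz _ (lt_abs.2 (by omega)), hz _ (lt_abs.2 (by omega)), hz _ (lt_abs.2 (by omega))]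
      ring
    · have h₀ : -(↑(k + 1) : ℤ) - (0 - 1) = -k := by push_cast; ring
      rw [degreeSum_add, degreeSum_sub, degreeSum_sub, degreeSum_monomial_mul,
        degreeSum_monomial_mul, degreeSum_monomial_mul, h₀, hP.bot,
        hz _ (lt_abs.2 (by omega)), hz _ (lt_abs.2 (by omega)), hz _ (lt_abs.2 (by omega))]
      ring
  cases e
  · exact h
  · have : mixPoly true * P = monomial (-1) (-1) * (mixPoly false * P) := mul_assoc _ _ _
    rw [this]
    exact h.diagonal_mul (-1)

theorem toFieldHom_eigenPoly (e : Bool) : toFieldHom (eigenPoly e) = (eigenCoef e).eval := by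
  have h0 : ∀ n : ℤ, s₀ ^ (2 * n) = t₀ ^ n := fun n => by rw [zpow_mul, ← s₀_sq]; norm_cast
  have h1 : ∀ n : ℤ, s₁ ^ (2 * n) = t₁ ^ n := fun n => by rw [zpow_mul, ← s₁_sq]; norm_cast
  cases e
  · rw [eigenPoly, toFieldHom_monomial, ← h0, ← h1]
    simp [eigenCoef, Mono.eval]
  · rw [eigenPoly, toFieldHom_monomial, ← h0, ← h1]
    simp [eigenCoef, Mono.eval]

theorem toFieldHom_mixPoly (e : Bool) : toFieldHom (mixPoly e) = (mixCoef e).eval := by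
  have h0 : ∀ n : ℤ, t₀ ^ n = s₀ ^ (2 * n) := fun n => by rw [zpow_mul, ← s₀_sq]; norm_cast
  have h1 : ∀ n : ℤ, t₁ ^ n = s₁ ^ (2 * n) := fun n => by rw [zpow_mul, ← s₁_sq]; norm_cast
  cases e
  · simp only [mixPoly, map_add, map_sub, map_one, toFieldHom_monomial, h0, h1]
    simp [mixCoef, Mono.eval]
    ring
  · simp only [mixPoly, mul_add, mul_sub, mul_one, map_add, map_sub, map_mul, toFieldHom_monomial,
      h0, h1]
    simp [mixCoef, Mono.eval]
    have := s₀_ne_zero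
    have := s₁_ne_zero
    field_simp
    ring

/-! ### The polynomial of the 2-bridge links -/

/-- The vector `x • arcVec e + y • arcVec (!e) + c • twistVec e`. -/
noncomputable def stateVec (e : Bool) (s : Laurent × Laurent × Laurent) : Tensor :=
  toFieldHom s.1 • arcVec e + toFieldHom s.2.1 • arcVec (!e) + toFieldHom s.2.2 • twistVec e

/-- The effect of one full twist on the coefficients. -/
noncomputable def twistState (e : Bool) (s : Laurent × Laurent × Laurent) :
    Laurent × Laurent × Laurent :=
  (s.1, s.2.1 - (mixPoly e * s.2.2 + mixPoly e * s.2.2), s.1 + eigenPoly e * s.2.2)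

/-- The coefficients of the same vector for the twist regions of the other kind. -/
noncomputable def switchState (e : Bool) (s : Laurent × Laurent × Laurent) :
    Laurent × Laurent × Laurent :=
  (s.2.1 - mixPoly e * s.2.2, s.1 - mixPoly e * s.2.2, -(eigenPoly e * s.2.2))

theorem twist_stateVec (e : Bool) (s : Laurent × Laurent × Laurent) :
    wordOp (twist e) (stateVec e s) = stateVec e (twistState e s) := by
  have h1 : wordOp (twist e) (arcVec e) = arcVec e + twistVec e := by
    rw [twistVec]
    abel
  simp only [stateVec, twistState, map_add, map_sub, map_mul, map_smul, h1, twist_arcVec_not,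
    twist_twistVec, toFieldHom_eigenPoly, toFieldHom_mixPoly]
  funext x
  simp only [Pi.add_apply, Pi.sub_apply, Pi.smul_apply, smul_eq_mul]
  ring

theorem stateVec_switchState (e : Bool) (s : Laurent × Laurent × Laurent) :
    stateVec e s = stateVec (!e) (switchState e s) := by
  have h := twistVec_eq e
  simp only [stateVec, switchState, map_sub, map_mul, map_neg, toFieldHom_eigenPoly,
    toFieldHom_mixPoly, Bool.not_not]
  funext x
  have hx := congrFun h x
  simp only [Pi.add_apply, Pi.sub_apply, Pi.smul_apply, smul_eq_mul] at hx ⊢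
  linear_combination toFieldHom s.2.2 * hx

/-- The coefficients after all twist regions, whose numbers of full twists are given by the list. -/
noncomputable def finalState : Bool → List ℕ → Laurent × Laurent × Laurent →
    Laurent × Laurent × Laurent
  | _, [], s => s
  | e, n :: L, s => finalState (!e) L (switchState e ((twistState e)^[n] s))

theorem wordOp_regions (e : Bool) (L : List ℕ) (s : Laurent × Laurent × Laurent) :
    wordOp (regions e L) (stateVec e s) =
      stateVec (e ^^ decide (Odd L.length)) (finalState e L s) := by
  induction L generalizing e s with
  | nil => simp [regions, finalState, wordOp]
  | cons n L ih =>
    have h : wordOp (List.replicate n (twist e)).flatten (stateVec e s) =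
        stateVec e ((twistState e)^[n] s) := by
      induction n generalizing s with
      | zero => rfl
      | succ n ihn =>
        rw [List.replicate_succ, List.flatten_cons, wordOp_append, LinearMap.comp_apply,
          twist_stateVec, ihn, Function.iterate_succ_apply]
    rw [regions, wordOp_append, LinearMap.comp_apply, h, stateVec_switchState, ih, finalState]
    congr 1
    simp only [List.length_cons, Nat.odd_add_one]
    by_cases ho : Odd L.length <;> simp [ho]

/-- After `n` full twists: each twist adds the first coefficient to the third one, which grows to `n * a` at
the edges, and subtracts `2 * mixPoly` times the third one from the second one, which gives
`2 * (0 + 1 + ⋯ + (n - 1)) * a = n * (n - 1) * a` in the next degree. -/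
theorem hasEdges_twistState {k : ℕ} {a d : ℤ} (e : Bool) (n : ℕ)
    {s : Laurent × Laurent × Laurent} (h₁ : HasEdges k a s.1) (h₂ : HasEdges k d s.2.1)
    (h₃ : HasEdges k 0 s.2.2) :
    HasEdges k a ((twistState e)^[n] s).1 ∧
      HasEdges (k + 1) (n * (n - 1) * a) ((twistState e)^[n] s).2.1 ∧
        HasEdges k (n * a) ((twistState e)^[n] s).2.2 := by
  induction n with
  | zero => exact ⟨h₁, by simpa using h₂.succ, by simpa using h₃⟩
  | succ n ih =>
    rw [Function.iterate_succ_apply']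
    obtain ⟨i₁, i₂, i₃⟩ := ih
    refine ⟨i₁, ?_, ?_⟩
    · convert i₂.sub ((i₃.mixPoly_mul e).add (i₃.mixPoly_mul e)) using 1
      · push_cast
        ring
      · rfl
    · convert i₁.add (i₃.eigenPoly_mul e) using 1
      · push_cast
        ring
      · rfl

/-- Each twist region with `n` full twists raises the extreme degrees by one and multiplies the sums of
the extreme coefficients by `n ^ 2`. -/
theorem hasEdges_finalState {k : ℕ} {a d : ℤ} (e : Bool) (L : List ℕ)
    {s : Laurent × Laurent × Laurent} (h₁ : HasEdges k a s.1) (h₂ : HasEdges k d s.2.1)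
    (h₃ : HasEdges k 0 s.2.2) :
    HasEdges (k + L.length) (a * (L.map fun n : ℕ => (n : ℤ) ^ 2).prod) (finalState e L s).1 := by
  induction L generalizing e k a d s with
  | nil => simpa [finalState] using h₁
  | cons n L ih =>
    obtain ⟨i₁, i₂, i₃⟩ := hasEdges_twistState e n h₁ h₂ h₃
    -- The first coefficient gets the edges `n * (n - 1) * a` from `i₂` and `n * a` from `i₃`, and
    -- `n * (n - 1) + n = n ^ 2`; the third one has degrees below the new bound, so its edges are `0`.
    have h := ih (!e) (s := switchState e ((twistState e)^[n] s)) (i₂.sub (i₃.mixPoly_mul e))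
      (i₁.succ.sub (i₃.mixPoly_mul e)) (i₃.eigenPoly_mul e).neg.succ
    convert h using 1
    · rw [List.length_cons]
      ring
    · rw [List.map_cons, List.prod_cons]
      ring
    · rfl

theorem span_eq_of_hasEdges {k : ℕ} {a : ℤ} {P : Laurent} (h : HasEdges k a P) (ha : a ≠ 0) :
    span P = 2 * (k : ℤ) := by
  obtain ⟨e, he, hek⟩ := exists_of_degreeSum_ne_zero (h.top.trans_ne ha)
  obtain ⟨e', he', hek'⟩ := exists_of_degreeSum_ne_zero (h.bot.trans_ne ha)
  have hmem : e ∈ P.coeff.support := Finsupp.mem_support_iff.2 he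
  have hmem' : e' ∈ P.coeff.support := Finsupp.mem_support_iff.2 he'
  have hne : P.coeff.support.Nonempty := ⟨e, hmem⟩
  have hle : ∀ f ∈ P.coeff.support, |f.1 - f.2| ≤ (k : ℤ) := fun f hf => by
    by_contra hlt
    exact Finsupp.mem_support_iff.1 hf (h.coeff_eq_zero f (not_le.1 hlt))
  rw [span, dif_pos hne]
  have hsup : P.coeff.support.sup' hne (fun e => e.1 - e.2) = k := by
    refine le_antisymm (Finset.sup'_le _ _ fun f hf => (abs_le.1 (hle f hf)).2) ?_
    rw [← hek]
    exact Finset.le_sup' (fun e : ℤ × ℤ => e.1 - e.2) hmem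
  have hinf : P.coeff.support.inf' hne (fun e => e.1 - e.2) = -k := by
    refine le_antisymm ?_ (Finset.le_inf' _ _ fun f hf => (abs_le.1 (hle f hf)).1)
    rw [← hek']
    exact Finset.inf'_le (fun e : ℤ × ℤ => e.1 - e.2) hmem'
  rw [hsup, hinf]
  ring

/-- The Links–Gould polynomial of a 2-bridge link. -/
noncomputable def twoBridgePoly (L : List ℕ) : Laurent := (finalState true L (1, 0, 0)).1

theorem hasEdges_twoBridgePoly (L : List ℕ) :
    HasEdges L.length (L.map fun n : ℕ => (n : ℤ) ^ 2).prod (twoBridgePoly L) := by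
  have h : HasEdges 0 1 (1 : Laurent) := by
    have h1 : (1 : Laurent) = AddMonoidAlgebra.single 0 1 := rfl
    have h2 : degreeSum 0 (1 : Laurent) = 1 := by
      rw [degreeSum, map_one]
      exact AddMonoidAlgebra.coeff_one_zero
    refine ⟨fun e he => ?_, h2, h2⟩
    rw [h1, AddMonoidAlgebra.coeff_single, Finsupp.single_apply, if_neg]
    rintro rfl
    simp at he
  simpa [twoBridgePoly] using
    hasEdges_finalState (d := 0) true L (s := (1, 0, 0)) h HasEdges.zero HasEdges.zero

theorem hasCutValue_twoBridge {m : ℕ} (b : Fin m → ℕ) :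
    HasCutValue (twoBridge b) (twoBridgePoly (List.ofFn b)).toField := by
  have h := hasCutValue_of_cut (D := twoBridge b) (w₁ := bottomArcs ++ twistRegions b)
    (w₂ := topArcs m) (s := [true, false, true, false]) (by simp [twoBridge])
    (isTangle_bottomArcs.append (isTangle_twistRegions b)) (by simp)
  have hs : wordOp bottomArcs vac = stateVec true (1, 0, 0) := by
    simp only [stateVec, map_one, map_zero, one_smul, zero_smul, add_zero]
    rfl
  have he : (true ^^ decide (Odd m)) = decide (Even m) := by
    simp only [← Nat.not_even_iff_odd]
    by_cases hm : Even m <;> simp [hm]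
  rw [cutLevel_topArcs, wordOp_append, LinearMap.comp_apply, twistRegions_eq, hs, wordOp_regions,
    List.length_ofFn, he, stateVec, sum_add_vec, sum_add_vec, sum_smul_vec, sum_smul_vec,
    sum_smul_vec, topForm_arcVec, topForm_arcVec_not, topForm_twistVec, mul_one, mul_zero,
    mul_zero, add_zero, add_zero, toFieldHom_apply] at h
  exact h

end LinksGould

theorem theorem2p15 (m : ℕ) (hm : 1 ≤ m) (b : Fin m → ℕ) (hb : ∀ i, 0 < b i) :
    ∃ P : LinksGould.Laurent,
      LinksGould.IsLinksGould (LinksGould.twoBridge b).toLink P ∧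
        LinksGould.span P = 2 * (m : ℤ) := by
  refine ⟨LinksGould.twoBridgePoly (List.ofFn b), fun k β hβ => ?_, ?_⟩
  · exact LinksGould.quantumTrace_of_hasCutValue
      (LinksGould.HasCutValue.of_toLink_eq hβ (LinksGould.hasCutValue_twoBridge b))
  · have h := LinksGould.span_eq_of_hasEdges (LinksGould.hasEdges_twoBridgePoly (List.ofFn b))
    rw [List.length_ofFn] at h
    refine h (List.prod_ne_zero fun hz => ?_)
    obtain ⟨n, hn, h0⟩ := List.mem_map.1 hz
    obtain ⟨i, rfl⟩ := (List.mem_ofFn' _ _).1 hn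
    have := hb i
    simp at h0
    omega
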